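/- **Notation.** Write $e(w)=e^{2\pi i w}$. Let $\mathcal H_1$ be the upper half plane and $\mathcal H_2$ the Siegel upper half space of degree two, whose points are written $\Omega=\begin{pmatrix}\tau&z\\z&\omega\end{pmatrix}$. For $k\in\mathbb Z$ and $\sigma=\begin{pmatrix}A&B\\C&D\end{pmatrix}\in \mathrm{Sp}_2(\mathbb R)$ put $(f|_k\sigma)(\Omega)=\det(C\Omega+D)^{-k}f\big((A\Omega+B)(C\Omega+D)^{-1}\big)$. Let $N\ge 1$ be an integer. The paramodular group is $$K(N)=\begin{pmatrix} *&N*&*&*\\ *&*&*&*/N\\ *&N*&*&*\\ N*&N*&N*&*\end{pmatrix}\cap \mathrm{Sp}_2(\mathbb Q),\quad *\in\mathbb Z ,$$ and $M_k(K(N))$ is the complex vector space of holomorphic $f:\mathcal H_2\to\mathbb C$ with $f|_k\sigma=f$ for all $\sigma\in K(N)$. Let $F_N=\frac1{\sqrt N}\begin{pmatrix}0&1\\-N&0\end{pmatrix}$, $\mu_N=\begin{pmatrix}-F_N'&0\\0&F_N\end{pmatrix}$ (where $F_N'$ is the transpose), and, for $\epsilon\in\{1,-1\}$, $M_k(K(N))^{\epsilon}=\{f\in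 M_k(K(N)): f|_k\mu_N=\epsilon f\}$. For $k\in\mathbb Z$ and an integer $m\ge 0$, let $J_{k,m}$ be the space of Jacobi forms of weight $k$ and index $m$: the holomorphic $\phi:\mathcal H_1\times\mathbb C\to\mathbb C$ such that $\tilde\phi(\Omega)=\phi(\tau,z)e(m\omega)$ satisfies $\tilde\phi|_k\sigma=\tilde\phi$ for all $$\sigma\in\begin{pmatrix} *&0&*&*\\ *&*&*&*\\ *&0&*&*\\ 0&0&0&*\end{pmatrix}\cap \mathrm{Sp}_2(\mathbb Z),$$ and whose Fourier series has the form $\phi(\tau,z)=\sum_{n,r\in\mathbb Z:\ n\ge0,\ 4mn\ge r^2}c(n,r;\phi)\,e(n\tau+rz)$. Let $\operatorname{ord}\phi=\min\{n: \exists r,\ c(n,r;\phi)\neq0\}$ ($=\infty$ for $\phi=0$) and, for $j\ge0$, $J_{k,m}(j)=\{\phi\in J_{k,m}:\operatorname{ord}\phi\ge j\}$. Let $\mathbb M_k(N)^{\epsilon}$ be the space of formal series $\Phi=\sum_{m\ge0,\ N\mid m}\phi_m\xi^m$ with $\phi_m\in J_{k,m}$ such that $c(n,r;\phi_m)=\epsilon\,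 c(m/N,-r;\phi_{nN})$ for all $n,r,m\in\mathbb Z$ with $N\mid m$ and $\begin{pmatrix}n&r/2\\r/2&m\end{pmatrix}$ positive semidefinite. For $j\ge 0$ let $\mathbb M_k^{(j)}(N)^{\epsilon}$ be the subspace of those $\Phi$ with $\phi_m=0$ for all $m<Nj$. Finally, let $M_\nu$ be the space of elliptic modular forms of weight $\nu\in\mathbb Z$ for $\mathrm{SL}_2(\mathbb Z)$. Dimensions are over $\mathbb C$; dimensions and sums take values in $\{0,1,2,\dots,\infty\}$. **Lemma 3.2.** Let $N\in\mathbb N$, $N\ge1$, $\epsilon\in\{1,-1\}$, $k\in\mathbb Z$, and set $\delta=0$ if $(-1)^k\epsilon=1$ and $\delta=1$ if $(-1)^k\epsilon=-1$. Then $$\dim M_k(K(N))^{\epsilon}\le\dim\mathbb M_k(N)^{\epsilon}\le\sum_{j=0}^\infty\dim\left(\mathbb M_k^{(j)}(N)^{\epsilon}/\mathbb M_k^{(j+1)}(N)^{\epsilon}\right)\le\sum_{j=0}^\infty\dim J_{k,Nj}(j+\delta)$$ and $$\sum_{j=0}^\infty\dim J_{k,Nj}(j+\delta)\le\begin{cases}\displaystyle\sum_{j=0}^\infty\sum_{i=0}^{Nj}\dim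 M_{k+2i-12(j+\delta)},&k\text{ even},\\[2ex] \displaystyle\sum_{j=1}^\infty\sum_{i=1}^{Nj-1}\dim M_{k-1+2i-12(j+\delta)},&k\text{ odd}.\end{cases}$$ (For $k$ odd and $N=j=1$ the inner sum is empty.) -/

import Mathlib

open Matrix UpperHalfPlane MeasureTheory
open scoped ModularForm MatrixGroups

namespace Paramodular

noncomputable section

/-- `e(w) = exp(2 π i w)`. -/
def e (w : ℂ) : ℂ := Complex.exp (2 * Real.pi * Complex.I * w)

/-! ### The Siegel upper half space of degree two and the action of `Sp₂(ℝ)` -/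

/-- The Siegel upper half space of degree two: symmetric complex `2 × 2` matrices with
positive definite imaginary part. -/
def siegelSet : Set (Matrix (Fin 2) (Fin 2) ℂ) :=
  {Ω | Ωᵀ = Ω ∧ (Ω.map Complex.im).PosDef}

/-- The real matrix `A`, viewed as a complex matrix. -/
def toC {m n : Type*} (A : Matrix m n ℝ) : Matrix m n ℂ := A.map Complex.ofReal

/-- The numerator `A Ω + B` of the action of `g = (A, B; C, D)` on `Ω`. -/
def num (g : symplecticGroup (Fin 2) ℝ) (Ω : Matrix (Fin 2) (Fin 2) ℂ) :
    Matrix (Fin 2) (Fin 2) ℂ :=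
  toC g.1.toBlocks₁₁ * Ω + toC g.1.toBlocks₁₂

/-- The denominator `C Ω + D` of the action of `g = (A, B; C, D)` on `Ω`. -/
def denom (g : symplecticGroup (Fin 2) ℝ) (Ω : Matrix (Fin 2) (Fin 2) ℂ) :
    Matrix (Fin 2) (Fin 2) ℂ :=
  toC g.1.toBlocks₂₁ * Ω + toC g.1.toBlocks₂₂

theorem block_rel (g : symplecticGroup (Fin 2) ℝ) :
    g.1.toBlocks₁₁ᵀ * g.1.toBlocks₂₁ = g.1.toBlocks₂₁ᵀ * g.1.toBlocks₁₁ ∧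
    g.1.toBlocks₁₂ᵀ * g.1.toBlocks₂₂ = g.1.toBlocks₂₂ᵀ * g.1.toBlocks₁₂ ∧
    g.1.toBlocks₁₁ᵀ * g.1.toBlocks₂₂ - g.1.toBlocks₂₁ᵀ * g.1.toBlocks₁₂ = 1 := by
  have h := SymplecticGroup.mem_iff'.1 g.2
  rw [← fromBlocks_toBlocks g.1] at h
  simp only [Matrix.J, fromBlocks_transpose, fromBlocks_multiply, fromBlocks_inj] at h
  obtain ⟨h1, h2, h3, h4⟩ := h
  simp only [Matrix.mul_zero, Matrix.mul_one, zero_add, Matrix.mul_neg, add_zero,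
    Matrix.neg_mul] at h1 h2 h3 h4
  refine ⟨?_, ?_, ?_⟩
  · exact (sub_eq_zero.1 (by rw [← h1]; abel)).symm
  · exact (sub_eq_zero.1 (by rw [← h4]; abel)).symm
  · rw [← neg_inj, ← h2]; abel

theorem toC_mul (A B : Matrix (Fin 2) (Fin 2) ℝ) : toC (A * B) = toC A * toC B :=
  Matrix.map_mul (f := Complex.ofRealHom)

theorem toC_transpose (A : Matrix (Fin 2) (Fin 2) ℝ) : toC Aᵀ = (toC A)ᵀ := rfl

theorem toC_sub (A B : Matrix (Fin 2) (Fin 2) ℝ) : toC (A - B) = toC A - toC B :=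
  Matrix.map_sub Complex.ofReal (by simp) A B

theorem toC_one : toC (1 : Matrix (Fin 2) (Fin 2) ℝ) = 1 :=
  Matrix.map_one Complex.ofReal rfl rfl

theorem block_relC (g : symplecticGroup (Fin 2) ℝ) :
    (toC g.1.toBlocks₁₁)ᵀ * toC g.1.toBlocks₂₁ = (toC g.1.toBlocks₂₁)ᵀ * toC g.1.toBlocks₁₁ ∧
    (toC g.1.toBlocks₁₂)ᵀ * toC g.1.toBlocks₂₂ = (toC g.1.toBlocks₂₂)ᵀ * toC g.1.toBlocks₁₂ ∧
    (toC g.1.toBlocks₁₁)ᵀ * toC g.1.toBlocks₂₂ =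
      1 + (toC g.1.toBlocks₂₁)ᵀ * toC g.1.toBlocks₁₂ ∧
    (toC g.1.toBlocks₂₂)ᵀ * toC g.1.toBlocks₁₁ =
      1 + (toC g.1.toBlocks₁₂)ᵀ * toC g.1.toBlocks₂₁ := by
  obtain ⟨h1, h2, h3⟩ := block_rel g
  have h3' := congrArg toC h3
  rw [toC_sub, toC_mul, toC_mul, toC_one, toC_transpose, toC_transpose, sub_eq_iff_eq_add] at h3'
  refine ⟨?_, ?_, h3', ?_⟩
  · simpa only [toC_mul, toC_transpose] using congrArg toC h1
  · simpa only [toC_mul, toC_transpose] using congrArg toC h2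
  · simpa using congrArg Matrix.transpose h3'

/-- The two fundamental relations between numerator and denominator, for two symmetric
matrices `Ω`, `Ω'`. -/
theorem num_denom (g : symplecticGroup (Fin 2) ℝ) {Ω Ω' : Matrix (Fin 2) (Fin 2) ℂ}
    (h : Ωᵀ = Ω) :
    (num g Ω)ᵀ * denom g Ω' - (denom g Ω)ᵀ * num g Ω' = Ω - Ω' := by
  obtain ⟨h1, h2, h3, h4⟩ := block_relC g
  simp only [num, denom, transpose_add, transpose_mul, h, add_mul, mul_add]
  generalize toC g.1.toBlocks₁₁ = A at *
  generalize toC g.1.toBlocks₁₂ = B at *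
  generalize toC g.1.toBlocks₂₁ = C at *
  generalize toC g.1.toBlocks₂₂ = D at *
  have e1 : Ω * Aᵀ * (C * Ω') = Ω * Cᵀ * (A * Ω') := by
    rw [Matrix.mul_assoc, ← Matrix.mul_assoc Aᵀ, h1]; simp only [Matrix.mul_assoc]
  have e2 : Ω * Aᵀ * D = Ω + Ω * Cᵀ * B := by
    rw [Matrix.mul_assoc, h3, Matrix.mul_add, Matrix.mul_one, Matrix.mul_assoc]
  have e3 : Dᵀ * (A * Ω') = Ω' + Bᵀ * (C * Ω') := by
    rw [← Matrix.mul_assoc, h4, Matrix.add_mul, Matrix.one_mul, Matrix.mul_assoc]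
  rw [e1, e2, e3, h2]
  abel

/-- Complex conjugation of the entries of a matrix. -/
theorem conj_num_denom (g : symplecticGroup (Fin 2) ℝ) (Ω : Matrix (Fin 2) (Fin 2) ℂ) :
    (num g Ω).map (starRingEnd ℂ) = num g (Ω.map (starRingEnd ℂ)) ∧
    (denom g Ω).map (starRingEnd ℂ) = denom g (Ω.map (starRingEnd ℂ)) := by
  constructor <;>
  · ext i j
    simp [num, denom, toC, Matrix.mul_apply]

theorem posDef_complex {Y : Matrix (Fin 2) (Fin 2) ℝ} (hY : Y.PosDef) {v : Fin 2 → ℂ}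
    (hv : v ≠ 0) : 0 < (v ⬝ᵥ (toC Y *ᵥ (fun i => starRingEnd ℂ (v i)))).re := by
  have key : (v ⬝ᵥ (toC Y *ᵥ (fun i => starRingEnd ℂ (v i)))).re =
      (fun i => (v i).re) ⬝ᵥ (Y *ᵥ (fun i => (v i).re)) +
      (fun i => (v i).im) ⬝ᵥ (Y *ᵥ (fun i => (v i).im)) := by
    simp [toC, dotProduct, mulVec, Fin.sum_univ_two]
    ring
  rw [key]
  have nn : ∀ x : Fin 2 → ℝ, 0 ≤ x ⬝ᵥ (Y *ᵥ x) := fun x => by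
    by_cases hx : x = 0
    · simp [hx]
    · simpa using (hY.dotProduct_mulVec_pos hx).le
  by_cases hr : (fun i => (v i).re) = 0
  · have hi : (fun i => (v i).im) ≠ 0 := by
      intro hi
      apply hv
      ext i
      exact Complex.ext (congrFun hr i) (congrFun hi i)
    have := hY.dotProduct_mulVec_pos hi
    simp only [star_trivial] at this
    linarith [nn (fun i => (v i).re)]
  · have := hY.dotProduct_mulVec_pos hr
    simp only [star_trivial] at this
    linarith [nn (fun i => (v i).im)]

theorem sub_conj (Ω : Matrix (Fin 2) (Fin 2) ℂ) :
    Ω - Ω.map (starRingEnd ℂ) = (2 * Complex.I) • toC (Ω.map Complex.im) := by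
  ext i j
  simp only [Matrix.sub_apply, Matrix.map_apply, Matrix.smul_apply, toC, smul_eq_mul, Complex.sub_conj]
  push_cast
  ring

theorem isUnit_denom (g : symplecticGroup (Fin 2) ℝ) {Ω : Matrix (Fin 2) (Fin 2) ℂ}
    (hΩ : Ω ∈ siegelSet) : IsUnit (denom g Ω) := by
  rw [Matrix.isUnit_iff_isUnit_det, isUnit_iff_ne_zero]
  intro h0
  obtain ⟨v, hv, hv0⟩ := Matrix.exists_mulVec_eq_zero_iff.2 h0
  have hrel := num_denom g (Ω' := Ω.map (starRingEnd ℂ)) hΩ.1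
  rw [sub_conj] at hrel
  set w : Fin 2 → ℂ := fun i => starRingEnd ℂ (v i) with hw
  have hc : denom g (Ω.map (starRingEnd ℂ)) *ᵥ w = 0 := by
    rw [← (conj_num_denom g Ω).2]
    ext i
    have := congrArg (starRingEnd ℂ) (congrFun hv0 i)
    simpa [mulVec, dotProduct, hw] using this
  have hd : v ᵥ* (denom g Ω)ᵀ = 0 := by rw [vecMul_transpose, hv0]
  have := congrArg (fun M => v ⬝ᵥ (M *ᵥ w)) hrel
  simp only [sub_mulVec, ← mulVec_mulVec, hc, mulVec_zero, zero_sub, dotProduct_neg,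
    dotProduct_mulVec v, hd, zero_dotProduct, neg_zero, smul_mulVec, dotProduct_smul] at this
  have hp := posDef_complex hΩ.2 hv
  rw [← dotProduct_mulVec] at this
  have h2 : (2 * Complex.I : ℂ) ≠ 0 := by simp
  rw [eq_comm, smul_eq_zero, or_iff_right h2] at this
  rw [← hw, this] at hp
  exact lt_irrefl _ hp

/-- The upper half space is stable under `Ω ↦ (A Ω + B) (C Ω + D)⁻¹`. -/
theorem moebius_mem (g : symplecticGroup (Fin 2) ℝ) {Ω : Matrix (Fin 2) (Fin 2) ℂ}
    (hΩ : Ω ∈ siegelSet) : num g Ω * (denom g Ω)⁻¹ ∈ siegelSet := by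
  have hu := isUnit_denom g hΩ
  have hdet : IsUnit (denom g Ω).det := (Matrix.isUnit_iff_isUnit_det _).1 hu
  set P := num g Ω with hP
  set Q := denom g Ω with hQ
  have hQt : IsUnit Qᵀ.det := by rwa [det_transpose]
  have hs : Pᵀ * Q = Qᵀ * P := by
    have := num_denom g (Ω' := Ω) hΩ.1
    rwa [sub_self, sub_eq_zero] at this
  have hsym : (P * Q⁻¹)ᵀ = P * Q⁻¹ := by
    rw [transpose_mul, transpose_nonsing_inv]
    have : Pᵀ = Qᵀ * P * Q⁻¹ := by
      rw [← hs, Matrix.mul_assoc, Matrix.mul_nonsing_inv _ hdet, Matrix.mul_one]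
    rw [this, ← Matrix.mul_assoc, ← Matrix.mul_assoc, Matrix.nonsing_inv_mul _ hQt,
      Matrix.one_mul]
  refine ⟨hsym, ?_⟩
  set W := P * Q⁻¹ with hW
  have hWQ : W * Q = P := by
    rw [hW, Matrix.mul_assoc, Matrix.nonsing_inv_mul _ hdet, Matrix.mul_one]
  have hrel := num_denom g (Ω' := Ω.map (starRingEnd ℂ)) hΩ.1
  rw [← (conj_num_denom g Ω).1, ← (conj_num_denom g Ω).2, ← hP, ← hQ, sub_conj] at hrel
  have hcP : P.map (starRingEnd ℂ) = W.map (starRingEnd ℂ) * Q.map (starRingEnd ℂ) := by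
    rw [← hWQ, Matrix.map_mul]
  have hPt : Pᵀ = Qᵀ * W := by rw [← hWQ, transpose_mul, hsym]
  have hfin : Qᵀ * toC (W.map Complex.im) * Q.map (starRingEnd ℂ) = toC (Ω.map Complex.im) := by
    have h2 : (2 * Complex.I : ℂ) ≠ 0 := by simp
    apply smul_right_injective _ h2
    simp only
    rw [← hrel, hcP, hPt, Matrix.mul_assoc Qᵀ W, ← Matrix.mul_sub, ← Matrix.sub_mul, sub_conj W,
      Matrix.smul_mul, Matrix.mul_smul, Matrix.mul_assoc]
  rw [posDef_iff_dotProduct_mulVec]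
  refine ⟨?_, ?_⟩
  · ext i j
    have := congrFun (congrFun hsym i) j
    simp only [transpose_apply] at this
    simp [conjTranspose_apply, this]
  · intro x hx
    simp only [star_trivial]
    set v : Fin 2 → ℂ := Q⁻¹ *ᵥ (fun i => (x i : ℂ)) with hv
    have hQv : Q *ᵥ v = fun i => (x i : ℂ) := by
      rw [hv, mulVec_mulVec, Matrix.mul_nonsing_inv _ hdet, one_mulVec]
    have hv0 : v ≠ 0 := by
      intro h
      rw [h, mulVec_zero] at hQv
      apply hx
      ext i
      have := congrFun hQv i
      simp only [Pi.zero_apply] at this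
      exact_mod_cast this.symm
    have hp := posDef_complex hΩ.2 hv0
    have hcQ : Q.map (starRingEnd ℂ) *ᵥ (fun i => starRingEnd ℂ (v i)) = fun i => (x i : ℂ) := by
      ext i
      have := congrArg (starRingEnd ℂ) (congrFun hQv i)
      simpa [mulVec, dotProduct] using this
    rw [← hfin, ← mulVec_mulVec, hcQ, ← mulVec_mulVec, dotProduct_mulVec, vecMul_transpose,
      hQv] at hp
    have : ((fun i => (x i : ℂ)) ⬝ᵥ (toC (W.map Complex.im) *ᵥ (fun i => (x i : ℂ)))).re =
        x ⬝ᵥ (W.map Complex.im *ᵥ x) := by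
      simp [toC, dotProduct, mulVec, Fin.sum_univ_two]
    rwa [this] at hp

/-- The action `Ω ↦ (A Ω + B) (C Ω + D)⁻¹` of `Sp₂(ℝ)` on the Siegel upper half space. -/
def moebius (g : symplecticGroup (Fin 2) ℝ) (Ω : siegelSet) : siegelSet :=
  ⟨num g Ω.1 * (denom g Ω.1)⁻¹, moebius_mem g Ω.2⟩

/-- The slash action `(f |ₖ g)(Ω) = det(C Ω + D)⁻ᵏ f((A Ω + B) (C Ω + D)⁻¹)`. -/
def slash (k : ℤ) (g : symplecticGroup (Fin 2) ℝ) (f : siegelSet → ℂ) : siegelSet → ℂ :=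
  fun Ω => (denom g Ω.1).det ^ (-k) * f (moebius g Ω)

theorem slash_add (k : ℤ) (g : symplecticGroup (Fin 2) ℝ) (f f' : siegelSet → ℂ) :
    slash k g (f + f') = slash k g f + slash k g f' := by
  ext Ω; simp [slash, mul_add]

theorem slash_smul (k : ℤ) (g : symplecticGroup (Fin 2) ℝ) (c : ℂ) (f : siegelSet → ℂ) :
    slash k g (c • f) = c • slash k g f := by
  ext Ω; simp [slash, mul_left_comm]

theorem slash_zero (k : ℤ) (g : symplecticGroup (Fin 2) ℝ) : slash k g 0 = 0 := by
  ext Ω; simp [slash]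

open Classical in
/-- A function on the Siegel upper half space, in the coordinates `(τ, z, ω)` of
`Ω = (τ, z; z, ω)` (and extended by zero). -/
def coordFun (f : siegelSet → ℂ) (p : ℂ × ℂ × ℂ) : ℂ :=
  if h : !![p.1, p.2.1; p.2.1, p.2.2] ∈ siegelSet then f ⟨_, h⟩ else 0

/-- `f` is holomorphic on the Siegel upper half space. -/
def IsHolomorphic (f : siegelSet → ℂ) : Prop :=
  DifferentiableOn ℂ (coordFun f) {p | !![p.1, p.2.1; p.2.1, p.2.2] ∈ siegelSet}

theorem coordFun_add (f g : siegelSet → ℂ) : coordFun (f + g) = coordFun f + coordFun g := by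
  ext p
  by_cases h : !![p.1, p.2.1; p.2.1, p.2.2] ∈ siegelSet <;> simp [coordFun, h]

theorem coordFun_smul (c : ℂ) (f : siegelSet → ℂ) : coordFun (c • f) = c • coordFun f := by
  ext p
  by_cases h : !![p.1, p.2.1; p.2.1, p.2.2] ∈ siegelSet <;> simp [coordFun, h]

theorem coordFun_zero : coordFun 0 = 0 := by
  ext p
  by_cases h : !![p.1, p.2.1; p.2.1, p.2.2] ∈ siegelSet <;> simp [coordFun, h]

/-! ### Paramodular forms -/

/-- The paramodular group `K(N)`: the symplectic matrices of the shape
`(*, N*, *, *; *, *, *, */N; *, N*, *, *; N*, N*, N*, *)` with integers `*`. -/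
def paramodularGroup (N : ℕ) : Set (symplecticGroup (Fin 2) ℝ) :=
  {g | ∃ a : Matrix (Fin 4) (Fin 4) ℤ, g.1 = fromBlocks
    !![(a 0 0 : ℝ), N * a 0 1; a 1 0, a 1 1]
    !![(a 0 2 : ℝ), a 0 3; a 1 2, a 1 3 / N]
    !![(a 2 0 : ℝ), N * a 2 1; N * a 3 0, N * a 3 1]
    !![(a 2 2 : ℝ), a 2 3; N * a 3 2, a 3 3]}

/-- The Fricke matrix `F_N = N^(-1/2) (0, 1; -N, 0)`. -/
def fricke (N : ℕ) : Matrix (Fin 2) (Fin 2) ℝ :=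
  (1 / Real.sqrt N) • !![0, 1; -(N : ℝ), 0]

theorem mu_mem (N : ℕ) [NeZero N] :
    fromBlocks (-(fricke N)ᵀ) 0 0 (fricke N) ∈ symplecticGroup (Fin 2) ℝ := by
  have hN : (N : ℝ) ≠ 0 := NeZero.ne _
  have hs : (Real.sqrt N)⁻¹ * (Real.sqrt N)⁻¹ = (N : ℝ)⁻¹ := by
    rw [← mul_inv, Real.mul_self_sqrt (Nat.cast_nonneg N)]
  have hF : (fricke N) * (fricke N) = -1 := by
    have h2 : !![(0 : ℝ), 1; -(N : ℝ), 0] * !![(0 : ℝ), 1; -(N : ℝ), 0] = -(N : ℝ) • 1 := by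
      ext i j
      fin_cases i <;> fin_cases j <;> simp [Matrix.mul_apply, Fin.sum_univ_two]
    rw [fricke, Matrix.smul_mul, Matrix.mul_smul, h2, smul_smul, one_div, hs, smul_smul]
    simp [hN]
  rw [SymplecticGroup.mem_iff]
  simp [Matrix.J, fromBlocks_transpose, fromBlocks_multiply, ← transpose_mul, hF]

/-- The normalizer `μ_N = (-F_N', 0; 0, F_N)` of the paramodular group. -/
def mu (N : ℕ) [NeZero N] : symplecticGroup (Fin 2) ℝ :=
  ⟨fromBlocks (-(fricke N)ᵀ) 0 0 (fricke N), mu_mem N⟩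

/-- `M_k(K(N))`: the paramodular forms of weight `k` and level `N`. -/
def paramodularForms (N : ℕ) (k : ℤ) : Submodule ℂ (siegelSet → ℂ) where
  carrier := {f | IsHolomorphic f ∧ ∀ g ∈ paramodularGroup N, slash k g f = f}
  add_mem' := by
    rintro f f' ⟨h1, h2⟩ ⟨h1', h2'⟩
    refine ⟨?_, fun g hg => by rw [slash_add, h2 g hg, h2' g hg]⟩
    rw [IsHolomorphic, coordFun_add]
    exact h1.add h1'
  zero_mem' := by
    refine ⟨?_, fun g _ => slash_zero k g⟩
    rw [IsHolomorphic, coordFun_zero]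
    exact differentiableOn_const 0
  smul_mem' := by
    rintro c f ⟨h1, h2⟩
    refine ⟨?_, fun g hg => by rw [slash_smul, h2 g hg]⟩
    rw [IsHolomorphic, coordFun_smul]
    exact h1.const_smul c

/-- `M_k(K(N))^ε = {f ∈ M_k(K(N)) : f |ₖ μ_N = ε f}`. -/
def paramodularFormsSign (N : ℕ) [NeZero N] (k : ℤ) (ε : ℤˣ) : Submodule ℂ (siegelSet → ℂ) where
  carrier := {f | f ∈ paramodularForms N k ∧ slash k (mu N) f = ((ε : ℤ) : ℂ) • f}
  add_mem' := by
    rintro f f' ⟨h1, h2⟩ ⟨h1', h2'⟩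
    exact ⟨add_mem h1 h1', by rw [slash_add, h2, h2', smul_add]⟩
  zero_mem' := ⟨zero_mem _, by rw [slash_zero, smul_zero]⟩
  smul_mem' := by
    rintro c f ⟨h1, h2⟩
    exact ⟨Submodule.smul_mem _ c h1, by rw [slash_smul, h2, smul_comm]⟩

/-! ### Jacobi forms -/

/-- The group `Jac` of the matrices of `Sp₂(ℤ)` of the shape
`(*, 0, *, *; *, *, *, *; *, 0, *, *; 0, 0, 0, *)`. -/
def jacobiGroup : Set (symplecticGroup (Fin 2) ℝ) :=
  {g | ∃ a : Matrix (Fin 4) (Fin 4) ℤ, g.1 = fromBlocks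
    !![(a 0 0 : ℝ), 0; a 1 0, a 1 1]
    !![(a 0 2 : ℝ), a 0 3; a 1 2, a 1 3]
    !![(a 2 0 : ℝ), 0; 0, 0]
    !![(a 2 2 : ℝ), a 2 3; 0, a 3 3]}

/-- The coordinate `τ` of `Ω = (τ, z; z, ω)`. -/
def tau (Ω : siegelSet) : ℍ := ⟨Ω.1 0 0, Ω.2.2.diag_pos (i := 0)⟩

/-- The function `φ~(τ, z; z, ω) = φ(τ, z) e(m ω)`. -/
def tilde (m : ℕ) (φ : ℍ × ℂ → ℂ) : siegelSet → ℂ :=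
  fun Ω => φ (tau Ω, Ω.1 0 1) * e (m * Ω.1 1 1)

/-- `φ` is holomorphic on `ℍ × ℂ`. -/
def IsHolomorphicJ (φ : ℍ × ℂ → ℂ) : Prop :=
  DifferentiableOn ℂ (fun p : ℂ × ℂ => φ (ofComplex p.1, p.2)) {p | 0 < p.1.im}

/-- The Fourier coefficient `c(n, r; φ)` of `e(n τ + r z)` in `φ(τ, z)`, for `φ` holomorphic and
of period one in both variables. By Cauchy's theorem any line `Im τ = const > 0`, `Im z = const`
gives the same value; here `Im τ = 1` and `Im z = 0`. -/
def coeff (n r : ℤ) (φ : ℍ × ℂ → ℂ) : ℂ :=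
  ∫ p in Set.Icc (0 : ℝ) 1 ×ˢ Set.Icc (0 : ℝ) 1,
    φ (p.1 +ᵥ UpperHalfPlane.I, (p.2 : ℂ)) * e (-(n * (p.1 + Complex.I) + r * p.2))

theorem IsHolomorphicJ.integrableOn {φ : ℍ × ℂ → ℂ} (h : IsHolomorphicJ φ) (n r : ℤ) :
    IntegrableOn (fun p : ℝ × ℝ =>
      φ (p.1 +ᵥ UpperHalfPlane.I, (p.2 : ℂ)) * e (-(n * (p.1 + Complex.I) + r * p.2)))
      (Set.Icc (0 : ℝ) 1 ×ˢ Set.Icc (0 : ℝ) 1) := by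
  apply ContinuousOn.integrableOn_compact (isCompact_Icc.prod isCompact_Icc)
  apply Continuous.continuousOn
  have h1 : Continuous (fun p : ℝ × ℝ => φ (p.1 +ᵥ UpperHalfPlane.I, (p.2 : ℂ))) := by
    have h2 := h.continuousOn.comp_continuous
      (f := fun p : ℝ × ℝ => ((p.1 : ℂ) + Complex.I, (p.2 : ℂ))) (by fun_prop)
      (fun p => by simp)
    refine h2.congr fun p => ?_
    have : ((p.1 : ℂ) + Complex.I) = ((p.1 +ᵥ UpperHalfPlane.I : ℍ) : ℂ) := by simp
    simp only [Function.comp_apply, this, ofComplex_apply]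
  refine h1.mul ?_
  unfold e
  fun_prop

theorem coeff_add {φ ψ : ℍ × ℂ → ℂ} (hφ : IsHolomorphicJ φ) (hψ : IsHolomorphicJ ψ) (n r : ℤ) :
    coeff n r (φ + ψ) = coeff n r φ + coeff n r ψ := by
  unfold coeff
  rw [← integral_add (hφ.integrableOn n r) (hψ.integrableOn n r)]
  simp [add_mul]

theorem coeff_smul (c : ℂ) (φ : ℍ × ℂ → ℂ) (n r : ℤ) :
    coeff n r (c • φ) = c * coeff n r φ := by
  unfold coeff
  rw [← integral_const_mul]
  simp [mul_assoc]

theorem coeff_zero (n r : ℤ) : coeff n r 0 = 0 := by simp [coeff]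

/-- `J_{k,m}`: the Jacobi forms of weight `k` and index `m`. -/
def jacobiForms (k : ℤ) (m : ℕ) : Submodule ℂ (ℍ × ℂ → ℂ) where
  carrier := {φ | IsHolomorphicJ φ ∧
    (∀ g ∈ jacobiGroup, slash k g (tilde m φ) = tilde m φ) ∧
    (∀ n r : ℤ, ¬ (0 ≤ n ∧ r ^ 2 ≤ 4 * m * n) → coeff n r φ = 0) ∧
    ∀ (τ : ℍ) (z : ℂ),
      HasSum (fun p : ℤ × ℤ => coeff p.1 p.2 φ * e (p.1 * τ + p.2 * z)) (φ (τ, z))}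
  add_mem' := by
    rintro φ ψ ⟨h1, h2, h3, h4⟩ ⟨h1', h2', h3', h4'⟩
    refine ⟨h1.add h1', fun g hg => ?_, fun n r h => ?_, fun τ z => ?_⟩
    · have : tilde m (φ + ψ) = tilde m φ + tilde m ψ := by ext Ω; simp [tilde, add_mul]
      rw [this, slash_add, h2 g hg, h2' g hg]
    · rw [coeff_add h1 h1', h3 n r h, h3' n r h, add_zero]
    · simpa only [coeff_add h1 h1', add_mul, Pi.add_apply] using (h4 τ z).add (h4' τ z)
  zero_mem' := by
    refine ⟨differentiableOn_const 0, fun g _ => ?_, fun n r _ => coeff_zero n r, fun τ z => ?_⟩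
    · have : tilde m 0 = 0 := by ext Ω; simp [tilde]
      rw [this, slash_zero]
    · simpa only [coeff_zero, zero_mul, Pi.zero_apply] using hasSum_zero
  smul_mem' := by
    rintro c φ ⟨h1, h2, h3, h4⟩
    refine ⟨h1.const_smul c, fun g hg => ?_, fun n r h => ?_, fun τ z => ?_⟩
    · have : tilde m (c • φ) = c • tilde m φ := by ext Ω; simp [tilde, mul_assoc]
      rw [this, slash_smul, h2 g hg]
    · rw [coeff_smul, h3 n r h, mul_zero]
    · simpa only [coeff_smul, mul_assoc, Pi.smul_apply, smul_eq_mul] using (h4 τ z).mul_left c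

/-- `ord φ = min {n : ∃ r, c(n, r; φ) ≠ 0}`, which is `∞` for `φ = 0`. -/
def ord (φ : ℍ × ℂ → ℂ) : ℕ∞ :=
  ⨅ (n : ℕ) (_ : ∃ r : ℤ, coeff n r φ ≠ 0), (n : ℕ∞)

theorem le_ord_iff {φ : ℍ × ℂ → ℂ} {j : ℕ} :
    (j : ℕ∞) ≤ ord φ ↔ ∀ n : ℕ, n < j → ∀ r : ℤ, coeff n r φ = 0 := by
  simp only [ord, le_iInf_iff, Nat.cast_le]
  constructor
  · intro h n hn r
    by_contra hne
    exact absurd (h n ⟨r, hne⟩) (by omega)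
  · rintro h n ⟨r, hr⟩
    by_contra hlt
    exact hr (h n (by omega) r)

/-- `J_{k,m}(j) = {φ ∈ J_{k,m} : ord φ ≥ j}`. -/
def jacobiFormsOrd (k : ℤ) (m j : ℕ) : Submodule ℂ (ℍ × ℂ → ℂ) where
  carrier := {φ | φ ∈ jacobiForms k m ∧ (j : ℕ∞) ≤ ord φ}
  add_mem' := by
    rintro φ ψ ⟨h1, h2⟩ ⟨h1', h2'⟩
    rw [le_ord_iff] at h2 h2'
    refine ⟨add_mem h1 h1', le_ord_iff.2 fun n hn r => ?_⟩
    rw [coeff_add h1.1 h1'.1, h2 n hn r, h2' n hn r, add_zero]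
  zero_mem' := ⟨zero_mem _, le_ord_iff.2 fun n _ r => coeff_zero n r⟩
  smul_mem' := by
    rintro c φ ⟨h1, h2⟩
    rw [le_ord_iff] at h2
    refine ⟨Submodule.smul_mem _ c h1, le_ord_iff.2 fun n hn r => ?_⟩
    rw [coeff_smul, h2 n hn r, mul_zero]

/-! ### Formal series of Jacobi forms -/

/-- The formal series `Φ = ∑_{m ≥ 0, N ∣ m} φ_m ξ^m` with `φ_m ∈ J_{k,m}`. The coefficient
`φ_m` with `m = N l` is `Φ l`. -/
def FormalSeries (N : ℕ) (k : ℤ) : Type := (l : ℕ) → jacobiForms k (N * l)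

instance (N : ℕ) (k : ℤ) : AddCommGroup (FormalSeries N k) :=
  inferInstanceAs (AddCommGroup ((l : ℕ) → jacobiForms k (N * l)))

instance (N : ℕ) (k : ℤ) : Module ℂ (FormalSeries N k) :=
  inferInstanceAs (Module ℂ ((l : ℕ) → jacobiForms k (N * l)))

/-- `𝕄_k(N)^ε`: the formal series which satisfy the Involution(`ε`) condition
`c(n, r; φ_m) = ε c(m / N, -r; φ_{n N})` for all positive semidefinite `(n, r/2; r/2, m)` with
`n, r, m ∈ ℤ` and `N ∣ m`; here `m = N l`, and semidefiniteness says that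
`0 ≤ n`, `0 ≤ m` and `r² ≤ 4 n m`. -/
def formalForms (N : ℕ) (k : ℤ) (ε : ℤˣ) : Submodule ℂ (FormalSeries N k) where
  carrier := {Φ | ∀ (n l : ℕ) (r : ℤ), r ^ 2 ≤ 4 * n * (N * l) →
    coeff n r (Φ l).1 = ((ε : ℤ) : ℂ) * coeff l (-r) (Φ n).1}
  add_mem' := by
    intro Φ Ψ h h' n l r hr
    have e1 := coeff_add (Φ l).2.1 (Ψ l).2.1 n r
    have e2 := coeff_add (Φ n).2.1 (Ψ n).2.1 l (-r)
    rw [h n l r hr, h' n l r hr, ← mul_add] at e1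
    rw [← e2] at e1
    exact e1
  zero_mem' := by
    intro n l r _
    have e1 := coeff_zero n r
    have e2 := coeff_zero l (-r)
    exact e1.trans (by rw [← mul_zero (((ε : ℤ) : ℂ)), ← e2]; rfl)
  smul_mem' := by
    intro c Φ h n l r hr
    have e1 := coeff_smul c (Φ l).1 n r
    have e2 := coeff_smul c (Φ n).1 l (-r)
    rw [h n l r hr, mul_left_comm, ← e2] at e1
    exact e1

/-- `𝕄_k^{(j)}(N)^ε`: the elements of `𝕄_k(N)^ε` of the form `∑_{m ≥ N j, N ∣ m} φ_m ξ^m`. -/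
def formalFormsFil (N : ℕ) (k : ℤ) (ε : ℤˣ) (j : ℕ) : Submodule ℂ (FormalSeries N k) where
  carrier := {Φ | Φ ∈ formalForms N k ε ∧ ∀ l < j, Φ l = 0}
  add_mem' := by
    rintro Φ Ψ ⟨h1, h2⟩ ⟨h1', h2'⟩
    exact ⟨add_mem h1 h1', fun l hl =>
      (congrArg₂ (· + ·) (h2 l hl) (h2' l hl)).trans (add_zero 0)⟩
  zero_mem' := ⟨zero_mem _, fun _ _ => rfl⟩
  smul_mem' := by
    rintro c Φ ⟨h1, h2⟩
    exact ⟨Submodule.smul_mem _ c h1, fun l hl =>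
      (congrArg (c • ·) (h2 l hl)).trans (smul_zero c)⟩

/-! ### Dimensions -/

/-- The dimension of a complex vector space, in `{0, 1, 2, …, ∞}`. -/
def dim (V : Type*) [AddCommGroup V] [Module ℂ V] : ℕ∞ :=
  Cardinal.toENat (Module.rank ℂ V)

/-- The dimension of the space `M_k` of elliptic modular forms of weight `k` for `SL₂(ℤ)`. -/
def dimM (k : ℤ) : ℕ∞ := dim (ModularForm 𝒮ℒ k)

/-- Every series in `{0, 1, 2, …, ∞}` has a sum, so that `∑'` never takes a junk value. -/
theorem hasSum_enat {ι : Type*} (f : ι → ℕ∞) : HasSum f (⨆ s : Finset ι, ∑ i ∈ s, f i) :=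
  tendsto_atTop_iSup fun _ _ h => Finset.sum_le_sum_of_subset h

/-- `δ = 0` if `(-1)^k ε = 1` and `δ = 1` if `(-1)^k ε = -1`. -/
def delta (k : ℤ) (ε : ℤˣ) : ℕ := if (-1 : ℤˣ) ^ k * ε = 1 then 0 else 1

end

end Paramodular

/-!
Every space of forms in the theorem is embedded into a more elementary one by means of a Fourier
or Taylor expansion.

A paramodular form `f` is invariant under the translations of a lattice of symmetric matrices.
Averaging over the real torus gives an absolutely convergent expansion with coefficients
`a(n, r, l)` and exponents `nτ + rz + Nlω` (`exists_fourier_expansion`, `exists_isExpansion`); the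
Koecher principle `IsExpansion.koecher`, a consequence of the invariance under a unipotent group of
substitutions, restricts the support to the positive semidefinite indices. Collecting the terms
with the same `l` gives Jacobi forms of index `Nl`, and `f |ₖ μ_N = ε f` becomes the involution
condition `IsExpansion.involution`. Hence `f` is determined by an element of `𝕄_k(N)^ε`
(`dim_paramodularFormsSign_le`).

The filtration of `𝕄_k(N)^ε` by the index of the leading coefficient is separated, which bounds
the dimension by the sum over the graded pieces (`dim_le_tsum_graded`). The leading coefficient
`φ_{Nj}` of an element of the `j`-th step determines its class in the graded piece, and the
involution condition forces its order to be at least `j + δ` (`leading_mem_jacobiFormsOrd`).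

Finally, for a Jacobi form `φ` of weight `k`, index `m` and order at least `j`, the first
non-vanishing Taylor coefficient of `z ↦ φ(τ, z)`, say the `ν`-th, is a modular form of weight
`k + ν` which vanishes to order `j` at the cusp; dividing by `Δ^j` gives a modular form of weight
`k + ν - 12 j` (`taylorForm`). Only the `ν` with the parity of `k` occur. If the Taylor
coefficients with `ν ≤ 2m` vanish (`ν ≤ 2m - 2` in odd weight), then so does `φ`: the elliptic
transformation confines the first non-zero row `c(n, ·)` of Fourier coefficients to `|r| ≤ m`
(`|r| < m` in odd weight), and a Vandermonde determinant shows that such a row with vanishing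
moments is zero (`eq_zero_of_taylor`). Filtering by the order of vanishing at `z = 0` gives the
bounds `dim_jacobiFormsOrd_le_of_even` and `dim_jacobiFormsOrd_le_of_odd`.
-/

namespace Paramodular

open Filter Topology
open scoped Manifold

section Torus

-- the torus carries its Haar measure of total mass one, as in the theory of `mFourier`

attribute [local instance] instMeasureSpaceUnitAddCircle

local instance : (volume : Measure UnitAddCircle).IsAddHaarMeasure :=
  inferInstanceAs (Measure.IsAddHaarMeasure AddCircle.haarAddCircle)

local instance : IsProbabilityMeasure (volume : Measure UnitAddCircle) :=
  inferInstanceAs (IsProbabilityMeasure AddCircle.haarAddCircle)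

variable {d : ℕ}

/-! ### The exponential `e` -/

theorem e_add (v w : ℂ) : e (v + w) = e v * e w := by
  rw [e, e, e, ← Complex.exp_add, mul_add]

theorem e_zero : e 0 = 1 := by simp [e]

theorem e_ne_zero (w : ℂ) : e w ≠ 0 := Complex.exp_ne_zero _

theorem e_neg (w : ℂ) : e (-w) = (e w)⁻¹ := by
  rw [e, e, ← Complex.exp_neg, mul_neg]

theorem e_int (n : ℤ) : e n = 1 := by
  rw [e, mul_comm, Complex.exp_int_mul_two_pi_mul_I]

theorem norm_e (w : ℂ) : ‖e w‖ = Real.exp (-(2 * Real.pi * w.im)) := by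
  rw [e, Complex.norm_exp]
  congr 1
  simp [Complex.mul_re, Complex.mul_im]

theorem differentiable_e : Differentiable ℂ e := by
  unfold e
  fun_prop

theorem continuous_e : Continuous e := differentiable_e.continuous

theorem hasDerivAt_e (w : ℂ) : HasDerivAt e (2 * Real.pi * Complex.I * e w) w := by
  have h := ((hasDerivAt_id w).const_mul (2 * Real.pi * Complex.I)).cexp
  rw [mul_one, mul_comm (Complex.exp _)] at h
  exact h

/-! ### Holomorphic periodic functions on tube domains -/

/-- The character `w ↦ e(n₁ w₁ + ⋯ + n_d w_d)` of `ℂᵈ`. -/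
noncomputable def chi {d : ℕ} (n : Fin d → ℤ) (w : Fin d → ℂ) : ℂ := e (∑ i, n i * w i)

/-- The tube over `D ⊆ ℝᵈ`: the points of `ℂᵈ` whose imaginary part lies in `D`. -/
def tube (D : Set (Fin d → ℝ)) : Set (Fin d → ℂ) := {w | (fun i => (w i).im) ∈ D}

theorem chi_add (n : Fin d → ℤ) (v w : Fin d → ℂ) : chi n (v + w) = chi n v * chi n w := by
  rw [chi, chi, chi, ← e_add, ← Finset.sum_add_distrib]
  simp [mul_add]

theorem chi_neg (n : Fin d → ℤ) (w : Fin d → ℂ) : chi (-n) w = (chi n w)⁻¹ := by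
  rw [chi, chi, ← e_neg, ← Finset.sum_neg_distrib]
  simp

theorem chi_ne_zero (n : Fin d → ℤ) (w : Fin d → ℂ) : chi n w ≠ 0 := e_ne_zero _

theorem chi_int (n m : Fin d → ℤ) : chi n (fun i => (m i : ℂ)) = 1 := by
  rw [chi]
  exact_mod_cast e_int (∑ i, n i * m i)

theorem norm_chi (n : Fin d → ℤ) (w : Fin d → ℂ) :
    ‖chi n w‖ = Real.exp (-(2 * Real.pi * ∑ i, n i * (w i).im)) := by
  rw [chi, norm_e]
  simp [Complex.mul_im]

theorem differentiable_chi (n : Fin d → ℤ) : Differentiable ℂ (chi n) := by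
  unfold chi
  exact differentiable_e.comp (by fun_prop)

theorem mFourier_coe (n : Fin d → ℤ) (x : Fin d → ℝ) :
    UnitAddTorus.mFourier n (fun i => (x i : UnitAddCircle)) = chi n (fun i => (x i : ℂ)) := by
  simp only [UnitAddTorus.mFourier, ContinuousMap.coe_mk, fourier_coe_apply, chi, e,
    Finset.mul_sum, Complex.exp_sum]
  refine Finset.prod_congr rfl fun i _ => ?_
  congr 1
  simp
  ring

/-- The representative in `[0, 1)ᵈ` of a point of the torus `(ℝ / ℤ)ᵈ`. -/
noncomputable def torusRep (x : UnitAddTorus (Fin d)) : Fin d → ℝ :=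
  fun i => (AddCircle.equivIco 1 0 (x i)).1

theorem torusRep_mem (x : UnitAddTorus (Fin d)) (i : Fin d) : torusRep x i ∈ Set.Icc (0 : ℝ) 1 := by
  have := (AddCircle.equivIco (1 : ℝ) 0 (x i)).2
  exact ⟨this.1, this.2.le.trans_eq (zero_add 1)⟩

theorem coe_torusRep (x : UnitAddTorus (Fin d)) :
    (fun i => (torusRep x i : UnitAddCircle)) = x := by
  ext i
  exact AddCircle.coe_equivIco

theorem measurable_torusRep : Measurable (torusRep (d := d)) := by
  refine measurable_pi_iff.2 fun i => ?_
  exact measurable_subtype_coe.comp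
    ((AddCircle.measurableEquivIco (1 : ℝ) 0).measurable.comp (measurable_pi_apply i))

/-- A function on `ℂᵈ` with periods `ℤᵈ` in the real directions takes the same values at the
representative of `x + ℤᵈ` and at `x`. -/
theorem apply_torusRep {F : (Fin d → ℂ) → ℂ} {D : Set (Fin d → ℝ)}
    (hper : ∀ w ∈ tube D, ∀ m : Fin d → ℤ, F (w + fun i => (m i : ℂ)) = F w)
    {w : Fin d → ℂ} (hw : w ∈ tube D) (x : Fin d → ℝ) :
    F ((fun i => (torusRep (fun i => (x i : UnitAddCircle)) i : ℂ)) + w) =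
      F ((fun i => (x i : ℂ)) + w) := by
  have h : ∀ i, ∃ m : ℤ, x i = torusRep (fun i => (x i : UnitAddCircle)) i + m := by
    intro i
    have := congrFun (coe_torusRep (fun i => (x i : UnitAddCircle))) i
    rw [← sub_eq_zero, ← AddCircle.coe_sub, AddCircle.coe_eq_zero_iff] at this
    obtain ⟨m, hm⟩ := this
    refine ⟨-m, ?_⟩
    simp only [zsmul_eq_mul, mul_one] at hm
    push_cast
    linarith
  choose m hm using h
  rw [← hper _ (by simpa [tube] using hw) m]
  congr 1
  ext i
  simp only [Pi.add_apply]
  conv_rhs => rw [hm i]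
  push_cast
  ring

/-- An integral of a locally uniformly bounded family of holomorphic functions is holomorphic. -/
theorem differentiableOn_integral {X : Type*} [MeasurableSpace X] {μ : Measure X}
    [IsFiniteMeasure μ] {K : ℂ → X → ℂ} {U : Set ℂ} (hU : IsOpen U)
    (hmeas : ∀ ζ ∈ U, AEStronglyMeasurable (K ζ) μ)
    (hdiff : ∀ x, DifferentiableOn ℂ (fun ζ => K ζ x) U)
    (hbound : ∀ ζ₀ ∈ U, ∃ r > 0, ∃ M, ∀ ζ ∈ Metric.ball ζ₀ r, ∀ x, ‖K ζ x‖ ≤ M) :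
    DifferentiableOn ℂ (fun ζ => ∫ x, K ζ x ∂μ) U := by
  intro ζ₀ hζ₀
  obtain ⟨r₁, hr₁, M, hM⟩ := hbound ζ₀ hζ₀
  obtain ⟨r₂, hr₂, hball⟩ := Metric.isOpen_iff.1 hU ζ₀ hζ₀
  set r := min r₁ r₂ / 2 with hr
  have hr0 : 0 < r := by positivity
  have hr1 : 2 * r ≤ r₁ := by rw [hr]; linarith [min_le_left r₁ r₂]
  have hr2 : 2 * r ≤ r₂ := by rw [hr]; linarith [min_le_right r₁ r₂]
  have hd : ∀ x, ∀ ζ ∈ Metric.ball ζ₀ r,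
      HasDerivAt (fun ζ => K ζ x) (deriv (fun ζ => K ζ x) ζ) ζ := by
    intro x ζ hζ
    refine ((hdiff x).differentiableAt (hU.mem_nhds (hball ?_))).hasDerivAt
    exact Metric.ball_subset_ball (by linarith) hζ
  refine (hasDerivAt_integral_of_dominated_loc_of_deriv_le (bound := fun _ => M / (r / 2))
    (F' := fun ζ x => deriv (fun ζ => K ζ x) ζ) (Metric.ball_mem_nhds ζ₀ (half_pos hr0)) ?_ ?_ ?_ ?_
    (integrable_const _) ?_).2.differentiableAt.differentiableWithinAt
  · filter_upwards [hU.mem_nhds hζ₀] with ζ hζ using hmeas ζ hζ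
  · exact Integrable.of_bound (hmeas ζ₀ hζ₀) M (Eventually.of_forall fun x =>
      hM ζ₀ (Metric.mem_ball_self hr₁) x)
  · have hu : Tendsto (fun n : ℕ => ((r / 2 / (n + 1) : ℝ) : ℂ)) atTop (𝓝[≠] 0) := by
      rw [tendsto_nhdsWithin_iff]
      constructor
      · have : Tendsto (fun n : ℕ => (r / 2 / (n + 1) : ℝ)) atTop (𝓝 0) := by
          have := (tendsto_one_div_add_atTop_nhds_zero_nat (𝕜 := ℝ)).const_mul (r / 2)
          simpa [div_eq_mul_inv] using this
        have h := (Complex.continuous_ofReal.tendsto 0).comp this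
        rwa [Complex.ofReal_zero] at h
      · refine Eventually.of_forall fun n => ?_
        have : (r / 2 / ((n : ℝ) + 1)) ≠ 0 := by positivity
        simp only [Set.mem_compl_iff, Set.mem_singleton_iff]
        exact_mod_cast this
    refine aestronglyMeasurable_of_tendsto_ae atTop
      (f := fun (n : ℕ) x => ((r / 2 / (n + 1) : ℝ) : ℂ)⁻¹ •
        (K (ζ₀ + ((r / 2 / (n + 1) : ℝ) : ℂ)) x - K ζ₀ x)) ?_ ?_
    · intro n
      have hmem : ζ₀ + ((r / 2 / (n + 1) : ℝ) : ℂ) ∈ U := hball ?_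
      · exact ((hmeas _ hmem).sub (hmeas _ hζ₀)).const_smul (((r / 2 / (n + 1) : ℝ) : ℂ)⁻¹)
      rw [Metric.mem_ball, dist_self_add_left, Complex.norm_real,
        Real.norm_of_nonneg (by positivity)]
      have : r / 2 / ((n : ℝ) + 1) ≤ r / 2 :=
        div_le_self (by positivity) (by linarith [Nat.cast_nonneg (α := ℝ) n])
      linarith
    · refine Eventually.of_forall fun x => ?_
      exact (hasDerivAt_iff_tendsto_slope_zero.1 (hd x ζ₀ (Metric.mem_ball_self hr0))).comp hu
  · refine Eventually.of_forall fun x ζ hζ => ?_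
    refine Complex.norm_deriv_le_of_forall_mem_sphere_norm_le (half_pos hr0) ?_ ?_
    · refine DifferentiableOn.diffContOnCl ?_
      refine (hdiff x).mono ((Metric.closure_ball_subset_closedBall).trans fun z hz => hball ?_)
      rw [Metric.mem_ball] at hζ ⊢
      rw [Metric.mem_closedBall] at hz
      linarith [dist_triangle z ζ ζ₀]
    · intro z hz
      refine hM z ?_ x
      rw [Metric.mem_ball] at hζ ⊢
      rw [Metric.mem_sphere] at hz
      linarith [dist_triangle z ζ ζ₀]
  · refine Eventually.of_forall fun x ζ hζ => hd x ζ (Metric.ball_subset_ball (by linarith) hζ)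

theorem isOpen_tube {D : Set (Fin d → ℝ)} (hD : IsOpen D) : IsOpen (tube D) :=
  hD.preimage (by fun_prop)

/-- The mean of `F` over the real torus through the point `w`. -/
noncomputable def torusMean (F : (Fin d → ℂ) → ℂ) (w : Fin d → ℂ) : ℂ :=
  ∫ x : UnitAddTorus (Fin d), F ((fun i => (torusRep x i : ℂ)) + w)

theorem add_mem_tube {D : Set (Fin d → ℝ)} {w : Fin d → ℂ} (hw : w ∈ tube D) (x : Fin d → ℝ) :
    (fun i => (x i : ℂ)) + w ∈ tube D := by
  simpa [tube] using hw

theorem continuous_apply_add {F : (Fin d → ℂ) → ℂ} {D : Set (Fin d → ℝ)}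
    (hF : ContinuousOn F (tube D)) {w : Fin d → ℂ} (hw : w ∈ tube D) :
    Continuous (fun x : Fin d → ℝ => F ((fun i => (x i : ℂ)) + w)) :=
  hF.comp_continuous (by fun_prop) (add_mem_tube hw)

theorem torusMean_add_real {F : (Fin d → ℂ) → ℂ} {D : Set (Fin d → ℝ)}
    (hper : ∀ w ∈ tube D, ∀ m : Fin d → ℤ, F (w + fun i => (m i : ℂ)) = F w)
    {w : Fin d → ℂ} (hw : w ∈ tube D) (v : Fin d → ℝ) :
    torusMean F ((fun i => (v i : ℂ)) + w) = torusMean F w := by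
  unfold torusMean
  rw [← integral_add_right_eq_self (μ := (volume : Measure (UnitAddTorus (Fin d))))
    (fun x => F ((fun i => (torusRep x i : ℂ)) + w)) (fun i => (v i : UnitAddCircle))]
  refine integral_congr_ae (Eventually.of_forall fun x => ?_)
  have h := apply_torusRep hper hw (torusRep x + v)
  have hx : (fun i => ((torusRep x + v) i : UnitAddCircle)) =
      x + fun i => (v i : UnitAddCircle) := by
    conv_rhs => rw [← coe_torusRep x]
    rfl
  simp only
  rw [hx] at h
  rw [h]
  congr 1
  ext i
  simp [add_assoc]

/-- The mean of a periodic holomorphic function over the real torus does not depend on the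
torus: the mean is holomorphic along complex lines, and constant in the real directions. -/
theorem torusMean_eq {F : (Fin d → ℂ) → ℂ} {D : Set (Fin d → ℝ)} (hD : IsOpen D)
    (hconv : Convex ℝ D) (hF : DifferentiableOn ℂ F (tube D))
    (hper : ∀ w ∈ tube D, ∀ m : Fin d → ℤ, F (w + fun i => (m i : ℂ)) = F w)
    {y y' : Fin d → ℝ} (hy : y ∈ D) (hy' : y' ∈ D) :
    torusMean F (fun i => y i * Complex.I) = torusMean F (fun i => y' i * Complex.I) := by
  set v : Fin d → ℝ := y' - y with hv
  set L : ℂ → Fin d → ℂ := fun ζ i => y i * Complex.I + ζ * v i with hL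
  have hLc : Continuous L := by fun_prop
  set U : Set ℂ := L ⁻¹' tube D with hUdef
  have hU : IsOpen U := (isOpen_tube hD).preimage hLc
  have hmemU : ∀ ζ, ζ ∈ U ↔ y + ζ.im • v ∈ D := by
    intro ζ
    simp only [hUdef, Set.mem_preimage, tube, Set.mem_ofPred_eq, hL]
    have : (fun i => ((y i : ℂ) * Complex.I + ζ * v i).im) = y + ζ.im • v := by
      ext i
      simp [Complex.mul_im]
    rw [this]
  have hUconv : Convex ℝ U := by
    intro a ha b hb s t hs ht hst
    rw [hmemU] at *
    have := hconv ha hb hs ht hst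
    convert this using 1
    ext i
    simp only [Pi.add_apply, Pi.smul_apply, smul_eq_mul, Complex.add_im, Complex.real_smul,
      Complex.im_ofReal_mul]
    linear_combination (y i) * (-hst)
  have hconst : ∀ ζ ∈ U, ∀ t : ℝ, torusMean F (L (ζ + t)) = torusMean F (L ζ) := by
    intro ζ hζ t
    rw [← torusMean_add_real hper (w := L ζ) hζ (t • v)]
    congr 1
    ext i
    simp [hL]
    ring
  have hcont := hF.continuousOn
  have hdiff : DifferentiableOn ℂ (fun ζ => torusMean F (L ζ)) U := by
    refine differentiableOn_integral hU ?_ ?_ ?_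
    · intro ζ hζ
      exact ((continuous_apply_add hcont hζ).measurable.comp
        measurable_torusRep).aestronglyMeasurable
    · intro x
      refine hF.comp (t := tube D) (by fun_prop) ?_
      intro ζ hζ
      exact add_mem_tube hζ _
    · intro ζ₀ hζ₀
      obtain ⟨r, hr, hball⟩ := Metric.isOpen_iff.1 hU ζ₀ hζ₀
      have hsub : Metric.closedBall ζ₀ (r / 2) ⊆ U :=
        (Metric.closedBall_subset_ball (by linarith)).trans hball
      have hcomp : IsCompact (Metric.closedBall ζ₀ (r / 2) ×ˢ
          (Set.univ.pi fun _ : Fin d => Set.Icc (0 : ℝ) 1)) :=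
        (isCompact_closedBall _ _).prod (isCompact_univ_pi fun _ => isCompact_Icc)
      have hc : ContinuousOn (fun p : ℂ × (Fin d → ℝ) => F ((fun i => (p.2 i : ℂ)) + L p.1))
          (Metric.closedBall ζ₀ (r / 2) ×ˢ (Set.univ.pi fun _ : Fin d => Set.Icc (0 : ℝ) 1)) := by
        refine hcont.comp (by fun_prop) ?_
        rintro p ⟨hp, -⟩
        exact add_mem_tube (hsub hp) _
      obtain ⟨M, hM⟩ := hcomp.exists_bound_of_continuousOn hc
      refine ⟨r / 2, half_pos hr, M, fun ζ hζ x => hM (ζ, torusRep x) ⟨?_, ?_⟩⟩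
      · exact Metric.ball_subset_closedBall hζ
      · exact fun i _ => torusRep_mem x i
  have hderiv : Set.EqOn (deriv fun ζ => torusMean F (L ζ)) 0 U := by
    intro ζ hζ
    have h1 := (hdiff.differentiableAt (hU.mem_nhds hζ)).hasDerivAt
    have h2 : HasDerivAt (fun t : ℝ => ζ + (t : ℂ)) 1 0 := by
      simpa using (Complex.ofRealCLM.hasDerivAt (x := (0 : ℝ))).const_add ζ
    have h1' : HasDerivAt (fun ζ => torusMean F (L ζ)) (deriv (fun ζ => torusMean F (L ζ)) ζ)
        (ζ + ((0 : ℝ) : ℂ)) := by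
      rwa [Complex.ofReal_zero, add_zero]
    have h3 := HasDerivAt.comp (0 : ℝ) h1' h2
    rw [mul_one] at h3
    have h4 : (fun t : ℝ => torusMean F (L (ζ + t))) = fun _ => torusMean F (L ζ) :=
      funext fun t => hconst ζ hζ t
    change HasDerivAt (fun t : ℝ => torusMean F (L (ζ + t))) _ 0 at h3
    rw [h4] at h3
    exact h3.unique (hasDerivAt_const _ _)
  have h0 : (0 : ℂ) ∈ U := by rw [hmemU]; simpa using hy
  have h1 : Complex.I ∈ U := by rw [hmemU]; simpa [hv] using hy'
  have := hU.is_const_of_deriv_eq_zero hUconv.isPreconnected hdiff hderiv h0 h1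
  convert this using 2
  · ext i; simp [hL]
  · ext i; simp [hL, hv]; ring

/-- The growth of the coefficients of a Fourier series which converges on the tube over `D`:
locally uniformly in `y ∈ D`, the coefficient `a n` is `O(exp(2π n·y))`. -/
def GrowthBound (a : (Fin d → ℤ) → ℂ) (D : Set (Fin d → ℝ)) : Prop :=
  ∀ y ∈ D, ∃ ρ > (0 : ℝ), ∃ M : ℝ, ∀ (n : Fin d → ℤ) (y' : Fin d → ℝ), (∀ i, |y' i - y i| ≤ ρ) →
    ‖a n‖ ≤ M * Real.exp (2 * Real.pi * ∑ i, n i * y' i)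

theorem continuous_torus_apply {F : (Fin d → ℂ) → ℂ} {D : Set (Fin d → ℝ)}
    (hF : ContinuousOn F (tube D))
    (hper : ∀ w ∈ tube D, ∀ m : Fin d → ℤ, F (w + fun i => (m i : ℂ)) = F w)
    {w : Fin d → ℂ} (hw : w ∈ tube D) :
    Continuous (fun x : UnitAddTorus (Fin d) => F ((fun i => (torusRep x i : ℂ)) + w)) := by
  have hq : IsOpenQuotientMap (Pi.map fun (_ : Fin d) (x : ℝ) => (x : UnitAddCircle)) :=
    IsOpenQuotientMap.piMap fun _ => QuotientAddGroup.isOpenQuotientMap_mk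
  rw [hq.isQuotientMap.continuous_iff]
  exact (continuous_apply_add hF hw).congr fun x => (apply_torusRep hper hw x).symm

/-- Exponential decay of the terms of the Fourier series, locally uniformly on the tube. It is
obtained by evaluating the growth bound at the point moved against the signs of `n`. -/
theorem GrowthBound.decay {a : (Fin d → ℤ) → ℂ} {D : Set (Fin d → ℝ)} (h : GrowthBound a D)
    {y : Fin d → ℝ} (hy : y ∈ D) : ∃ ρ > (0 : ℝ), ∃ M : ℝ,
      ∀ (n : Fin d → ℤ) (y' : Fin d → ℝ), (∀ i, |y' i - y i| ≤ ρ) →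
      ‖a n‖ * Real.exp (-(2 * Real.pi * ∑ i, n i * y' i)) ≤
        M * Real.exp (-(2 * Real.pi * ρ * ∑ i, |(n i : ℝ)|)) := by
  obtain ⟨ρ, hρ, M, hM⟩ := h y hy
  refine ⟨ρ / 2, half_pos hρ, M, fun n y' hy' => ?_⟩
  have hs : ∀ i, |(SignType.sign (n i : ℝ) : ℝ)| ≤ 1 := by
    intro i
    rcases lt_trichotomy (n i : ℝ) 0 with h | h | h <;> simp [h]
  have h1 := hM n (fun i => y' i - ρ / 2 * SignType.sign (n i : ℝ)) (by
    intro i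
    calc |y' i - ρ / 2 * SignType.sign (n i : ℝ) - y i|
        = |(y' i - y i) - ρ / 2 * SignType.sign (n i : ℝ)| := by ring_nf
      _ ≤ |y' i - y i| + |ρ / 2 * SignType.sign (n i : ℝ)| := abs_sub _ _
      _ ≤ ρ / 2 + ρ / 2 * 1 := by
        rw [abs_mul, abs_of_pos (half_pos hρ)]
        exact add_le_add (hy' i) (mul_le_mul_of_nonneg_left (hs i) (half_pos hρ).le)
      _ = ρ := by ring)
  have h2 : ∑ i, (n i : ℝ) * (y' i - ρ / 2 * SignType.sign (n i : ℝ)) =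
      ∑ i, (n i : ℝ) * y' i - ρ / 2 * ∑ i, |(n i : ℝ)| := by
    rw [Finset.mul_sum, ← Finset.sum_sub_distrib]
    refine Finset.sum_congr rfl fun i _ => ?_
    rw [← self_mul_sign (n i : ℝ)]
    simp only [self_mul_sign]
    rw [mul_sub, mul_left_comm, self_mul_sign]
  rw [h2] at h1
  calc ‖a n‖ * Real.exp (-(2 * Real.pi * ∑ i, n i * y' i))
      ≤ M * Real.exp (2 * Real.pi * (∑ i, (n i : ℝ) * y' i - ρ / 2 * ∑ i, |(n i : ℝ)|)) *
        Real.exp (-(2 * Real.pi * ∑ i, n i * y' i)) :=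
        mul_le_mul_of_nonneg_right h1 (Real.exp_pos _).le
    _ = _ := by
      rw [mul_assoc, ← Real.exp_add]
      congr 2
      ring

theorem summable_exp_neg_abs {c : ℝ} (hc : 0 < c) :
    Summable (fun n : ℤ => Real.exp (-(c * |(n : ℝ)|))) := by
  have h : Summable (fun n : ℕ => Real.exp (-(c * (n : ℝ)))) := by
    have := Real.summable_exp_nat_mul_iff.2 (neg_lt_zero.2 hc)
    simpa [mul_comm] using this
  refine Summable.of_nat_of_neg ?_ ?_ <;> simpa using h

theorem summable_exp_neg_sum_abs {c : ℝ} (hc : 0 < c) (d : ℕ) :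
    Summable (fun n : Fin d → ℤ => Real.exp (-(c * ∑ i, |(n i : ℝ)|))) := by
  induction d with
  | zero => exact (hasSum_fintype _).summable
  | succ d ih =>
    rw [← (Fin.consEquiv fun _ => ℤ).summable_iff]
    refine ((summable_exp_neg_abs hc).mul_of_nonneg ih (fun _ => (Real.exp_pos _).le)
      (fun _ => (Real.exp_pos _).le)).congr fun p => ?_
    simp [Fin.consEquiv, Fin.sum_univ_succ, ← Real.exp_add]
    ring

theorem GrowthBound.summable {a : (Fin d → ℤ) → ℂ} {D : Set (Fin d → ℝ)} (h : GrowthBound a D)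
    {w : Fin d → ℂ} (hw : w ∈ tube D) : Summable (fun n => a n * chi n w) := by
  obtain ⟨ρ, hρ, M, hM⟩ := h.decay hw
  refine Summable.of_norm_bounded
    ((summable_exp_neg_sum_abs (c := 2 * Real.pi * ρ) (by positivity) d).mul_left M) fun n => ?_
  rw [norm_mul, norm_chi]
  exact hM n _ (fun i => by simpa using hρ.le)

/-- A holomorphic function on a convex tube which has the periods `ℤᵈ` is the sum of an absolutely
convergent Fourier series. The coefficients are the Fourier coefficients over any of the real tori,
which all agree by `torusMean_eq`; their growth bound makes the series over each torus summable. -/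
theorem exists_fourier_expansion {F : (Fin d → ℂ) → ℂ} {D : Set (Fin d → ℝ)} (hD : IsOpen D)
    (hconv : Convex ℝ D) (hF : DifferentiableOn ℂ F (tube D))
    (hper : ∀ w ∈ tube D, ∀ m : Fin d → ℤ, F (w + fun i => (m i : ℂ)) = F w)
    {y₀ : Fin d → ℝ} (hy₀ : y₀ ∈ D) :
    ∃ a, GrowthBound a D ∧ ∀ w ∈ tube D, HasSum (fun n => a n * chi n w) (F w) := by
  set a : (Fin d → ℤ) → ℂ := fun n =>
    torusMean (fun w => F w * chi (-n) w) (fun i => y₀ i * Complex.I) with ha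
  have hdn : ∀ n, DifferentiableOn ℂ (fun w => F w * chi (-n) w) (tube D) := fun n =>
    hF.mul (differentiable_chi _).differentiableOn
  have hpern : ∀ n, ∀ w ∈ tube D, ∀ m : Fin d → ℤ, F (w + fun i => (m i : ℂ)) *
      chi (-n) (w + fun i => (m i : ℂ)) = F w * chi (-n) w := by
    intro n w hw m
    rw [hper w hw m, chi_add, chi_int, mul_one]
  have ha' : ∀ w ∈ tube D, ∀ n, a n = torusMean (fun w => F w * chi (-n) w) w := by
    intro w hw n
    rw [ha]
    simp only
    rw [torusMean_eq hD hconv (hdn n) (hpern n) hy₀ hw]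
    have hmem : (fun i => ((w i).im : ℂ) * Complex.I) ∈ tube D := by
      have : (fun i => ((((w i).im : ℂ) * Complex.I)).im) = fun i => (w i).im := by
        ext i; simp
      simpa only [tube, Set.mem_ofPred_eq, this] using hw
    rw [← torusMean_add_real (hpern n) hmem (fun i => (w i).re)]
    congr 1
    ext i
    simp
  have hgrowth : GrowthBound a D := by
    intro y hy
    obtain ⟨r, hr, hball⟩ := Metric.isOpen_iff.1 hD y hy
    have hsub : Metric.closedBall y (r / 2) ⊆ D :=
      (Metric.closedBall_subset_ball (by linarith)).trans hball
    have hcomp : IsCompact (Metric.closedBall y (r / 2) ×ˢ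
        (Set.univ.pi fun _ : Fin d => Set.Icc (0 : ℝ) 1)) :=
      (isCompact_closedBall _ _).prod (isCompact_univ_pi fun _ => isCompact_Icc)
    have hmem : ∀ y' ∈ D, (fun i => (y' i : ℂ) * Complex.I) ∈ tube D := by
      intro y' hy'
      have : (fun i => (((y' i : ℂ) * Complex.I)).im) = y' := by ext i; simp
      simpa only [tube, Set.mem_ofPred_eq, this] using hy'
    have hc : ContinuousOn (fun p : (Fin d → ℝ) × (Fin d → ℝ) =>
        F ((fun i => (p.2 i : ℂ)) + fun i => (p.1 i : ℂ) * Complex.I))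
        (Metric.closedBall y (r / 2) ×ˢ (Set.univ.pi fun _ : Fin d => Set.Icc (0 : ℝ) 1)) := by
      refine hF.continuousOn.comp (by fun_prop) ?_
      rintro p ⟨hp, -⟩
      exact add_mem_tube (hmem _ (hsub hp)) _
    obtain ⟨M, hM⟩ := hcomp.exists_bound_of_continuousOn hc
    refine ⟨r / 2, half_pos hr, M, fun n y' hy' => ?_⟩
    have hyb : y' ∈ Metric.closedBall y (r / 2) := by
      rw [Metric.mem_closedBall, dist_pi_le_iff (by positivity)]
      exact hy'
    rw [ha' _ (hmem y' (hsub hyb)) n, torusMean]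
    refine (norm_integral_le_of_norm_le_const
      (C := M * Real.exp (2 * Real.pi * ∑ i, n i * y' i)) (Eventually.of_forall fun x => ?_)).trans
      (by simp)
    rw [norm_mul, norm_chi]
    refine mul_le_mul (hM (y', torusRep x) ⟨hyb, fun i _ => torusRep_mem x i⟩) (le_of_eq ?_)
      (Real.exp_pos _).le
      ((norm_nonneg _).trans (hM (y', torusRep x) ⟨hyb, fun i _ => torusRep_mem x i⟩))
    simp
  refine ⟨a, hgrowth, fun w hw => ?_⟩
  let G : C(UnitAddTorus (Fin d), ℂ) := ⟨_, continuous_torus_apply hF.continuousOn hper hw⟩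
  have hG : ∀ n, UnitAddTorus.mFourierCoeff G n = a n * chi n w := by
    intro n
    rw [ha' w hw n, torusMean, ← integral_mul_const, UnitAddTorus.mFourierCoeff]
    refine integral_congr_ae (Eventually.of_forall fun x => ?_)
    change UnitAddTorus.mFourier (-n) x * F ((fun i => (torusRep x i : ℂ)) + w) =
      F ((fun i => (torusRep x i : ℂ)) + w) * chi (-n) ((fun i => (torusRep x i : ℂ)) + w) * chi n w
    conv_lhs => rw [← coe_torusRep x, mFourier_coe, coe_torusRep x]
    rw [chi_add, chi_neg n w]
    field_simp [chi_ne_zero n w]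
  have hs : Summable (UnitAddTorus.mFourierCoeff G) := by
    rw [funext hG]
    exact hgrowth.summable hw
  have h0 := UnitAddTorus.hasSum_mFourier_series_apply_of_summable hs
    (fun i => ((0 : ℝ) : UnitAddCircle))
  have hG0 : G (fun i => ((0 : ℝ) : UnitAddCircle)) = F w := by
    change F _ = F w
    rw [apply_torusRep hper hw (fun _ => 0)]
    congr 1
    ext i
    simp
  rw [hG0] at h0
  convert h0 using 1
  ext n
  rw [hG, mFourier_coe, smul_eq_mul]
  simp [chi, e_zero]

theorem hasFDerivAt_chi (n : Fin d → ℤ) (w : Fin d → ℂ) :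
    HasFDerivAt (chi n) ((2 * Real.pi * Complex.I * chi n w) •
      ∑ i, (n i : ℂ) • ContinuousLinearMap.proj (R := ℂ) (φ := fun _ : Fin d => ℂ) i) w := by
  have h1 : HasFDerivAt (fun w : Fin d → ℂ => ∑ i, (n i : ℂ) * w i)
      (∑ i, (n i : ℂ) • ContinuousLinearMap.proj (R := ℂ) (φ := fun _ : Fin d => ℂ) i) w :=
    HasFDerivAt.fun_sum fun i _ => (hasFDerivAt_apply i w).const_mul (n i : ℂ)
  exact (hasDerivAt_e _).comp_hasFDerivAt w h1

theorem GrowthBound.differentiableOn {a : (Fin d → ℤ) → ℂ} {D : Set (Fin d → ℝ)}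
    (h : GrowthBound a D) :
    DifferentiableOn ℂ (fun w => ∑' n, a n * chi n w) (tube D) := by
  intro w hw
  obtain ⟨ρ, hρ, M, hM⟩ := h.decay hw
  set c := 2 * Real.pi * ρ with hc
  have hc0 : 0 < c := by positivity
  have hM0 : 0 ≤ M := by
    have := (mul_nonneg (norm_nonneg _) (Real.exp_pos _).le).trans
      (hM 0 (fun i => (w i).im) (fun i => by simpa using hρ.le))
    simpa using this
  have hbound : ∀ n : Fin d → ℤ, (∑ i, |(n i : ℝ)|) * Real.exp (-(c * ∑ i, |(n i : ℝ)|)) ≤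
      2 / c * Real.exp (-(c / 2 * ∑ i, |(n i : ℝ)|)) := by
    intro n
    set t := ∑ i, |(n i : ℝ)|
    have h1 : t ≤ 2 / c * Real.exp (c / 2 * t) := by
      have := Real.add_one_le_exp (c / 2 * t)
      calc t = 2 / c * (c / 2 * t) := by field_simp
        _ ≤ _ := mul_le_mul_of_nonneg_left (by linarith) (by positivity)
    calc t * Real.exp (-(c * t)) ≤ 2 / c * Real.exp (c / 2 * t) * Real.exp (-(c * t)) :=
          mul_le_mul_of_nonneg_right h1 (Real.exp_pos _).le
      _ = _ := by
        rw [mul_assoc, ← Real.exp_add]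
        congr 2
        ring
  refine (hasFDerivAt_tsum_of_isPreconnected (s := Metric.ball w ρ)
    (u := fun n => 2 * Real.pi * M * (2 / c * Real.exp (-(c / 2 * ∑ i, |(n i : ℝ)|))))
    (f' := fun n w => a n • ((2 * Real.pi * Complex.I * chi n w) •
      ∑ i, (n i : ℂ) • ContinuousLinearMap.proj (R := ℂ) (φ := fun _ : Fin d => ℂ) i))
    ?_ Metric.isOpen_ball (convex_ball w ρ).isPreconnected ?_ ?_ (Metric.mem_ball_self hρ)
    (h.summable hw) (Metric.mem_ball_self hρ)).differentiableAt.differentiableWithinAt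
  · exact ((summable_exp_neg_sum_abs (half_pos hc0) d).mul_left _).mul_left _
  · intro n v _
    exact (hasFDerivAt_chi n v).const_mul (a n)
  · intro n v hv
    have h1 := hM n (fun i => (v i).im) (by
      intro i
      rw [← Complex.sub_im]
      refine (Complex.abs_im_le_norm _).trans ?_
      rw [← Pi.sub_apply]
      refine (norm_le_pi_norm (v - w) i).trans ?_
      exact (mem_ball_iff_norm.1 hv).le)
    have h2 : ‖∑ i, (n i : ℂ) • ContinuousLinearMap.proj (R := ℂ) (φ := fun _ : Fin d => ℂ) i‖ ≤
        ∑ i, |(n i : ℝ)| := by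
      refine (norm_sum_le _ _).trans (Finset.sum_le_sum fun i _ => ?_)
      rw [norm_smul]
      have h3 : ‖ContinuousLinearMap.proj (R := ℂ) (φ := fun _ : Fin d => ℂ) i‖ ≤ 1 :=
        ContinuousLinearMap.opNorm_le_bound _ zero_le_one fun x => by
          simpa using norm_le_pi_norm x i
      have h4 : ‖(n i : ℂ)‖ = |(n i : ℝ)| := by simp
      rw [h4]
      exact mul_le_of_le_one_right (abs_nonneg _) h3
    have h5 : ‖(2 * Real.pi * Complex.I : ℂ)‖ = 2 * Real.pi := by
      simp [abs_of_pos Real.pi_pos]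
    rw [norm_smul, norm_smul, norm_mul, h5, norm_chi]
    calc _ ≤ ‖a n‖ * (2 * Real.pi * Real.exp (-(2 * Real.pi * ∑ i, n i * (v i).im)) *
          ∑ i, |(n i : ℝ)|) := by gcongr
      _ = 2 * Real.pi * (‖a n‖ * Real.exp (-(2 * Real.pi * ∑ i, n i * (v i).im))) *
          ∑ i, |(n i : ℝ)| := by ring
      _ ≤ 2 * Real.pi * (M * Real.exp (-(c * ∑ i, |(n i : ℝ)|))) * ∑ i, |(n i : ℝ)| := by
        gcongr
      _ = 2 * Real.pi * M * ((∑ i, |(n i : ℝ)|) * Real.exp (-(c * ∑ i, |(n i : ℝ)|))) := by ring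
      _ ≤ _ := mul_le_mul_of_nonneg_left (hbound n) (by positivity)

theorem integral_mFourier (n : Fin d → ℤ) :
    ∫ x, UnitAddTorus.mFourier n x = if n = 0 then 1 else 0 := by
  have h := orthonormal_iff_ite.1 (UnitAddTorus.orthonormal_mFourier (d := Fin d)) 0 n
  simp only [ContinuousMap.inner_toLp, UnitAddTorus.mFourier_zero] at h
  simpa [eq_comm] using h

/-- A Fourier series which vanishes on a real torus has zero coefficients. -/
theorem eq_zero_of_hasSum_chi {a : (Fin d → ℤ) → ℂ} (w : Fin d → ℂ)
    (h : ∀ x : Fin d → ℝ, HasSum (fun n => a n * chi n ((fun i => (x i : ℂ)) + w)) 0) :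
    a = 0 := by
  have hnorm : Summable (fun n => ‖a n * chi n w‖) := by
    have := (h 0).summable.norm
    refine this.congr fun n => ?_
    congr 3
    ext i
    simp
  have htorus : ∀ x : UnitAddTorus (Fin d),
      HasSum (fun n => a n * chi n w * UnitAddTorus.mFourier n x) 0 := by
    intro x
    have := h (torusRep x)
    simp only [chi_add] at this
    rw [← coe_torusRep x]
    simp only [mFourier_coe]
    convert this using 2
    ring
  ext m
  have hint : HasSum (fun n => ∫ x, a n * chi n w * UnitAddTorus.mFourier (n + -m) x)
      (∫ x : UnitAddTorus (Fin d), (0 : ℂ)) := by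
    have hnm : ∀ (k : Fin d → ℤ) (x : UnitAddTorus (Fin d)), ‖UnitAddTorus.mFourier k x‖ ≤ 1 :=
      fun k x => ((UnitAddTorus.mFourier k).norm_coe_le_norm x).trans_eq UnitAddTorus.mFourier_norm
    refine hasSum_integral_of_dominated_convergence (fun n _ => ‖a n * chi n w‖) ?_ ?_ ?_ ?_ ?_
    · intro n
      exact (Continuous.aestronglyMeasurable (by fun_prop))
    · intro n
      refine Eventually.of_forall fun x => ?_
      rw [norm_mul]
      exact mul_le_of_le_one_right (norm_nonneg _) (hnm _ x)
    · exact Eventually.of_forall fun _ => hnorm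
    · exact integrable_const _
    · refine Eventually.of_forall fun x => ?_
      have := (htorus x).mul_right (UnitAddTorus.mFourier (-m) x)
      rw [zero_mul] at this
      refine this.congr_fun fun n => ?_
      rw [UnitAddTorus.mFourier_add]
      ring
  have hterm : ∀ n, ∫ x, a n * chi n w * UnitAddTorus.mFourier (n + -m) x =
      if n = m then a n * chi n w else 0 := by
    intro n
    rw [integral_const_mul, integral_mFourier]
    simp only [← sub_eq_add_neg, sub_eq_zero]
    split_ifs <;> simp
  rw [funext hterm, integral_zero] at hint
  have h0 := (hint.unique (hasSum_ite_eq m (a m * chi m w) |>.congr_fun fun n => by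
    split_ifs with hnm
    · rw [hnm]
    · rfl))
  exact (mul_eq_zero.1 h0.symm).resolve_right (chi_ne_zero _ _)

theorem eq_of_hasSum_chi {a b : (Fin d → ℤ) → ℂ} {f : (Fin d → ℝ) → ℂ} (w : Fin d → ℂ)
    (ha : ∀ x : Fin d → ℝ, HasSum (fun n => a n * chi n ((fun i => (x i : ℂ)) + w)) (f x))
    (hb : ∀ x : Fin d → ℝ, HasSum (fun n => b n * chi n ((fun i => (x i : ℂ)) + w)) (f x)) :
    a = b := by
  rw [← sub_eq_zero]
  refine eq_zero_of_hasSum_chi w fun x => ?_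
  simpa [sub_mul] using (ha x).sub (hb x)

end Torus

/-! ### Explicit symplectic matrices -/

theorem moebius_eq {g : symplecticGroup (Fin 2) ℝ} {Ω W : siegelSet}
    (h : num g Ω.1 = W.1 * denom g Ω.1) : moebius g Ω = W := by
  refine Subtype.ext ?_
  have hdet := (Matrix.isUnit_iff_isUnit_det _).1 (isUnit_denom g Ω.2)
  change num g Ω.1 * (denom g Ω.1)⁻¹ = W.1
  rw [h, Matrix.mul_assoc, Matrix.mul_nonsing_inv _ hdet, Matrix.mul_one]

theorem mem_siegelSet_iff {τ z ω : ℂ} :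
    !![τ, z; z, ω] ∈ siegelSet ↔ 0 < τ.im ∧ z.im ^ 2 < τ.im * ω.im := by
  have hmap : (!![τ, z; z, ω] : Matrix (Fin 2) (Fin 2) ℂ).map Complex.im =
      !![τ.im, z.im; z.im, ω.im] := by
    ext i j; fin_cases i <;> fin_cases j <;> rfl
  constructor
  · rintro ⟨-, h⟩
    rw [hmap] at h
    have h1 := h.diag_pos (i := 0)
    have h2 := h.det_pos
    rw [Matrix.det_fin_two_of] at h2
    exact ⟨by simpa using h1, by nlinarith⟩
  · rintro ⟨h1, h2⟩
    refine ⟨by ext i j; fin_cases i <;> fin_cases j <;> rfl, ?_⟩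
    rw [hmap, posDef_iff_dotProduct_mulVec]
    refine ⟨by ext i j; fin_cases i <;> fin_cases j <;> simp [conjTranspose_apply], ?_⟩
    intro x hx
    simp only [star_trivial, dotProduct, mulVec, Fin.sum_univ_two, Matrix.of_apply,
      Matrix.cons_val', Matrix.cons_val_zero, Matrix.cons_val_one, Matrix.cons_val_fin_one]
    have key : 0 < τ.im * (x 0 * (τ.im * x 0 + z.im * x 1) + x 1 * (z.im * x 0 + ω.im * x 1)) := by
      have e1 : τ.im * (x 0 * (τ.im * x 0 + z.im * x 1) + x 1 * (z.im * x 0 + ω.im * x 1)) =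
          (τ.im * x 0 + z.im * x 1) ^ 2 + (τ.im * ω.im - z.im ^ 2) * x 1 ^ 2 := by ring
      rw [e1]
      by_cases h : x 1 = 0
      · have h0 : x 0 ≠ 0 := by
          intro h0
          apply hx
          ext i
          fin_cases i <;> simp [h, h0]
        rw [h]
        have : 0 < (τ.im * x 0) ^ 2 := by positivity
        simpa using this
      · have : 0 < (τ.im * ω.im - z.im ^ 2) * x 1 ^ 2 :=
          mul_pos (by linarith) (by positivity)
        linarith [sq_nonneg (τ.im * x 0 + z.im * x 1)]
    exact (pos_iff_pos_of_mul_pos key).1 h1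

theorem siegel_eq (Ω : siegelSet) : Ω.1 = !![Ω.1 0 0, Ω.1 0 1; Ω.1 0 1, Ω.1 1 1] := by
  have h : Ω.1 1 0 = Ω.1 0 1 := congrFun (congrFun Ω.2.1 0) 1
  ext i j
  fin_cases i <;> fin_cases j <;> simp [h]

theorem siegel_im (Ω : siegelSet) :
    0 < (Ω.1 0 0).im ∧ (Ω.1 0 1).im ^ 2 < (Ω.1 0 0).im * (Ω.1 1 1).im :=
  mem_siegelSet_iff.1 (siegel_eq Ω ▸ Ω.2)

theorem siegel_ext {Ω W : siegelSet} (h0 : Ω.1 0 0 = W.1 0 0) (h1 : Ω.1 0 1 = W.1 0 1)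
    (h2 : Ω.1 1 1 = W.1 1 1) : Ω = W := by
  apply Subtype.ext
  rw [siegel_eq Ω, siegel_eq W, h0, h1, h2]

/-- The point `(τ, z; z, ω)` of the Siegel upper half space. -/
def siegelPoint (τ z ω : ℂ) (h : 0 < τ.im ∧ z.im ^ 2 < τ.im * ω.im) : siegelSet :=
  ⟨!![τ, z; z, ω], mem_siegelSet_iff.2 h⟩

/-- The translation `Ω ↦ Ω + B` as a symplectic matrix. -/
def translation (B : Matrix (Fin 2) (Fin 2) ℝ) (hB : Bᵀ = B) : symplecticGroup (Fin 2) ℝ :=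
  ⟨fromBlocks 1 B 0 1, by
    rw [SymplecticGroup.mem_iff]
    simp [Matrix.J, fromBlocks_transpose, fromBlocks_multiply, hB]⟩

/-- The symplectic matrix `(A, 0; 0, D)`, which acts by `Ω ↦ A Ω Aᵀ`. -/
def levi (A D : Matrix (Fin 2) (Fin 2) ℝ) (h : A * Dᵀ = 1) : symplecticGroup (Fin 2) ℝ :=
  ⟨fromBlocks A 0 0 D, by
    have h' : D * Aᵀ = 1 := by simpa using congrArg Matrix.transpose h
    rw [SymplecticGroup.mem_iff]
    simp [Matrix.J, fromBlocks_transpose, fromBlocks_multiply, h, h']⟩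

theorem toC_zero : toC (0 : Matrix (Fin 2) (Fin 2) ℝ) = 0 := by
  ext i j; simp [toC]

theorem slash_translation (k : ℤ) (B : Matrix (Fin 2) (Fin 2) ℝ) (hB : Bᵀ = B)
    (f : siegelSet → ℂ) {Ω W : siegelSet} (hW : W.1 = Ω.1 + toC B) :
    slash k (translation B hB) f Ω = f W := by
  have hd : denom (translation B hB) Ω.1 = 1 := by
    simp [denom, translation, toC_one, toC_zero]
  have hn : num (translation B hB) Ω.1 = W.1 := by
    simp [num, translation, toC_one, hW]
  rw [slash, moebius_eq (W := W) (by rw [hd, hn, Matrix.mul_one]), hd]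
  simp

theorem slash_levi (k : ℤ) (A D : Matrix (Fin 2) (Fin 2) ℝ) (h : A * Dᵀ = 1)
    (f : siegelSet → ℂ) {Ω W : siegelSet} (hW : W.1 = toC A * Ω.1 * (toC A)ᵀ) :
    slash k (levi A D h) f Ω = (D.det : ℂ) ^ (-k) * f W := by
  have h' : Aᵀ * D = 1 := by
    have h2 : Dᵀ * A = 1 := mul_eq_one_comm.1 h
    simpa using congrArg Matrix.transpose h2
  have hd : denom (levi A D h) Ω.1 = toC D := by
    simp [denom, levi, toC_zero]
  have hn : num (levi A D h) Ω.1 = W.1 * toC D := by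
    have : (toC A)ᵀ * toC D = 1 := by rw [← toC_transpose, ← toC_mul, h', toC_one]
    rw [hW, Matrix.mul_assoc, this]
    simp [num, levi, toC_zero]
  rw [slash, moebius_eq (W := W) (by rw [hd, hn]), hd]
  congr 2
  exact (RingHom.map_det Complex.ofRealHom D).symm

/-! ### The Fourier expansion of a paramodular form -/

/-- The domain `{(y₀, y₁, y₂) : (y₀, y₁; y₁, y₂ / N) > 0}` of `ℝ³`. In the coordinates
`(τ, z, N ω)` the Siegel upper half space is the tube over it, and the translations of `K(N)`
are those by `ℤ³`. -/
def siegelCone (N : ℕ) : Set (Fin 3 → ℝ) := {y | 0 < y 0 ∧ N * y 1 ^ 2 < y 0 * y 2}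

theorem isOpen_siegelCone (N : ℕ) : IsOpen (siegelCone N) :=
  (isOpen_lt (f := fun _ => (0 : ℝ)) (g := fun y : Fin 3 → ℝ => y 0) (by fun_prop)
    (by fun_prop)).inter (isOpen_lt (f := fun y : Fin 3 → ℝ => N * y 1 ^ 2)
      (g := fun y : Fin 3 → ℝ => y 0 * y 2) (by fun_prop) (by fun_prop))

theorem convex_siegelCone (N : ℕ) : Convex ℝ (siegelCone N) := by
  have hsmul : ∀ y ∈ siegelCone N, ∀ s : ℝ, 0 < s → s • y ∈ siegelCone N := by
    rintro y ⟨h1, h2⟩ s hs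
    refine ⟨mul_pos hs h1, ?_⟩
    simp only [Pi.smul_apply, smul_eq_mul]
    nlinarith [mul_lt_mul_of_pos_left h2 (pow_pos hs 2)]
  have hadd : ∀ y ∈ siegelCone N, ∀ y' ∈ siegelCone N, y + y' ∈ siegelCone N := by
    rintro y ⟨h1, h2⟩ y' ⟨h1', h2'⟩
    refine ⟨add_pos h1 h1', ?_⟩
    simp only [Pi.add_apply]
    have hN : (0 : ℝ) ≤ N := Nat.cast_nonneg N
    have h3 : 0 < y 0 * y' 0 * (y 0 * y' 2 + y' 0 * y 2 - 2 * N * y 1 * y' 1) := by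
      have e1 := mul_lt_mul_of_pos_left h2 (pow_pos h1' 2)
      have e2 := mul_lt_mul_of_pos_left h2' (pow_pos h1 2)
      have e3 := mul_nonneg hN (sq_nonneg (y' 0 * y 1 - y 0 * y' 1))
      nlinarith
    have h4 := (pos_iff_pos_of_mul_pos h3).1 (mul_pos h1 h1')
    nlinarith
  intro y hy y' hy' s t hs ht hst
  rcases hs.eq_or_lt with rfl | hs
  · have : t = 1 := by linarith
    simpa [this] using hy'
  rcases ht.eq_or_lt with rfl | ht
  · have : s = 1 := by linarith
    simpa [this] using hy
  exact hadd _ (hsmul _ hy _ hs) _ (hsmul _ hy' _ ht)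

theorem mem_tube_siegelCone {N : ℕ} [NeZero N] {w : Fin 3 → ℂ} :
    w ∈ tube (siegelCone N) ↔ !![w 0, w 1; w 1, w 2 / N] ∈ siegelSet := by
  rw [mem_siegelSet_iff]
  have hN : (0 : ℝ) < N := Nat.cast_pos.2 (NeZero.pos N)
  have him : (w 2 / (N : ℂ)).im = (w 2).im / N := by
    have : (N : ℂ) = ((N : ℝ) : ℂ) := by simp
    rw [this, Complex.div_ofReal_im]
  rw [him, mul_div_assoc', lt_div_iff₀ hN, mul_comm _ (N : ℝ)]
  rfl

/-- The series `∑ a(n, r, l) e(n τ + r z + N l ω)` converges to `f` on the Siegel upper half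
space. -/
def IsExpansion (N : ℕ) (a : (Fin 3 → ℤ) → ℂ) (f : siegelSet → ℂ) : Prop :=
  ∀ Ω : siegelSet, HasSum (fun n => a n * chi n ![Ω.1 0 0, Ω.1 0 1, N * Ω.1 1 1]) (f Ω)

theorem IsExpansion.unique {N : ℕ} [NeZero N] {a b : (Fin 3 → ℤ) → ℂ} {f : siegelSet → ℂ}
    (ha : IsExpansion N a f) (hb : IsExpansion N b f) : a = b := by
  have hN : (N : ℂ) ≠ 0 := NeZero.ne _
  have hpos : (0 : ℝ) < N := Nat.cast_pos.2 (NeZero.pos N)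
  let Q : (Fin 3 → ℝ) → siegelSet := fun x => siegelPoint (x 0 + Complex.I) (x 1)
    ((x 2 + Complex.I) / N) (by
      have him : (((x 2 : ℂ) + Complex.I) / (N : ℂ)).im = 1 / N := by
        have : (N : ℂ) = ((N : ℝ) : ℂ) := by simp
        rw [this, Complex.div_ofReal_im]
        simp
      rw [him]
      simpa using hpos)
  have hQ : ∀ x, ![(Q x).1 0 0, (Q x).1 0 1, N * (Q x).1 1 1] =
      (fun i => (x i : ℂ)) + ![Complex.I, 0, Complex.I] := by
    intro x
    ext i
    fin_cases i
    · simp [Q, siegelPoint]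
    · simp [Q, siegelPoint]
    · simp [Q, siegelPoint]
      field_simp
  refine eq_of_hasSum_chi (f := fun x => f (Q x)) ![Complex.I, 0, Complex.I] ?_ ?_
  · intro x
    rw [← hQ]
    exact ha (Q x)
  · intro x
    rw [← hQ]
    exact hb (Q x)

theorem coordFun_of_mem (f : siegelSet → ℂ) {p : ℂ × ℂ × ℂ}
    (h : !![p.1, p.2.1; p.2.1, p.2.2] ∈ siegelSet) : coordFun f p = f ⟨_, h⟩ := dif_pos h

theorem translation_mem_paramodularGroup (N : ℕ) (m : Fin 3 → ℤ) :
    translation !![(m 0 : ℝ), m 1; m 1, m 2 / N] (by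
      ext i j; fin_cases i <;> fin_cases j <;> rfl) ∈ paramodularGroup N := by
  refine ⟨!![1, 0, m 0, m 1; 0, 1, m 1, m 2; 0, 0, 1, 0; 0, 0, 0, 1], ?_⟩
  simp only [translation]
  congr 1
  all_goals
    ext i j
    fin_cases i <;> fin_cases j <;> simp

theorem exists_isExpansion {N : ℕ} [NeZero N] {k : ℤ} {f : siegelSet → ℂ}
    (hf : f ∈ paramodularForms N k) :
    ∃ a, GrowthBound a (siegelCone N) ∧ IsExpansion N a f := by
  have hN : (N : ℂ) ≠ 0 := NeZero.ne _
  have hpos : (0 : ℝ) < N := Nat.cast_pos.2 (NeZero.pos N)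
  have hF : DifferentiableOn ℂ (fun w : Fin 3 → ℂ => coordFun f (w 0, w 1, w 2 / N))
      (tube (siegelCone N)) := by
    refine DifferentiableOn.comp (g := coordFun f)
      (f := fun w : Fin 3 → ℂ => (w 0, w 1, w 2 / (N : ℂ))) hf.1 (by fun_prop) ?_
    intro w hw
    exact mem_tube_siegelCone.1 hw
  have hper : ∀ w ∈ tube (siegelCone N), ∀ m : Fin 3 → ℤ,
      (fun w : Fin 3 → ℂ => coordFun f (w 0, w 1, w 2 / N)) (w + fun i => (m i : ℂ)) =
        (fun w : Fin 3 → ℂ => coordFun f (w 0, w 1, w 2 / N)) w := by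
    intro w hw m
    have h1 := mem_tube_siegelCone.1 hw
    have h2 : (w + fun i => (m i : ℂ)) ∈ tube (siegelCone N) := by
      have := add_mem_tube hw (fun i => (m i : ℝ))
      simp only [Complex.ofReal_intCast] at this
      rwa [add_comm]
    have h3 := mem_tube_siegelCone.1 h2
    simp only
    rw [coordFun_of_mem f h3, coordFun_of_mem f h1]
    have := hf.2 _ (translation_mem_paramodularGroup N m)
    conv_rhs => rw [← this]
    rw [slash_translation]
    ext i j
    fin_cases i <;> fin_cases j <;> simp [toC, add_div]
  have hy : (![1, 0, 1] : Fin 3 → ℝ) ∈ siegelCone N := by simp [siegelCone]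
  obtain ⟨a, ha, hsum⟩ := exists_fourier_expansion (isOpen_siegelCone N) (convex_siegelCone N)
    hF hper hy
  refine ⟨a, ha, fun Ω => ?_⟩
  have hw : (![Ω.1 0 0, Ω.1 0 1, N * Ω.1 1 1] : Fin 3 → ℂ) ∈ tube (siegelCone N) := by
    rw [mem_tube_siegelCone]
    simp [hN, ← siegel_eq Ω]
  have := hsum _ hw
  rw [coordFun_of_mem f (by simpa using mem_tube_siegelCone.1 hw)] at this
  convert this using 1
  congr 1
  apply siegel_ext <;> simp [hN]

/-! ### The Koecher principle -/

/-- The unipotent matrix `1 + s N v wᵀ` with `w = (-v₂, v₁)` orthogonal to `v`. -/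
def koecherMatrix (N : ℕ) (s v₁ v₂ : ℤ) : Matrix (Fin 2) (Fin 2) ℝ :=
  !![1 - s * N * v₁ * v₂, s * N * v₁ ^ 2; -(s * N * v₂ ^ 2), 1 + s * N * v₁ * v₂]

/-- The inverse transpose of `koecherMatrix`. -/
def koecherDual (N : ℕ) (s v₁ v₂ : ℤ) : Matrix (Fin 2) (Fin 2) ℝ :=
  !![1 + s * N * v₁ * v₂, s * N * v₂ ^ 2; -(s * N * v₁ ^ 2), 1 - s * N * v₁ * v₂]

theorem koecherMatrix_mul_dual (N : ℕ) (s v₁ v₂ : ℤ) :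
    koecherMatrix N s v₁ v₂ * (koecherDual N s v₁ v₂)ᵀ = 1 := by
  ext i j
  fin_cases i <;> fin_cases j <;>
    simp [koecherMatrix, koecherDual, Matrix.mul_apply, Fin.sum_univ_two] <;> ring

theorem koecher_mem_paramodularGroup (N : ℕ) (s v₁ v₂ : ℤ) :
    levi _ _ (koecherMatrix_mul_dual N s v₁ v₂) ∈ paramodularGroup N := by
  refine ⟨!![1 - s * N * v₁ * v₂, s * v₁ ^ 2, 0, 0; -(s * N * v₂ ^ 2), 1 + s * N * v₁ * v₂, 0, 0;
    0, 0, 1 + s * N * v₁ * v₂, s * N * v₂ ^ 2; 0, 0, -(s * v₁ ^ 2), 1 - s * N * v₁ * v₂], ?_⟩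
  simp only [levi, koecherMatrix, koecherDual]
  congr 1
  all_goals
    ext i j
    fin_cases i <;> fin_cases j <;> simp <;> ring

/-- The action `T ↦ Uᵀ T U` of `U = koecherMatrix N s v₁ v₂` on the triples `(n, r, l)` which
encode the matrices `T = (n, r / 2; r / 2, N l)`. -/
def koecherEquiv (N : ℕ) (s v₁ v₂ : ℤ) : (Fin 3 → ℤ) ≃ (Fin 3 → ℤ) where
  toFun n := ![n 0 * (1 - s * N * v₁ * v₂) ^ 2 - n 1 * (1 - s * N * v₁ * v₂) * (s * N * v₂ ^ 2) +
      n 2 * N * (s * N * v₂ ^ 2) ^ 2,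
    2 * n 0 * (1 - s * N * v₁ * v₂) * (s * N * v₁ ^ 2) +
      n 1 * ((1 - s * N * v₁ * v₂) * (1 + s * N * v₁ * v₂) - s * N * v₂ ^ 2 * (s * N * v₁ ^ 2)) -
      2 * n 2 * N * (s * N * v₂ ^ 2) * (1 + s * N * v₁ * v₂),
    n 0 * N * (s * v₁ ^ 2) ^ 2 + n 1 * (s * v₁ ^ 2) * (1 + s * N * v₁ * v₂) +
      n 2 * (1 + s * N * v₁ * v₂) ^ 2]
  invFun n := ![n 0 * (1 + s * N * v₁ * v₂) ^ 2 + n 1 * (1 + s * N * v₁ * v₂) * (s * N * v₂ ^ 2) +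
      n 2 * N * (s * N * v₂ ^ 2) ^ 2,
    -(2 * n 0 * (1 + s * N * v₁ * v₂) * (s * N * v₁ ^ 2)) +
      n 1 * ((1 - s * N * v₁ * v₂) * (1 + s * N * v₁ * v₂) - s * N * v₂ ^ 2 * (s * N * v₁ ^ 2)) +
      2 * n 2 * N * (s * N * v₂ ^ 2) * (1 - s * N * v₁ * v₂),
    n 0 * N * (s * v₁ ^ 2) ^ 2 - n 1 * (s * v₁ ^ 2) * (1 - s * N * v₁ * v₂) +
      n 2 * (1 - s * N * v₁ * v₂) ^ 2]
  left_inv n := by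
    ext i
    fin_cases i <;> simp <;> ring
  right_inv n := by
    ext i
    fin_cases i <;> simp <;> ring

theorem siegel_conj_mem (U D : Matrix (Fin 2) (Fin 2) ℝ) (h : U * Dᵀ = 1) (Ω : siegelSet) :
    toC U * Ω.1 * (toC U)ᵀ ∈ siegelSet := by
  have h' : Uᵀ * D = 1 := by
    have h2 : Dᵀ * U = 1 := mul_eq_one_comm.1 h
    simpa using congrArg Matrix.transpose h2
  have hu := (Matrix.isUnit_iff_isUnit_det _).1 (isUnit_denom (levi U D h) Ω.2)
  have hmem := moebius_mem (levi U D h) Ω.2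
  have hd : denom (levi U D h) Ω.1 = toC D := by simp [denom, levi, toC_zero]
  have hn : num (levi U D h) Ω.1 = toC U * Ω.1 * (toC U)ᵀ * toC D := by
    have : (toC U)ᵀ * toC D = 1 := by rw [← toC_transpose, ← toC_mul, h', toC_one]
    rw [Matrix.mul_assoc, this]
    simp [num, levi, toC_zero]
  rw [hd] at hu hmem
  rwa [hn, Matrix.mul_assoc, Matrix.mul_nonsing_inv _ hu, Matrix.mul_one] at hmem

/-- The invariance under the unipotent matrices `U = koecherMatrix N s v₁ v₂`, for the Fourier
coefficients: `a(Uᵀ T U) = a(T)`. -/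
theorem IsExpansion.koecher_invariant {N : ℕ} [NeZero N] {k : ℤ} {f : siegelSet → ℂ}
    (hf : f ∈ paramodularForms N k) {a : (Fin 3 → ℤ) → ℂ} (ha : IsExpansion N a f)
    (s v₁ v₂ : ℤ) (n : Fin 3 → ℤ) : a (koecherEquiv N s v₁ v₂ n) = a n := by
  have h1 : IsExpansion N (a ∘ (koecherEquiv N s v₁ v₂).symm) f := by
    intro Ω
    set W : siegelSet := ⟨_, siegel_conj_mem _ _ (koecherMatrix_mul_dual N s v₁ v₂) Ω⟩ with hW
    have hinv := congrFun (hf.2 _ (koecher_mem_paramodularGroup N s v₁ v₂)) Ω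
    have hdet : (koecherDual N s v₁ v₂).det = 1 := by
      rw [koecherDual, Matrix.det_fin_two_of]
      ring
    rw [slash_levi k _ _ _ f (W := W) rfl, hdet, Complex.ofReal_one, _root_.one_zpow,
      one_mul] at hinv
    rw [← hinv, ← (koecherEquiv N s v₁ v₂).hasSum_iff]
    convert ha W using 1
    ext m
    simp only [Function.comp_apply, Equiv.symm_apply_apply]
    congr 1
    have hΩ : Ω.1 1 0 = Ω.1 0 1 := congrFun (congrFun Ω.2.1 0) 1
    simp only [chi, Fin.sum_univ_three, koecherEquiv, hW, koecherMatrix, toC, Matrix.mul_apply,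
      Fin.sum_univ_two, Equiv.coe_fn_mk, Matrix.cons_val_zero, Matrix.cons_val_one,
      Matrix.cons_val, Matrix.map_apply, Matrix.of_apply, Matrix.transpose_apply, hΩ]
    congr 1
    push_cast
    ring
  have h2 := congrFun (h1.unique ha) (koecherEquiv N s v₁ v₂ n)
  simp only [Function.comp_apply, Equiv.symm_apply_apply] at h2
  exact h2.symm

theorem IsExpansion.bounded {N : ℕ} {f : siegelSet → ℂ} {a : (Fin 3 → ℤ) → ℂ}
    (ha : IsExpansion N a f) :
    ∃ C, ∀ n, ‖a n‖ ≤ C * Real.exp (2 * Real.pi * (n 0 + N * n 2)) := by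
  have h := (ha (siegelPoint Complex.I 0 Complex.I (by simp))).summable.norm
  refine ⟨∑' n, ‖a n * chi n ![(siegelPoint Complex.I 0 Complex.I (by simp)).1 0 0,
      (siegelPoint Complex.I 0 Complex.I (by simp)).1 0 1,
      N * (siegelPoint Complex.I 0 Complex.I (by simp)).1 1 1]‖, fun n => ?_⟩
  have h1 := h.le_tsum n fun _ _ => norm_nonneg _
  rw [norm_mul, norm_chi] at h1
  have h2 : ∑ i, (n i : ℝ) * ((![(siegelPoint Complex.I 0 Complex.I (by simp)).1 0 0,
      (siegelPoint Complex.I 0 Complex.I (by simp)).1 0 1,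
      N * (siegelPoint Complex.I 0 Complex.I (by simp)).1 1 1] : Fin 3 → ℂ) i).im =
      n 0 + N * n 2 := by
    simp [Fin.sum_univ_three, siegelPoint, mul_comm]
  rw [h2] at h1
  calc ‖a n‖ = ‖a n‖ * Real.exp (-(2 * Real.pi * (n 0 + N * n 2))) *
        Real.exp (2 * Real.pi * (n 0 + N * n 2)) := by
        rw [mul_assoc, ← Real.exp_add, neg_add_cancel, Real.exp_zero, mul_one]
    _ ≤ _ := mul_le_mul_of_nonneg_right h1 (Real.exp_pos _).le

/-- A binary quadratic form which is not positive semidefinite takes a negative value at some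
integral vector. -/
theorem exists_neg_value {n r m : ℤ} (h : ¬ (0 ≤ n ∧ 0 ≤ m ∧ r ^ 2 ≤ 4 * n * m)) :
    ∃ v₁ v₂ : ℤ, n * v₁ ^ 2 + r * v₁ * v₂ + m * v₂ ^ 2 < 0 := by
  by_cases hn : n < 0
  · exact ⟨1, 0, by simpa using hn⟩
  by_cases hm : m < 0
  · exact ⟨0, 1, by simpa using hm⟩
  have hr : 4 * n * m < r ^ 2 := by
    by_contra hr
    exact h ⟨by omega, by omega, by omega⟩
  rcases (not_lt.1 hn).eq_or_lt with rfl | hn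
  · refine ⟨-r * (m + 1), 1, ?_⟩
    have : 1 ≤ r ^ 2 := by linarith
    nlinarith
  · exact ⟨-r, 2 * n, by nlinarith⟩

/-- The Koecher principle: the Fourier coefficients are supported on the positive semidefinite
matrices. If `T[v] < 0`, the trace of `Uᵀ T U`, for `U = 1 + s N v wᵀ`, tends to `-∞` with `s`,
but the coefficient stays the same. -/
theorem IsExpansion.koecher {N : ℕ} [NeZero N] {k : ℤ} {f : siegelSet → ℂ}
    (hf : f ∈ paramodularForms N k) {a : (Fin 3 → ℤ) → ℂ} (ha : IsExpansion N a f)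
    {n : Fin 3 → ℤ} (hn : ¬ (0 ≤ n 0 ∧ 0 ≤ n 2 ∧ n 1 ^ 2 ≤ 4 * n 0 * (N * n 2))) : a n = 0 := by
  have hpos : (0 : ℤ) < N := Int.natCast_pos.2 (NeZero.pos N)
  obtain ⟨v₁, v₂, hv⟩ := exists_neg_value (n := n 0) (r := n 1) (m := N * n 2) (by
    rintro ⟨h1, h2, h3⟩
    exact hn ⟨h1, nonneg_of_mul_nonneg_right h2 hpos, h3⟩)
  obtain ⟨C, hC⟩ := ha.bounded
  set q : ℝ := ((n 0 * v₁ ^ 2 + n 1 * v₁ * v₂ + N * n 2 * v₂ ^ 2 : ℤ) : ℝ) with hq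
  have hq0 : q < 0 := by rw [hq]; exact_mod_cast hv
  have hw : 0 < (N : ℝ) ^ 2 * (v₁ ^ 2 + v₂ ^ 2) := by
    have : v₁ ≠ 0 ∨ v₂ ≠ 0 := by
      by_contra! h0
      rw [h0.1, h0.2] at hv
      simp at hv
    have hN' : (0 : ℝ) < N := Nat.cast_pos.2 (NeZero.pos N)
    rcases this with h | h <;> positivity
  set β : ℝ := N * (-2 * n 0 * v₁ * v₂ - n 1 * v₂ ^ 2 + n 1 * v₁ ^ 2 +
    2 * N * n 2 * v₁ * v₂) with hβ
  have hbound : ∀ s : ℕ, ‖a n‖ ≤ C * Real.exp (2 * Real.pi *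
      ((s : ℝ) * ((N : ℝ) ^ 2 * (v₁ ^ 2 + v₂ ^ 2) * q * s + β) + (n 0 + N * n 2))) := by
    intro s
    rw [← ha.koecher_invariant hf s v₁ v₂ n]
    refine (hC _).trans_eq ?_
    congr 3
    simp only [koecherEquiv, Equiv.coe_fn_mk, Matrix.cons_val_zero, Matrix.cons_val, hq, hβ]
    push_cast
    ring
  have hs : Tendsto (fun s : ℕ => (s : ℝ)) atTop atTop := tendsto_natCast_atTop_atTop
  have hlim : Tendsto (fun s : ℕ => C * Real.exp (2 * Real.pi *
      ((s : ℝ) * ((N : ℝ) ^ 2 * (v₁ ^ 2 + v₂ ^ 2) * q * s + β) + (n 0 + N * n 2)))) atTop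
      (𝓝 (C * 0)) := by
    refine Tendsto.const_mul _ (Real.tendsto_exp_atBot.comp ?_)
    refine Tendsto.const_mul_atBot (by positivity) (tendsto_atBot_add_const_right _ _ ?_)
    refine hs.atTop_mul_atBot₀ (tendsto_atBot_add_const_right _ _ ?_)
    exact hs.const_mul_atTop_of_neg (mul_neg_of_pos_of_neg hw hq0)
  rw [mul_zero] at hlim
  exact norm_le_zero_iff.1 (ge_of_tendsto' hlim hbound)

/-- The relation between the Fourier coefficients given by `μ_N`. -/
theorem IsExpansion.involution {N : ℕ} [NeZero N] {k : ℤ} {ε : ℤˣ} {f : siegelSet → ℂ}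
    (hf : f ∈ paramodularFormsSign N k ε) {a : (Fin 3 → ℤ) → ℂ} (ha : IsExpansion N a f)
    (n r l : ℤ) : a ![n, r, l] = ((ε : ℤ) : ℂ) * a ![l, -r, n] := by
  have hN : (N : ℂ) ≠ 0 := NeZero.ne _
  have hpos : (0 : ℝ) < N := Nat.cast_pos.2 (NeZero.pos N)
  have hs : (Real.sqrt N)⁻¹ * (Real.sqrt N)⁻¹ = (N : ℝ)⁻¹ := by
    rw [← mul_inv, Real.mul_self_sqrt (Nat.cast_nonneg N)]
  have hsC : ((Real.sqrt N : ℝ) : ℂ)⁻¹ * ((Real.sqrt N : ℝ) : ℂ)⁻¹ = (N : ℂ)⁻¹ := by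
    simpa using congrArg Complex.ofReal hs
  have hF : -(fricke N)ᵀ * (fricke N)ᵀ = 1 := by
    have hs2 : (Real.sqrt N)⁻¹ * ((Real.sqrt N)⁻¹ * N) = 1 := by
      rw [← mul_assoc, hs, inv_mul_cancel₀ hpos.ne']
    ext i j
    fin_cases i <;> fin_cases j <;>
      simp [fricke, Matrix.mul_apply, Fin.sum_univ_two] <;> linarith
  have hmu : mu N = levi (-(fricke N)ᵀ) (fricke N) hF := rfl
  have hdet : (fricke N).det = 1 := by
    simp only [fricke, Matrix.det_smul, Matrix.det_fin_two_of, Fintype.card_fin, one_div]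
    rw [pow_two, hs]
    field_simp
    ring
  let σ : (Fin 3 → ℤ) ≃ (Fin 3 → ℤ) :=
    { toFun := fun n => ![n 2, -n 1, n 0]
      invFun := fun n => ![n 2, -n 1, n 0]
      left_inv := fun n => by ext i; fin_cases i <;> simp
      right_inv := fun n => by ext i; fin_cases i <;> simp }
  have h1 : IsExpansion N (a ∘ σ) (((ε : ℤ) : ℂ) • f) := by
    intro Ω
    have hinv := congrFun hf.2 Ω
    rw [hmu, slash_levi k _ _ _ f (W := ⟨_, siegel_conj_mem _ _ hF Ω⟩) rfl, hdet,
      Complex.ofReal_one, _root_.one_zpow, one_mul] at hinv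
    set W : siegelSet := ⟨_, siegel_conj_mem _ _ hF Ω⟩ with hW
    have hA : toC (-(fricke N)ᵀ) = !![0, ((Real.sqrt N : ℝ) : ℂ)⁻¹ * N;
        -((Real.sqrt N : ℝ) : ℂ)⁻¹, 0] := by
      ext i j
      fin_cases i <;> fin_cases j <;> simp [toC, fricke]
    have hW' : W.1 = !![N * Ω.1 1 1, -Ω.1 0 1; -Ω.1 0 1, Ω.1 0 0 / N] := by
      rw [hW]
      simp only
      rw [hA, siegel_eq Ω]
      have hsN : ((Real.sqrt N : ℝ) : ℂ)⁻¹ * (((Real.sqrt N : ℝ) : ℂ)⁻¹ * N) = 1 := by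
        rw [← mul_assoc, hsC, inv_mul_cancel₀ hN]
      generalize ((Real.sqrt N : ℝ) : ℂ)⁻¹ = c at *
      ext i j
      fin_cases i <;> fin_cases j <;> simp [Matrix.mul_apply, Fin.sum_univ_two]
      · linear_combination N * Ω.1 1 1 * hsN
      · linear_combination Ω.1 0 1 * hsN
      · linear_combination Ω.1 0 1 * hsN
      · rw [div_eq_mul_inv]
        linear_combination Ω.1 0 0 * hsC
    rw [← hinv, ← σ.symm.hasSum_iff]
    convert ha W using 1
    ext m
    simp only [Function.comp_apply, Equiv.apply_symm_apply]
    congr 1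
    rw [hW']
    simp only [chi, Fin.sum_univ_three, σ, Equiv.coe_fn_symm_mk, Matrix.cons_val_zero,
      Matrix.cons_val_one, Matrix.cons_val, Matrix.of_apply]
    congr 1
    push_cast
    field_simp
    ring
  have h2 : IsExpansion N (((ε : ℤ) : ℂ) • a) (((ε : ℤ) : ℂ) • f) := fun Ω => by
    simpa [mul_assoc] using (ha Ω).mul_left ((ε : ℤ) : ℂ)
  have h3 := congrFun (h1.unique h2) ![l, -r, n]
  simpa [σ] using h3

/-! ### Fourier coefficients of functions on `ℍ × ℂ` -/

theorem integral_e_int (k : ℤ) :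
    ∫ x in Set.Icc (0 : ℝ) 1, e (k * (x : ℂ)) = if k = 0 then 1 else 0 := by
  rw [integral_Icc_eq_integral_Ioc, ← intervalIntegral.integral_of_le zero_le_one]
  split_ifs with hk
  · simp [hk, e_zero]
  · have hc : (2 * Real.pi * Complex.I * k : ℂ) ≠ 0 := by
      have : (k : ℂ) ≠ 0 := by exact_mod_cast hk
      simp [this, Real.pi_ne_zero]
    simp only [e, ← mul_assoc]
    rw [integral_exp_mul_complex hc]
    have := e_int k
    rw [e] at this
    simp [this]

/-- The coefficients of a convergent Fourier series are the integrals `coeff n r φ`. -/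
theorem coeff_eq_of_hasSum {φ : ℍ × ℂ → ℂ} {b : ℤ × ℤ → ℂ}
    (h : ∀ (τ : ℍ) (z : ℂ), HasSum (fun p => b p * e (p.1 * τ + p.2 * z)) (φ (τ, z)))
    (n r : ℤ) : coeff n r φ = b (n, r) := by
  have hterm : ∀ (p : ℤ × ℤ) (x : ℝ × ℝ),
      b p * e (p.1 * ((x.1 +ᵥ UpperHalfPlane.I : ℍ) : ℂ) + p.2 * (x.2 : ℂ)) *
        e (-(n * (x.1 + Complex.I) + r * x.2)) =
      b p * e ((p.1 - n) * Complex.I) *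
        (e (((p.1 - n : ℤ) : ℂ) * (x.1 : ℂ)) * e (((p.2 - r : ℤ) : ℂ) * (x.2 : ℂ))) := by
    intro p x
    rw [mul_assoc, ← e_add, ← e_add, mul_assoc, ← e_add]
    congr 2
    simp
    ring
  have hnorm : Summable (fun p : ℤ × ℤ => ‖b p * e ((p.1 - n) * Complex.I)‖) := by
    have h1 := ((h UpperHalfPlane.I 0).mul_right (e (-(n * Complex.I)))).summable.norm
    refine h1.congr fun p => ?_
    rw [mul_assoc, ← e_add]
    congr 3
    simp
    ring
  have hint : HasSum (fun p : ℤ × ℤ => ∫ x in Set.Icc (0 : ℝ) 1 ×ˢ Set.Icc (0 : ℝ) 1,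
      b p * e ((p.1 - n) * Complex.I) *
        (e (((p.1 - n : ℤ) : ℂ) * (x.1 : ℂ)) * e (((p.2 - r : ℤ) : ℂ) * (x.2 : ℂ))))
      (coeff n r φ) := by
    have hfin : IsFiniteMeasure ((volume : Measure (ℝ × ℝ)).restrict
        (Set.Icc (0 : ℝ) 1 ×ˢ Set.Icc (0 : ℝ) 1)) :=
      ⟨by
        rw [Measure.restrict_apply_univ]
        exact (isCompact_Icc.prod isCompact_Icc).measure_lt_top⟩
    refine hasSum_integral_of_dominated_convergence
      (fun p _ => ‖b p * e ((p.1 - n) * Complex.I)‖) ?_ ?_ ?_ ?_ ?_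
    · intro p
      have := continuous_e
      exact (Continuous.aestronglyMeasurable (by fun_prop))
    · intro p
      refine Eventually.of_forall fun x => ?_
      rw [norm_mul, norm_mul (e _) (e _), norm_e (_ * (x.1 : ℂ)), norm_e (_ * (x.2 : ℂ))]
      simp [Complex.mul_im]
    · exact Eventually.of_forall fun _ => hnorm
    · exact integrable_const _
    · refine Eventually.of_forall fun x => ?_
      have := (h (x.1 +ᵥ UpperHalfPlane.I) x.2).mul_right (e (-(n * (x.1 + Complex.I) + r * x.2)))
      exact this.congr_fun fun p => (hterm p x).symm
  have hval : ∀ p : ℤ × ℤ, ∫ x in Set.Icc (0 : ℝ) 1 ×ˢ Set.Icc (0 : ℝ) 1,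
      b p * e ((p.1 - n) * Complex.I) *
        (e (((p.1 - n : ℤ) : ℂ) * (x.1 : ℂ)) * e (((p.2 - r : ℤ) : ℂ) * (x.2 : ℂ))) =
      if p = (n, r) then b (n, r) else 0 := by
    intro p
    rw [integral_const_mul]
    have := setIntegral_prod_mul (μ := (volume : Measure ℝ)) (ν := (volume : Measure ℝ))
      (fun x : ℝ => e (((p.1 - n : ℤ) : ℂ) * (x : ℂ)))
      (fun x : ℝ => e (((p.2 - r : ℤ) : ℂ) * (x : ℂ))) (Set.Icc (0 : ℝ) 1) (Set.Icc (0 : ℝ) 1)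
    rw [← Measure.volume_eq_prod] at this
    rw [this, integral_e_int, integral_e_int]
    by_cases h1 : p.1 = n
    · by_cases h2 : p.2 = r
      · have hp : p = (n, r) := Prod.ext h1 h2
        simp [hp, e_zero]
      · have hp : p ≠ (n, r) := fun hp => h2 (by rw [hp])
        simp [hp, sub_ne_zero.2 h2, sub_eq_zero]
    · have hp : p ≠ (n, r) := fun hp => h1 (by rw [hp])
      simp [hp, sub_eq_zero, h1]
  rw [funext hval] at hint
  exact hint.unique (hasSum_ite_eq (n, r) (b (n, r)))

theorem HasSum.unique_int {b c : ℤ → ℂ} {f : ℝ → ℂ}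
    (hb : ∀ x : ℝ, HasSum (fun l : ℤ => b l * e (l * x)) (f x))
    (hc : ∀ x : ℝ, HasSum (fun l : ℤ => c l * e (l * x)) (f x)) : b = c := by
  have key : ∀ b : ℤ → ℂ, (∀ x : ℝ, HasSum (fun l : ℤ => b l * e (l * x)) (f x)) →
      ∀ x : Fin 1 → ℝ, HasSum (fun n : Fin 1 → ℤ => (b ∘ fun n => n 0) n *
        chi n ((fun i => (x i : ℂ)) + 0)) (f (x 0)) := by
    intro b hb x
    rw [← (Equiv.funUnique (Fin 1) ℤ).symm.hasSum_iff]
    convert hb (x 0) using 1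
    ext l
    simp [chi]
  have := eq_of_hasSum_chi (f := fun x => f (x 0)) 0 (key b hb) (key c hc)
  ext l
  simpa using congrFun this (fun _ => l)

/-! ### The Fourier–Jacobi expansion -/

/-- The coefficient `φ_l` of `e(N l ω)` in the series `∑ a(n, r, l) e(n τ + r z + N l ω)`. -/
noncomputable def fourierJacobi (a : (Fin 3 → ℤ) → ℂ) (l : ℤ) (p : ℍ × ℂ) : ℂ :=
  ∑' m : Fin 2 → ℤ, a ![m 0, m 1, l] * chi m ![(p.1 : ℂ), p.2]

/-- The coefficients with fixed last index `l` satisfy the growth bound over the upper half space,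
since every point `(y₀, y₁)` with `y₀ > 0` extends to a point `(y₀, y₁, t)` of the cone. -/
theorem GrowthBound.slice {N : ℕ} [NeZero N] {a : (Fin 3 → ℤ) → ℂ}
    (ha : GrowthBound a (siegelCone N)) (l : ℤ) :
    GrowthBound (fun m : Fin 2 → ℤ => a ![m 0, m 1, l]) {y | 0 < y 0} := by
  intro y hy
  have hy0 : 0 < y 0 := hy
  set t : ℝ := (N * y 1 ^ 2 + 1) / y 0 with ht
  have hmem : (![y 0, y 1, t] : Fin 3 → ℝ) ∈ siegelCone N := by
    refine ⟨hy0, ?_⟩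
    simp only [Matrix.cons_val_zero, Matrix.cons_val_one, Matrix.cons_val, ht]
    rw [mul_div_cancel₀ _ hy0.ne']
    linarith
  obtain ⟨ρ, hρ, M, hM⟩ := ha _ hmem
  refine ⟨ρ, hρ, M * Real.exp (2 * Real.pi * (l * t)), fun n y' hy' => ?_⟩
  refine (hM _ ![y' 0, y' 1, t] ?_).trans_eq ?_
  · intro i
    fin_cases i
    · simpa using hy' 0
    · simpa using hy' 1
    · simpa using hρ.le
  · rw [mul_assoc M, ← Real.exp_add]
    congr 2
    simp [Fin.sum_univ_three, Fin.sum_univ_two]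
    ring

theorem mem_tube_upper {τ z : ℂ} :
    (![τ, z] : Fin 2 → ℂ) ∈ tube {y : Fin 2 → ℝ | 0 < y 0} ↔ 0 < τ.im := Iff.rfl

theorem GrowthBound.hasSum_fourierJacobi {N : ℕ} [NeZero N] {a : (Fin 3 → ℤ) → ℂ}
    (ha : GrowthBound a (siegelCone N)) (l : ℤ) (τ : ℍ) (z : ℂ) :
    HasSum (fun m : Fin 2 → ℤ => a ![m 0, m 1, l] * chi m ![(τ : ℂ), z])
      (fourierJacobi a l (τ, z)) :=
  ((ha.slice l).summable (mem_tube_upper.2 τ.im_pos)).hasSum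

theorem GrowthBound.hasSum_fourierJacobi' {N : ℕ} [NeZero N] {a : (Fin 3 → ℤ) → ℂ}
    (ha : GrowthBound a (siegelCone N)) (l : ℤ) (τ : ℍ) (z : ℂ) :
    HasSum (fun p : ℤ × ℤ => a ![p.1, p.2, l] * e (p.1 * τ + p.2 * z))
      (fourierJacobi a l (τ, z)) := by
  rw [← (finTwoArrowEquiv ℤ).hasSum_iff]
  refine (ha.hasSum_fourierJacobi l τ z).congr_fun fun m => ?_
  simp [chi, Fin.sum_univ_two, finTwoArrowEquiv]

theorem GrowthBound.coeff_fourierJacobi {N : ℕ} [NeZero N] {a : (Fin 3 → ℤ) → ℂ}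
    (ha : GrowthBound a (siegelCone N)) (l n r : ℤ) :
    coeff n r (fourierJacobi a l) = a ![n, r, l] :=
  coeff_eq_of_hasSum (b := fun p => a ![p.1, p.2, l]) (ha.hasSum_fourierJacobi' l) n r

theorem GrowthBound.isHolomorphicJ {N : ℕ} [NeZero N] {a : (Fin 3 → ℤ) → ℂ}
    (ha : GrowthBound a (siegelCone N)) (l : ℤ) : IsHolomorphicJ (fourierJacobi a l) := by
  have h := (ha.slice l).differentiableOn
  have h2 : DifferentiableOn ℂ (fun p : ℂ × ℂ => ∑' m : Fin 2 → ℤ,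
      a ![m 0, m 1, l] * chi m ![p.1, p.2]) {p | 0 < p.1.im} := by
    refine DifferentiableOn.comp (g := fun w => ∑' m : Fin 2 → ℤ, a ![m 0, m 1, l] * chi m w)
      (f := fun p : ℂ × ℂ => (![p.1, p.2] : Fin 2 → ℂ)) h ?_ fun p hp => hp
    refine differentiableOn_pi.2 fun i => ?_
    fin_cases i
    · exact differentiableOn_fst
    · exact differentiableOn_snd
  refine h2.congr fun p hp => ?_
  have : ((ofComplex p.1 : ℍ) : ℂ) = p.1 := by
    rw [ofComplex_apply_of_im_pos hp]
  simp only [fourierJacobi, this]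

theorem IsExpansion.hasSum_fourierJacobi {N : ℕ} [NeZero N] {f : siegelSet → ℂ}
    {a : (Fin 3 → ℤ) → ℂ} (ha : IsExpansion N a f) (hg : GrowthBound a (siegelCone N))
    (Ω : siegelSet) :
    HasSum (fun l : ℤ => fourierJacobi a l (tau Ω, Ω.1 0 1) * e (N * l * Ω.1 1 1)) (f Ω) := by
  let E : ℤ × (Fin 2 → ℤ) ≃ (Fin 3 → ℤ) :=
    { toFun := fun p => ![p.2 0, p.2 1, p.1]
      invFun := fun n => (n 2, ![n 0, n 1])
      left_inv := fun p => by
        refine Prod.ext rfl ?_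
        ext i; fin_cases i <;> simp
      right_inv := fun n => by ext i; fin_cases i <;> simp }
  have h := E.hasSum_iff.2 (ha Ω)
  refine h.prod_fiberwise fun l => ?_
  have h2 := (hg.hasSum_fourierJacobi l (tau Ω) (Ω.1 0 1)).mul_right (e (N * l * Ω.1 1 1))
  refine h2.congr_fun fun m => ?_
  simp only [Function.comp_apply, E, Equiv.coe_fn_mk]
  rw [mul_assoc]
  congr 1
  rw [chi, chi, ← e_add]
  congr 1
  simp [Fin.sum_univ_three, Fin.sum_univ_two, tau]
  ring

theorem jacobiGroup_subset (N : ℕ) [NeZero N] : jacobiGroup ⊆ paramodularGroup N := by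
  rintro g ⟨a, ha⟩
  have hN : (N : ℝ) ≠ 0 := NeZero.ne _
  refine ⟨!![a 0 0, 0, a 0 2, a 0 3; a 1 0, a 1 1, a 1 2, N * a 1 3;
    a 2 0, 0, a 2 2, a 2 3; 0, 0, 0, a 3 3], ?_⟩
  rw [ha]
  congr 1
  all_goals
    ext i j
    fin_cases i <;> fin_cases j <;> simp [hN]

/-- The point `Ω + (0, 0; 0, t)`. -/
def shift (Ω : siegelSet) (t : ℝ) : siegelSet :=
  siegelPoint (Ω.1 0 0) (Ω.1 0 1) (Ω.1 1 1 + t) (by simpa using siegel_im Ω)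

theorem shift_val (Ω : siegelSet) (t : ℝ) : (shift Ω t).1 = Ω.1 + toC !![0, 0; 0, t] := by
  conv_rhs => rw [siegel_eq Ω]
  ext i j
  fin_cases i <;> fin_cases j <;> simp [shift, siegelPoint, toC]

/-- The elements of the Jacobi group commute with the translations of `ω`. -/
theorem jacobi_shift {g : symplecticGroup (Fin 2) ℝ} (hg : g ∈ jacobiGroup) (Ω : siegelSet)
    (t : ℝ) : denom g (shift Ω t).1 = denom g Ω.1 ∧
      moebius g (shift Ω t) = shift (moebius g Ω) t := by
  obtain ⟨a, ha⟩ := hg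
  have hA : g.1.toBlocks₁₁ = !![(a 0 0 : ℝ), 0; a 1 0, a 1 1] := by rw [ha, toBlocks_fromBlocks₁₁]
  have hB : g.1.toBlocks₁₂ = !![(a 0 2 : ℝ), a 0 3; a 1 2, a 1 3] := by
    rw [ha, toBlocks_fromBlocks₁₂]
  have hC : g.1.toBlocks₂₁ = !![(a 2 0 : ℝ), 0; 0, 0] := by rw [ha, toBlocks_fromBlocks₂₁]
  have hD : g.1.toBlocks₂₂ = !![(a 2 2 : ℝ), a 2 3; 0, a 3 3] := by rw [ha, toBlocks_fromBlocks₂₂]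
  have hrel := congrFun (congrFun (block_rel g).2.2 1) 1
  rw [hA, hB, hC, hD] at hrel
  simp [Matrix.mul_apply, Fin.sum_univ_two] at hrel
  -- `a₁₁ a₃₃ = 1` in the integers forces `a₁₁ = a₃₃ = ±1`
  have hint : a 1 1 * a 3 3 = 1 := by exact_mod_cast hrel
  have heq : a 1 1 = a 3 3 := by
    rcases Int.mul_eq_one_iff_eq_one_or_neg_one.1 hint with h | h <;> rw [h.1, h.2]
  have hden : denom g (shift Ω t).1 = denom g Ω.1 := by
    rw [shift_val, denom, denom, hC, Matrix.mul_add, ← toC_mul]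
    have : !![(a 2 0 : ℝ), 0; 0, 0] * !![0, 0; 0, t] = 0 := by
      ext i j
      fin_cases i <;> fin_cases j <;> simp [Matrix.mul_apply, Fin.sum_univ_two]
    rw [this, toC_zero, add_zero]
  refine ⟨hden, moebius_eq ?_⟩
  rw [hden, shift_val (moebius g Ω), Matrix.add_mul]
  have hdet := (Matrix.isUnit_iff_isUnit_det _).1 (isUnit_denom g Ω.2)
  have h1 : (moebius g Ω).1 * denom g Ω.1 = num g Ω.1 := by
    change num g Ω.1 * (denom g Ω.1)⁻¹ * denom g Ω.1 = _
    rw [Matrix.mul_assoc, Matrix.nonsing_inv_mul _ hdet, Matrix.mul_one]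
  rw [h1, shift_val, num, num, denom, Matrix.mul_add, hA, hC, hD, heq]
  rw [siegel_eq Ω]
  ext i j
  fin_cases i <;> fin_cases j <;> simp [Matrix.mul_apply, Fin.sum_univ_two, toC]
  ring

theorem tau_shift (Ω : siegelSet) (t : ℝ) : tau (shift Ω t) = tau Ω := rfl

/-- The Fourier–Jacobi coefficients inherit the invariance under the Jacobi group: since the group
commutes with the translations of `ω`, the identity `f |ₖ g = f` can be compared coefficientwise as
an identity of Fourier series in `Re ω`. -/
theorem IsExpansion.slash_tilde {N : ℕ} [NeZero N] {k : ℤ} {f : siegelSet → ℂ}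
    (hf : f ∈ paramodularForms N k) {a : (Fin 3 → ℤ) → ℂ} (ha : IsExpansion N a f)
    (hg : GrowthBound a (siegelCone N)) (l : ℕ) {g : symplecticGroup (Fin 2) ℝ}
    (hgJ : g ∈ jacobiGroup) :
    slash k g (tilde (N * l) (fourierJacobi a l)) = tilde (N * l) (fourierJacobi a l) := by
  have hN : (N : ℂ) ≠ 0 := NeZero.ne _
  ext Ω
  set W := moebius g Ω with hW
  have key : ∀ (P : siegelSet) (x : ℝ), HasSum (fun j : ℤ =>
      fourierJacobi a j (tau P, P.1 0 1) * e (N * j * P.1 1 1) * e (j * x))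
      (f (shift P (x / N))) := by
    intro P x
    refine (ha.hasSum_fourierJacobi hg (shift P (x / N))).congr_fun fun j => ?_
    rw [mul_assoc, ← e_add, tau_shift]
    congr 2
    simp [shift, siegelPoint]
    field_simp
  have h1 : ∀ x : ℝ, HasSum (fun j : ℤ => (denom g Ω.1).det ^ (-k) *
      (fourierJacobi a j (tau W, W.1 0 1) * e (N * j * W.1 1 1)) * e (j * x))
      (f (shift Ω (x / N))) := by
    intro x
    have h2 := (key W x).mul_left ((denom g Ω.1).det ^ (-k))
    have h3 := congrFun (hf.2 g (jacobiGroup_subset N hgJ)) (shift Ω (x / N))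
    rw [slash, (jacobi_shift hgJ Ω (x / N)).1, (jacobi_shift hgJ Ω (x / N)).2] at h3
    rw [h3] at h2
    exact h2.congr_fun fun j => by rw [mul_assoc]
  have h4 := congrFun (HasSum.unique_int h1 (key Ω)) l
  simpa [slash, tilde] using h4

theorem IsExpansion.fourierJacobi_mem {N : ℕ} [NeZero N] {k : ℤ} {f : siegelSet → ℂ}
    (hf : f ∈ paramodularForms N k) {a : (Fin 3 → ℤ) → ℂ} (ha : IsExpansion N a f)
    (hg : GrowthBound a (siegelCone N)) (l : ℕ) :
    fourierJacobi a l ∈ jacobiForms k (N * l) := by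
  refine ⟨hg.isHolomorphicJ l, fun g hgJ => ha.slash_tilde hf hg l hgJ, fun n r h => ?_,
    fun τ z => ?_⟩
  · rw [hg.coeff_fourierJacobi]
    refine ha.koecher hf fun h' => h ⟨h'.1, ?_⟩
    have h3 := h'.2.2
    simp only [Matrix.cons_val_zero, Matrix.cons_val_one, Matrix.cons_val] at h3
    push_cast
    linarith
  · simpa only [hg.coeff_fourierJacobi] using hg.hasSum_fourierJacobi' l τ z

/-! ### The functional equations of a Jacobi form -/

/-- Every point of `ℍ × ℂ` is of the form `(τ, z)` for some `(τ, z; z, ω)`, so that identities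
between the functions `φ~` give identities between Jacobi forms. -/
theorem exists_siegel (τ : ℍ) (z : ℂ) : ∃ Ω : siegelSet, tau Ω = τ ∧ Ω.1 0 1 = z := by
  refine ⟨siegelPoint τ z (((z.im ^ 2 + 1) / τ.im : ℝ) * Complex.I) ⟨τ.im_pos, ?_⟩, rfl, rfl⟩
  have h : ((((z.im ^ 2 + 1) / τ.im : ℝ) : ℂ) * Complex.I).im = (z.im ^ 2 + 1) / τ.im := by
    rw [Complex.im_ofReal_mul, Complex.I_im, mul_one]
  rw [h]
  change z.im ^ 2 < τ.im * ((z.im ^ 2 + 1) / τ.im)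
  rw [mul_div_cancel₀ _ τ.im_pos.ne']
  linarith

theorem jacobi_levi {k : ℤ} {m : ℕ} {φ : ℍ × ℂ → ℂ} (hφ : φ ∈ jacobiForms k m)
    {A D : Matrix (Fin 2) (Fin 2) ℝ} (h : A * Dᵀ = 1) (hg : levi A D h ∈ jacobiGroup)
    {Ω W : siegelSet} (hW : W.1 = toC A * Ω.1 * (toC A)ᵀ) :
    (D.det : ℂ) ^ (-k) * (φ (tau W, W.1 0 1) * e (m * W.1 1 1)) =
      φ (tau Ω, Ω.1 0 1) * e (m * Ω.1 1 1) := by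
  have := congrFun (hφ.2.1 _ hg) Ω
  rwa [slash_levi k A D h _ hW] at this

theorem jacobi_neg {k : ℤ} {m : ℕ} {φ : ℍ × ℂ → ℂ} (hφ : φ ∈ jacobiForms k m) (τ : ℍ) (z : ℂ) :
    φ (τ, -z) = (-1) ^ k * φ (τ, z) := by
  obtain ⟨Ω, rfl, rfl⟩ := exists_siegel τ z
  have h : !![(1 : ℝ), 0; 0, -1] * (!![(1 : ℝ), 0; 0, -1])ᵀ = 1 := by
    ext i j
    fin_cases i <;> fin_cases j <;> simp [Matrix.mul_apply, Fin.sum_univ_two]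
  have hg : levi _ _ h ∈ jacobiGroup := by
    refine ⟨!![1, 0, 0, 0; 0, -1, 0, 0; 0, 0, 1, 0; 0, 0, 0, -1], ?_⟩
    simp only [levi]
    congr 1
    all_goals
      ext i j
      fin_cases i <;> fin_cases j <;> simp
  have key := jacobi_levi hφ h hg (Ω := Ω)
    (W := siegelPoint (Ω.1 0 0) (-Ω.1 0 1) (Ω.1 1 1) (by simpa using siegel_im Ω)) (by
      conv_rhs => rw [siegel_eq Ω]
      ext i j
      fin_cases i <;> fin_cases j <;>
        simp [siegelPoint, toC, Matrix.mul_apply, Fin.sum_univ_two])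
  have hdet : (!![(1 : ℝ), 0; 0, -1]).det = -1 := by simp [Matrix.det_fin_two_of]
  rw [hdet] at key
  have h2 : ((-1 : ℝ) : ℂ) ^ (-k) * φ (tau Ω, -Ω.1 0 1) = φ (tau Ω, Ω.1 0 1) := by
    refine mul_right_cancel₀ (e_ne_zero (m * Ω.1 1 1)) ?_
    rw [mul_assoc]
    exact key
  rw [← h2, ← mul_assoc]
  push_cast
  rw [← zpow_add₀ (by norm_num), add_neg_cancel, zpow_zero, one_mul]

/-- The elliptic transformation law. -/
theorem jacobi_add_mul_tau {k : ℤ} {m : ℕ} {φ : ℍ × ℂ → ℂ} (hφ : φ ∈ jacobiForms k m) (τ : ℍ)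
    (z : ℂ) (μ : ℤ) : φ (τ, z) = φ (τ, z + μ * τ) * e (m * (2 * μ * z + μ ^ 2 * τ)) := by
  obtain ⟨Ω, rfl, rfl⟩ := exists_siegel τ z
  have h : !![(1 : ℝ), 0; μ, 1] * (!![(1 : ℝ), -μ; 0, 1])ᵀ = 1 := by
    ext i j
    fin_cases i <;> fin_cases j <;> simp [Matrix.mul_apply, Fin.sum_univ_two]
  have hg : levi _ _ h ∈ jacobiGroup := by
    refine ⟨!![1, 0, 0, 0; μ, 1, 0, 0; 0, 0, 1, -μ; 0, 0, 0, 1], ?_⟩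
    simp only [levi]
    congr 1
    all_goals
      ext i j
      fin_cases i <;> fin_cases j <;> simp
  set W : siegelSet := ⟨_, siegel_conj_mem _ _ h Ω⟩ with hW
  have hW' : W.1 = !![Ω.1 0 0, Ω.1 0 1 + μ * Ω.1 0 0; Ω.1 0 1 + μ * Ω.1 0 0,
      Ω.1 1 1 + (2 * μ * Ω.1 0 1 + μ ^ 2 * Ω.1 0 0)] := by
    rw [hW]
    simp only
    rw [siegel_eq Ω]
    ext i j
    fin_cases i <;> fin_cases j <;> simp [toC, Matrix.mul_apply, Fin.sum_univ_two] <;> ring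
  have key := jacobi_levi hφ h hg (Ω := Ω) (W := W) rfl
  have hdet : (!![(1 : ℝ), -μ; 0, 1]).det = 1 := by simp [Matrix.det_fin_two_of]
  have htau : tau W = tau Ω := by
    ext
    change W.1 0 0 = Ω.1 0 0
    rw [hW']
    rfl
  have h01 : W.1 0 1 = Ω.1 0 1 + μ * Ω.1 0 0 := by rw [hW']; rfl
  have h11 : W.1 1 1 = Ω.1 1 1 + (2 * μ * Ω.1 0 1 + μ ^ 2 * Ω.1 0 0) := by rw [hW']; rfl
  rw [hdet, Complex.ofReal_one, _root_.one_zpow, one_mul, htau, h01, h11, mul_add, e_add] at key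
  refine mul_right_cancel₀ (e_ne_zero (m * Ω.1 1 1)) ?_
  rw [← key]
  change _ = φ (tau Ω, Ω.1 0 1 + μ * Ω.1 0 0) * e (m * (2 * μ * Ω.1 0 1 + μ ^ 2 * Ω.1 0 0)) * _
  ring

/-- The embedding of `SL₂(ℤ)` into the Jacobi group, acting on the coordinate `τ`. -/
def embed (γ : SL(2, ℤ)) : symplecticGroup (Fin 2) ℝ :=
  ⟨fromBlocks !![(γ 0 0 : ℝ), 0; 0, 1] !![(γ 0 1 : ℝ), 0; 0, 0] !![(γ 1 0 : ℝ), 0; 0, 0]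
    !![(γ 1 1 : ℝ), 0; 0, 1], by
    have hdet : (γ 0 0 : ℝ) * γ 1 1 - γ 0 1 * γ 1 0 = 1 := by
      have := γ.det_coe
      rw [Matrix.det_fin_two] at this
      exact_mod_cast this
    rw [SymplecticGroup.mem_iff, Matrix.J, fromBlocks_transpose, fromBlocks_multiply,
      fromBlocks_multiply]
    congr 1
    all_goals
      ext i j
      fin_cases i <;> fin_cases j <;> simp [Matrix.vecMul, dotProduct, Fin.sum_univ_two]
      all_goals linarith⟩

theorem embed_mem_jacobiGroup (γ : SL(2, ℤ)) : embed γ ∈ jacobiGroup := by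
  refine ⟨!![γ 0 0, 0, γ 0 1, 0; 0, 1, 0, 0; γ 1 0, 0, γ 1 1, 0; 0, 0, 0, 1], ?_⟩
  simp only [embed]
  congr 1
  all_goals
    ext i j
    fin_cases i <;> fin_cases j <;> simp

/-- The modular transformation law. -/
theorem jacobi_smul {k : ℤ} {m : ℕ} {φ : ℍ × ℂ → ℂ} (hφ : φ ∈ jacobiForms k m) (τ : ℍ) (z : ℂ)
    (γ : SL(2, ℤ)) :
    φ (γ • τ, z / (γ 1 0 * τ + γ 1 1)) =
      ((γ 1 0 : ℂ) * τ + γ 1 1) ^ k * e (m * (γ 1 0 * z ^ 2 / (γ 1 0 * τ + γ 1 1))) * φ (τ, z) := by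
  obtain ⟨Ω, rfl, rfl⟩ := exists_siegel τ z
  set τ := tau Ω with hτ
  set z := Ω.1 0 1 with hz
  have hτ' : Ω.1 0 0 = (τ : ℂ) := rfl
  set d : ℂ := (γ 1 0 : ℂ) * τ + γ 1 1 with hd
  have hden : denom (embed γ) Ω.1 = !![d, γ 1 0 * z; 0, 1] := by
    conv_lhs => rw [siegel_eq Ω]
    ext i j
    fin_cases i <;> fin_cases j <;>
      simp [denom, embed, toC, Matrix.mul_apply, Fin.sum_univ_two, hd, hτ', hz]
  have hdet : (denom (embed γ) Ω.1).det = d := by rw [hden, Matrix.det_fin_two_of]; ring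
  have hd0 : d ≠ 0 := by
    rw [← hdet]
    exact isUnit_iff_ne_zero.1 ((Matrix.isUnit_iff_isUnit_det _).1 (isUnit_denom (embed γ) Ω.2))
  have hdetγ : (γ 0 0 : ℂ) * γ 1 1 - γ 0 1 * γ 1 0 = 1 := by
    have := γ.det_coe
    rw [Matrix.det_fin_two] at this
    exact_mod_cast this
  have hsmul : ((γ • τ : ℍ) : ℂ) = (γ 0 0 * τ + γ 0 1) / d := by
    rw [UpperHalfPlane.specialLinearGroup_apply]
    simp [hd]
  have hval : (moebius (embed γ) Ω).1 = !![((γ • τ : ℍ) : ℂ), z / d; z / d,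
      Ω.1 1 1 - γ 1 0 * z ^ 2 / d] := by
    have hu : IsUnit (denom (embed γ) Ω.1).det := by rw [hdet]; exact isUnit_iff_ne_zero.2 hd0
    have h1 : num (embed γ) Ω.1 = !![((γ • τ : ℍ) : ℂ), z / d; z / d,
      Ω.1 1 1 - γ 1 0 * z ^ 2 / d] * denom (embed γ) Ω.1 := by
      rw [hden, hsmul]
      conv_lhs => rw [siegel_eq Ω]
      ext i j
      fin_cases i <;> fin_cases j <;>
        simp [num, embed, toC, Matrix.mul_apply, Fin.sum_univ_two, hτ', ← hz]
      · field_simp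
      · field_simp
        rw [hd]
        linear_combination z * hdetγ
      · field_simp
      · field_simp
        ring
    change num (embed γ) Ω.1 * (denom (embed γ) Ω.1)⁻¹ = _
    rw [h1, Matrix.mul_assoc, Matrix.mul_nonsing_inv _ hu, Matrix.mul_one]
  have htau : tau (moebius (embed γ) Ω) = γ • τ := by
    ext
    change (moebius (embed γ) Ω).1 0 0 = _
    rw [hval]
    rfl
  have h01 : (moebius (embed γ) Ω).1 0 1 = z / d := by rw [hval]; rfl
  have h11 : (moebius (embed γ) Ω).1 1 1 = Ω.1 1 1 + -(γ 1 0 * z ^ 2 / d) := by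
    rw [hval, ← sub_eq_add_neg]; rfl
  have key := congrFun (hφ.2.1 _ (embed_mem_jacobiGroup γ)) Ω
  rw [slash, hdet] at key
  simp only [tilde] at key
  rw [htau, h01, h11, mul_add, e_add, mul_neg, e_neg] at key
  have hE := e_ne_zero (m * (γ 1 0 * z ^ 2 / d))
  have hE2 := e_ne_zero (m * Ω.1 1 1)
  have hdk : d ^ k ≠ 0 := zpow_ne_zero _ hd0
  rw [_root_.zpow_neg] at key
  change φ (γ • τ, z / d) = d ^ k * e (m * (γ 1 0 * z ^ 2 / d)) * φ (τ, z)
  change _ = φ (τ, z) * e (m * Ω.1 1 1) at key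
  generalize e (m * (γ 1 0 * z ^ 2 / d)) = E at *
  generalize e (m * Ω.1 1 1) = E' at *
  calc φ (γ • τ, z / d) =
      d ^ k * E * ((d ^ k)⁻¹ * (φ (γ • τ, z / d) * (E' * E⁻¹))) * E'⁻¹ := by field_simp
    _ = d ^ k * E * φ (τ, z) := by rw [key]; field_simp

theorem coeff_neg {k : ℤ} {m : ℕ} {φ : ℍ × ℂ → ℂ} (hφ : φ ∈ jacobiForms k m) (n r : ℤ) :
    coeff n (-r) φ = (-1) ^ k * coeff n r φ := by
  refine coeff_eq_of_hasSum (b := fun p => (-1) ^ k * coeff p.1 (-p.2) φ) (fun τ z => ?_) n (-r)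
    |>.trans (by simp)
  have h := (hφ.2.2.2 τ (-z)).mul_left ((-1 : ℂ) ^ k)
  rw [jacobi_neg hφ, ← mul_assoc, ← mul_zpow] at h
  norm_num at h
  rw [← ((Equiv.refl ℤ).prodCongr (Equiv.neg ℤ)).hasSum_iff]
  refine h.congr_fun fun p => ?_
  simp [mul_assoc]

/-- The elliptic transformation law for the Fourier coefficients: for `m > 0`
it says that they depend only on `4mn - r²` and on `r` modulo `2m`. -/
theorem coeff_add_mul {k : ℤ} {m : ℕ} {φ : ℍ × ℂ → ℂ} (hφ : φ ∈ jacobiForms k m) (n r μ : ℤ) :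
    coeff (n + μ * r + μ ^ 2 * m) (r + 2 * μ * m) φ = coeff n r φ := by
  let E : ℤ × ℤ ≃ ℤ × ℤ :=
    { toFun := fun p => (p.1 + μ * p.2 + μ ^ 2 * m, p.2 + 2 * μ * m)
      invFun := fun p => (p.1 - μ * p.2 + μ ^ 2 * m, p.2 - 2 * μ * m)
      left_inv := fun p => by (ext <;> simp); ring
      right_inv := fun p => by (ext <;> simp); ring }
  have h := coeff_eq_of_hasSum (φ := φ) (b := fun p => coeff (E.symm p).1 (E.symm p).2 φ)
    (fun τ z => ?_) (E (n, r)).1 (E (n, r)).2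
  · simp only [Prod.mk.eta, Equiv.symm_apply_apply] at h
    exact h
  · rw [jacobi_add_mul_tau hφ τ z μ, ← E.hasSum_iff]
    refine ((hφ.2.2.2 τ (z + μ * τ)).mul_right _).congr_fun fun p => ?_
    simp only [Function.comp_apply, Equiv.symm_apply_apply]
    rw [mul_assoc, ← e_add]
    congr 2
    simp only [E, Equiv.coe_fn_mk]
    push_cast
    ring

/-! ### Dimensions with values in `{0, 1, 2, …, ∞}` -/

section Dimension

variable {V W : Type} [AddCommGroup V] [Module ℂ V] [AddCommGroup W] [Module ℂ W]

theorem dim_le_of_injective (f : V →ₗ[ℂ] W) (hf : Function.Injective f) : dim V ≤ dim W :=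
  Cardinal.toENat.monotone' (LinearMap.rank_le_of_injective f hf)

theorem dim_eq_of_equiv (f : V ≃ₗ[ℂ] W) : dim V = dim W :=
  congrArg Cardinal.toENat f.rank_eq

theorem dim_eq_zero [Subsingleton V] : dim V = 0 := by
  rw [dim, rank_subsingleton', map_zero]

theorem subsingleton_of_dim_eq_zero (h : dim V = 0) : Subsingleton V :=
  rank_zero_iff.1 (Cardinal.toENat_eq_zero.1 h)

theorem dim_quotient_add (p : Submodule ℂ V) : dim (V ⧸ p) + dim p = dim V := by
  rw [dim, dim, dim, ← map_add, Submodule.rank_quotient_add_rank]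

theorem dim_le_ker_add (f : V →ₗ[ℂ] W) : dim V ≤ dim W + dim f.ker := by
  rw [← dim_quotient_add f.ker]
  gcongr
  exact dim_le_of_injective (f.ker.liftQ f le_rfl)
    (LinearMap.ker_eq_bot.1 (Submodule.ker_liftQ_eq_bot _ _ _ le_rfl))

theorem enat_tsum_eq_top {d : ℕ → ℕ∞} (h : ∀ J, ∃ j ≥ J, d j ≠ 0) : ∑' j, d j = ⊤ := by
  have key : ∀ m : ℕ, ∃ n, (m : ℕ∞) ≤ ∑ j ∈ Finset.range n, d j := by
    intro m
    induction m with
    | zero => exact ⟨0, by simp⟩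
    | succ m ih =>
      obtain ⟨n, hn⟩ := ih
      obtain ⟨j, hj, hdj⟩ := h n
      refine ⟨j + 1, ?_⟩
      rw [Finset.sum_range_succ]
      push_cast
      refine add_le_add (hn.trans ?_) (Order.one_le_iff_ne_zero.2 hdj)
      exact Finset.sum_le_sum_of_subset (Finset.range_mono hj)
  refine ENat.eq_top_iff_forall_ge.2 fun m => ?_
  obtain ⟨n, hn⟩ := key m
  exact hn.trans ((hasSum_enat d).summable.sum_le_tsum _ fun _ _ => zero_le)

/-- The dimension of a space with a separated descending filtration is at most the sum of the
dimensions of the graded pieces. -/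
theorem dim_le_tsum_graded (p : ℕ → Submodule ℂ V) (hp : Antitone p) (hbot : ⨅ j, p j = ⊥) :
    dim (p 0) ≤ ∑' j, dim (p j ⧸ (p (j + 1)).submoduleOf (p j)) := by
  by_cases h : ∀ J, ∃ j ≥ J, dim (p j ⧸ (p (j + 1)).submoduleOf (p j)) ≠ 0
  · rw [enat_tsum_eq_top h]
    exact le_top
  push Not at h
  obtain ⟨J, hJ⟩ := h
  have hle : ∀ j ≥ J, p J ≤ p j := by
    intro j hj
    induction j, hj using Nat.le_induction with
    | base => exact le_rfl
    | succ j hj ih =>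
      refine ih.trans ?_
      have := subsingleton_of_dim_eq_zero (hJ j hj)
      rw [Submodule.Quotient.subsingleton_iff] at this
      exact Submodule.comap_subtype_eq_top.1 this
  have hJbot : p J = ⊥ := by
    rw [eq_bot_iff, ← hbot]
    refine le_iInf fun j => ?_
    rcases le_total J j with h | h
    · exact hle j h
    · exact hp h
  have hstep : ∀ n, dim (p 0) ≤
      ∑ j ∈ Finset.range n, dim (p j ⧸ (p (j + 1)).submoduleOf (p j)) + dim (p n) := by
    intro n
    induction n with
    | zero => simp
    | succ n ih =>
      rw [Finset.sum_range_succ, add_assoc]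
      refine ih.trans (add_le_add le_rfl ?_)
      rw [← dim_quotient_add ((p (n + 1)).submoduleOf (p n)),
        dim_eq_of_equiv (Submodule.submoduleOfEquivOfLe (hp n.le_succ))]
  refine (hstep J).trans ?_
  rw [hJbot, dim_eq_zero, add_zero]
  exact (hasSum_enat _).summable.sum_le_tsum _ fun _ _ => zero_le

end Dimension

/-! ### From paramodular forms to formal series of Jacobi forms -/

section FormalSeries

variable {N : ℕ} [NeZero N] {k : ℤ} {ε : ℤˣ}

/-- The Fourier coefficients `a(n, r, l)` of a paramodular form. -/
noncomputable def siegelCoeff (f : paramodularForms N k) : (Fin 3 → ℤ) → ℂ :=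
  (exists_isExpansion f.2).choose

theorem growthBound_siegelCoeff (f : paramodularForms N k) :
    GrowthBound (siegelCoeff f) (siegelCone N) := (exists_isExpansion f.2).choose_spec.1

theorem isExpansion_siegelCoeff (f : paramodularForms N k) :
    IsExpansion N (siegelCoeff f) f := (exists_isExpansion f.2).choose_spec.2

theorem siegelCoeff_add (f g : paramodularForms N k) :
    siegelCoeff (f + g) = siegelCoeff f + siegelCoeff g :=
  (isExpansion_siegelCoeff (f + g)).unique fun Ω => by
    simpa [add_mul] using (isExpansion_siegelCoeff f Ω).add (isExpansion_siegelCoeff g Ω)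

theorem siegelCoeff_smul (c : ℂ) (f : paramodularForms N k) :
    siegelCoeff (c • f) = c • siegelCoeff f :=
  (isExpansion_siegelCoeff (c • f)).unique fun Ω => by
    simpa [mul_assoc] using (isExpansion_siegelCoeff f Ω).mul_left c

/-- The Fourier–Jacobi expansion of a paramodular form, as a linear map. -/
noncomputable def fourierJacobiMap (N : ℕ) [NeZero N] (k : ℤ) :
    paramodularForms N k →ₗ[ℂ] FormalSeries N k where
  toFun f := fun l => ⟨fourierJacobi (siegelCoeff f) l,
    (isExpansion_siegelCoeff f).fourierJacobi_mem f.2 (growthBound_siegelCoeff f) l⟩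
  map_add' f g := by
    refine funext fun l => Subtype.ext (funext fun p => ?_)
    refine ((growthBound_siegelCoeff (f + g)).hasSum_fourierJacobi l p.1 p.2).unique ?_
    refine (((growthBound_siegelCoeff f).hasSum_fourierJacobi l p.1 p.2).add
      ((growthBound_siegelCoeff g).hasSum_fourierJacobi l p.1 p.2)).congr_fun fun m => ?_
    rw [siegelCoeff_add, Pi.add_apply, add_mul]
  map_smul' c f := by
    refine funext fun l => Subtype.ext (funext fun p => ?_)
    refine ((growthBound_siegelCoeff (c • f)).hasSum_fourierJacobi l p.1 p.2).unique ?_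
    refine (((growthBound_siegelCoeff f).hasSum_fourierJacobi l p.1 p.2).mul_left c).congr_fun
      fun m => ?_
    rw [siegelCoeff_smul, Pi.smul_apply, smul_eq_mul, mul_assoc]

theorem coeff_fourierJacobiMap (f : paramodularForms N k) (l : ℕ) (n r : ℤ) :
    coeff n r (fourierJacobiMap N k f l).1 = siegelCoeff f ![n, r, l] :=
  (growthBound_siegelCoeff f).coeff_fourierJacobi l n r

theorem fourierJacobiMap_injective : Function.Injective (fourierJacobiMap N k) := by
  rw [injective_iff_map_eq_zero]
  intro f hf
  have ha : siegelCoeff f = 0 := by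
    ext n
    have hn : n = ![n 0, n 1, n 2] := by ext i; fin_cases i <;> rfl
    by_cases h2 : 0 ≤ n 2
    · obtain ⟨l, hl⟩ := Int.eq_ofNat_of_zero_le h2
      rw [hn, hl]
      refine (coeff_fourierJacobiMap f l (n 0) (n 1)).symm.trans ?_
      rw [hf]
      exact coeff_zero _ _
    · exact (isExpansion_siegelCoeff f).koecher f.2 fun h => h2 h.2.1
  refine Subtype.ext (funext fun Ω => ?_)
  have h := isExpansion_siegelCoeff f Ω
  rw [ha] at h
  simpa using h.unique (by simp)

theorem dim_paramodularFormsSign_le :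
    dim (paramodularFormsSign N k ε) ≤ dim (formalForms N k ε) := by
  have hle : paramodularFormsSign N k ε ≤ paramodularForms N k := fun f hf => hf.1
  refine dim_le_of_injective (LinearMap.codRestrict (formalForms N k ε)
    ((fourierJacobiMap N k).comp (Submodule.inclusion hle)) ?_) ?_
  · intro f n l r _
    exact (coeff_fourierJacobiMap _ l n r).trans
      (((isExpansion_siegelCoeff _).involution f.2 n r l).trans
        (congrArg _ (coeff_fourierJacobiMap _ n l (-r)).symm))
  · intro f g hfg
    exact Submodule.inclusion_injective hle (fourierJacobiMap_injective (congrArg Subtype.val hfg))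

end FormalSeries

section Graded

variable {N : ℕ} {k : ℤ} {ε : ℤˣ}

theorem dim_formalForms_le : dim (formalForms N k ε) ≤
    ∑' j : ℕ, dim (formalFormsFil N k ε j ⧸
      (formalFormsFil N k ε (j + 1)).submoduleOf (formalFormsFil N k ε j)) := by
  have h0 : formalForms N k ε = formalFormsFil N k ε 0 :=
    le_antisymm (fun Φ hΦ => ⟨hΦ, fun l hl => absurd hl (Nat.not_lt_zero l)⟩) fun Φ hΦ => hΦ.1
  rw [h0]
  refine dim_le_tsum_graded (formalFormsFil N k ε)
    (fun i j hij Φ hΦ => ⟨hΦ.1, fun l hl => hΦ.2 l (hl.trans_le hij)⟩) ?_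
  rw [eq_bot_iff]
  intro Φ hΦ
  rw [Submodule.mem_iInf] at hΦ
  exact funext fun l => (hΦ (l + 1)).2 l l.lt_succ_self

/-- The leading coefficient `φ_{Nj}` of an element of `𝕄_k^{(j)}(N)^ε` has order at least
`j + δ`: its coefficients `c(n, r)` with `n < j` agree up to sign with coefficients of `φ_{Nn}`,
and those with `n = j` are antisymmetric in `r` for one reason and symmetric for another one
if `δ = 1`. -/
theorem leading_mem_jacobiFormsOrd {j : ℕ} {Φ : FormalSeries N k}
    (hΦ : Φ ∈ formalFormsFil N k ε j) :
    (Φ j).1 ∈ jacobiFormsOrd k (N * j) (j + delta k ε) := by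
  refine ⟨(Φ j).2, le_ord_iff.2 fun n hn r => ?_⟩
  by_cases hr : r ^ 2 ≤ 4 * n * (N * j)
  · have hinv := hΦ.1 n j r hr
    rcases lt_or_ge n j with hnj | hnj
    · rw [hinv, hΦ.2 n hnj]
      exact (congrArg _ (coeff_zero _ _)).trans (mul_zero _)
    · have hd : delta k ε = 1 ∧ n = j := by
        have h1 : delta k ε ≤ 1 := by
          unfold delta
          split_ifs <;> omega
        omega
      have hsign : (-1 : ℤˣ) ^ k * ε = -1 := by
        refine (Int.units_eq_one_or _).resolve_left fun h => ?_
        have := hd.1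
        simp [delta, h] at this
      have hsignC : ((ε : ℤ) : ℂ) * (-1) ^ k = -1 := by
        rcases Int.even_or_odd k with hk | hk
        · rw [hk.neg_one_zpow, one_mul] at hsign
          simp [hsign, hk.neg_one_zpow]
        · rw [hk.neg_one_zpow, neg_mul, one_mul, neg_inj] at hsign
          simp [hsign, hk.neg_one_zpow]
      rw [hd.2] at hinv ⊢
      rw [coeff_neg (Φ j).2, ← mul_assoc, hsignC] at hinv
      have h2 : (2 : ℂ) * coeff j r (Φ j).1 = 0 := by linear_combination hinv
      exact (mul_eq_zero.1 h2).resolve_left two_ne_zero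
  · refine (Φ j).2.2.2.1 n r fun h => hr ?_
    have := h.2
    push_cast at this
    linarith

theorem dim_graded_le (j : ℕ) : dim (formalFormsFil N k ε j ⧸
    (formalFormsFil N k ε (j + 1)).submoduleOf (formalFormsFil N k ε j)) ≤
      dim (jacobiFormsOrd k (N * j) (j + delta k ε)) := by
  let f : formalFormsFil N k ε j →ₗ[ℂ] jacobiFormsOrd k (N * j) (j + delta k ε) :=
    { toFun := fun Φ => ⟨(Φ.1 j).1, leading_mem_jacobiFormsOrd Φ.2⟩
      map_add' := fun _ _ => rfl
      map_smul' := fun _ _ => rfl }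
  have hker : f.ker = (formalFormsFil N k ε (j + 1)).submoduleOf (formalFormsFil N k ε j) := by
    ext Φ
    constructor
    · intro h
      refine ⟨Φ.2.1, fun l hl => ?_⟩
      rcases (Nat.lt_succ_iff.1 hl).lt_or_eq with h1 | h1
      · exact Φ.2.2 l h1
      · rw [h1]
        have h0 : f Φ = 0 := LinearMap.mem_ker.1 h
        have h2 : (Φ.1 j).1 = 0 := congrArg Subtype.val h0
        exact Subtype.ext h2
    · intro h
      refine LinearMap.mem_ker.2 (Subtype.ext ?_)
      have h2 : Φ.1 j = 0 := h.2 j j.lt_succ_self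
      change (Φ.1 j).1 = 0
      rw [h2]
      rfl
  exact dim_le_of_injective (Submodule.liftQ _ f hker.ge)
    (LinearMap.ker_eq_bot.1 (Submodule.ker_liftQ_eq_bot _ _ _ hker.le))

end Graded

/-! ### The Taylor coefficients of a Jacobi form -/

/-- The `ν`-th Taylor coefficient at `z = 0` of the function `z ↦ φ(τ, z)`, in terms of the
Fourier coefficients of `φ`. -/
noncomputable def taylor (ν : ℕ) (φ : ℍ × ℂ → ℂ) (τ : ℍ) : ℂ :=
  ∑' p : ℤ × ℤ, coeff p.1 p.2 φ * ((2 * Real.pi * Complex.I * p.2) ^ ν / ν.factorial) * e (p.1 * τ)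

section Taylor

variable {k : ℤ} {m : ℕ} {φ ψ : ℍ × ℂ → ℂ}

/-- Absolute convergence, locally uniform in `z`: since `exp |t| ≤ exp t + exp (-t)`, it follows
from the convergence of the expansion at the points `z = ±iR`. -/
theorem summable_norm_coeff (hφ : φ ∈ jacobiForms k m) {y : ℝ} (hy : 0 < y) (R : ℝ) :
    Summable fun p : ℤ × ℤ => ‖coeff p.1 p.2 φ‖ *
      (Real.exp (-(2 * Real.pi * (p.1 * y))) * Real.exp (2 * Real.pi * (|(p.2 : ℝ)| * R))) := by
  have h1 := (hφ.2.2.2 ⟨Complex.I * y, by simpa using hy⟩ (Complex.I * R)).summable.norm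
  have h2 := (hφ.2.2.2 ⟨Complex.I * y, by simpa using hy⟩ (-Complex.I * R)).summable.norm
  refine Summable.of_nonneg_of_le (fun p => by positivity) (fun p => ?_) (h1.add h2)
  rw [norm_mul, norm_mul, norm_e, norm_e, ← mul_add]
  refine mul_le_mul_of_nonneg_left ?_ (norm_nonneg _)
  rw [← Real.exp_add]
  have i1 : (((p.1 : ℂ) * (⟨Complex.I * y, by simpa using hy⟩ : ℍ) + p.2 * (Complex.I * R))).im =
      p.1 * y + p.2 * R := by simp [Complex.mul_im]
  have i2 : (((p.1 : ℂ) * (⟨Complex.I * y, by simpa using hy⟩ : ℍ) + p.2 * (-Complex.I * R))).im =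
      p.1 * y - p.2 * R := by simp [Complex.mul_im]; ring
  rw [i1, i2]
  rcases abs_choice (p.2 : ℝ) with h | h
  · rw [h]
    refine le_add_of_nonneg_of_le (Real.exp_pos _).le (le_of_eq ?_)
    congr 1; ring
  · rw [h]
    refine le_add_of_le_of_nonneg (le_of_eq ?_) (Real.exp_pos _).le
    congr 1; ring

theorem norm_two_pi_I_mul (r : ℤ) : ‖2 * Real.pi * Complex.I * r‖ = 2 * Real.pi * |(r : ℝ)| := by
  simp [abs_of_pos Real.pi_pos]

theorem norm_taylor_term_le (p : ℤ × ℤ) (ν : ℕ) (τ : ℂ) :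
    ‖coeff p.1 p.2 φ * ((2 * Real.pi * Complex.I * p.2) ^ ν / ν.factorial) * e (p.1 * τ)‖ ≤
      ‖coeff p.1 p.2 φ‖ *
        (Real.exp (-(2 * Real.pi * (p.1 * τ.im))) *
          Real.exp (2 * Real.pi * (|(p.2 : ℝ)| * 1))) := by
  rw [norm_mul, norm_mul, mul_assoc, norm_e, norm_div, norm_pow, norm_two_pi_I_mul, mul_one,
    Complex.norm_natCast, mul_comm (Real.exp _)]
  have : ((p.1 : ℂ) * τ).im = p.1 * τ.im := by simp [Complex.mul_im]
  rw [this]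
  gcongr
  exact Real.pow_div_factorial_le_exp _ (by positivity) ν

theorem hasSum_taylor (hφ : φ ∈ jacobiForms k m) (ν : ℕ) (τ : ℍ) :
    HasSum (fun p : ℤ × ℤ => coeff p.1 p.2 φ *
      ((2 * Real.pi * Complex.I * p.2) ^ ν / ν.factorial) * e (p.1 * τ)) (taylor ν φ τ) :=
  (Summable.of_norm_bounded (summable_norm_coeff hφ τ.im_pos 1) fun p =>
    norm_taylor_term_le p ν τ).hasSum

theorem taylor_add (hφ : φ ∈ jacobiForms k m) (hψ : ψ ∈ jacobiForms k m) (ν : ℕ) (τ : ℍ) :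
    taylor ν (φ + ψ) τ = taylor ν φ τ + taylor ν ψ τ := by
  refine (hasSum_taylor (add_mem hφ hψ) ν τ).unique ?_
  simpa only [coeff_add hφ.1 hψ.1, add_mul] using (hasSum_taylor hφ ν τ).add (hasSum_taylor hψ ν τ)

theorem taylor_smul (hφ : φ ∈ jacobiForms k m) (c : ℂ) (ν : ℕ) (τ : ℍ) :
    taylor ν (c • φ) τ = c * taylor ν φ τ := by
  refine (hasSum_taylor (Submodule.smul_mem _ c hφ) ν τ).unique ?_
  simpa only [coeff_smul, mul_assoc] using (hasSum_taylor hφ ν τ).mul_left c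

theorem taylor_zero (ν : ℕ) (τ : ℍ) : taylor ν 0 τ = 0 := by simp [taylor, coeff_zero]

/-- The symmetry `φ(τ, -z) = (-1)^k φ(τ, z)` makes every second Taylor coefficient vanish. -/
theorem taylor_eq_zero_of_odd (hφ : φ ∈ jacobiForms k m) {ν : ℕ} (h : Odd (k + ν)) (τ : ℍ) :
    taylor ν φ τ = 0 := by
  have hsign : (-1 : ℂ) ^ k * (-1) ^ ν = -1 := by
    rw [← zpow_natCast (-1 : ℂ) ν, ← zpow_add₀ (by norm_num), h.neg_one_zpow]
  have h1 : taylor ν φ τ = -taylor ν φ τ := by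
    refine (hasSum_taylor hφ ν τ).unique ?_
    rw [← ((Equiv.refl ℤ).prodCongr (Equiv.neg ℤ)).hasSum_iff]
    refine (hasSum_taylor hφ ν τ).neg.congr_fun fun p => ?_
    change coeff p.1 (-p.2) φ * ((2 * Real.pi * Complex.I * ((-p.2 : ℤ) : ℂ)) ^ ν / ν.factorial) *
      e (p.1 * τ) = _
    rw [coeff_neg hφ, Int.cast_neg, mul_neg, neg_pow (2 * Real.pi * Complex.I * (p.2 : ℂ))]
    linear_combination (coeff p.1 p.2 φ * ((2 * Real.pi * Complex.I * p.2) ^ ν / ν.factorial) *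
      e (p.1 * τ)) * hsign
  exact self_eq_neg.1 h1

/-- The Taylor expansion of a Jacobi form in the variable `z`. -/
theorem hasSum_taylor_mul_pow (hφ : φ ∈ jacobiForms k m) (τ : ℍ) (z : ℂ) :
    HasSum (fun ν : ℕ => taylor ν φ τ * z ^ ν) (φ (τ, z)) := by
  set F : (ℤ × ℤ) × ℕ → ℂ := fun q => coeff q.1.1 q.1.2 φ *
    ((2 * Real.pi * Complex.I * q.1.2) ^ q.2 / q.2.factorial) * e (q.1.1 * τ) * z ^ q.2 with hF
  have hexp : ∀ p : ℤ × ℤ, HasSum (fun ν => F (p, ν))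
      (coeff p.1 p.2 φ * e (p.1 * τ + p.2 * z)) := by
    intro p
    have h := NormedSpace.expSeries_div_hasSum_exp (𝔸 := ℂ) (2 * Real.pi * Complex.I * (p.2 * z))
    rw [← Complex.exp_eq_exp_ℂ] at h
    rw [e_add, ← mul_assoc]
    refine (h.mul_left (coeff p.1 p.2 φ * e (p.1 * τ))).congr_fun fun ν => ?_
    simp only [hF]
    rw [← mul_assoc, mul_pow _ z]
    ring
  have hnorm : ∀ p : ℤ × ℤ, HasSum (fun ν => ‖F (p, ν)‖) (‖coeff p.1 p.2 φ‖ *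
      (Real.exp (-(2 * Real.pi * (p.1 * τ.im))) *
        Real.exp (2 * Real.pi * (|(p.2 : ℝ)| * ‖z‖)))) := by
    intro p
    have h := NormedSpace.expSeries_div_hasSum_exp (𝔸 := ℝ) (2 * Real.pi * (|(p.2 : ℝ)| * ‖z‖))
    rw [← Real.exp_eq_exp_ℝ] at h
    rw [← mul_assoc]
    refine (h.mul_left _).congr_fun fun ν => ?_
    simp only [hF]
    have : ((p.1 : ℂ) * τ).im = p.1 * τ.im := by simp [Complex.mul_im]
    rw [norm_mul, norm_mul, norm_mul, norm_e, norm_div, norm_pow, norm_two_pi_I_mul, norm_pow,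
      Complex.norm_natCast, this, ← mul_assoc (2 * Real.pi) |(p.2 : ℝ)|, mul_pow _ ‖z‖]
    ring
  have hsum : Summable F := by
    refine Summable.of_norm ((summable_prod_of_nonneg fun _ => norm_nonneg _).2
      ⟨fun p => (hnorm p).summable, ?_⟩)
    simp_rw [fun p => (hnorm p).tsum_eq]
    exact summable_norm_coeff hφ τ.im_pos ‖z‖
  have h1 := (hsum.hasSum.prod_fiberwise hexp).unique (hφ.2.2.2 τ z)
  have h2 : HasSum (fun q : ℕ × (ℤ × ℤ) => F (q.2, q.1)) (φ (τ, z)) := by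
    rw [← h1]
    exact (Equiv.prodComm ℕ (ℤ × ℤ)).hasSum_iff.2 hsum.hasSum
  refine HasSum.prod_fiberwise h2 fun ν => ?_
  exact (hasSum_taylor hφ ν τ).mul_right (z ^ ν)

/-- The first non-vanishing coefficient of a power series as a limit. -/
theorem tendsto_div_pow {t : ℕ → ℂ} {f : ℂ → ℂ} (h : ∀ z, HasSum (fun l => t l * z ^ l) (f z))
    {ν : ℕ} (h0 : ∀ l < ν, t l = 0) :
    Tendsto (fun z => f z / z ^ ν) (𝓝[≠] 0) (𝓝 (t ν)) := by
  have hs : Summable fun l => ‖t (l + ν)‖ := by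
    have := (h 1).summable.norm
    simp only [_root_.one_pow, mul_one] at this
    exact (summable_nat_add_iff ν).2 this
  set g : ℂ → ℂ := fun z => ∑' l, t (l + ν) * z ^ l with hg
  have hle : ∀ l, ∀ z ∈ Metric.closedBall (0 : ℂ) 1, ‖t (l + ν) * z ^ l‖ ≤ ‖t (l + ν)‖ := by
    intro l z hz
    rw [norm_mul, norm_pow]
    refine mul_le_of_le_one_right (norm_nonneg _) (pow_le_one₀ (norm_nonneg _) ?_)
    simpa using hz
  have hcont : ContinuousOn g (Metric.closedBall 0 1) :=
    continuousOn_tsum (fun l => by fun_prop) hs hle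
  have hnhds : Metric.closedBall (0 : ℂ) 1 ∈ 𝓝 0 := Metric.closedBall_mem_nhds 0 one_pos
  have hg0 : g 0 = t ν := by
    rw [hg]
    simp only
    rw [tsum_eq_single 0 fun l hl => by rw [zero_pow hl, mul_zero]]
    simp
  rw [← hg0]
  refine Tendsto.congr' ?_ ((hcont.continuousAt hnhds).tendsto.mono_left nhdsWithin_le_nhds)
  filter_upwards [mem_nhdsWithin_of_mem_nhds hnhds, self_mem_nhdsWithin] with z hz hz0
  have hz1 : z ^ ν ≠ 0 := pow_ne_zero _ hz0
  rw [eq_div_iff hz1]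
  have hgz : HasSum (fun l => t (l + ν) * z ^ l) (g z) :=
    (Summable.of_norm_bounded hs fun l => hle l z hz).hasSum
  have hf : HasSum (fun l => t (l + ν) * z ^ (l + ν)) (f z) := by
    have := (hasSum_nat_add_iff' ν).2 (h z)
    rwa [Finset.sum_eq_zero fun l hl => by rw [h0 l (Finset.mem_range.1 hl), zero_mul],
      sub_zero] at this
  refine ((hgz.mul_right (z ^ ν)).congr_fun fun l => ?_).unique hf
  rw [pow_add, mul_assoc]

/-- The first non-vanishing Taylor coefficient transforms like a modular form. -/
theorem taylor_smul_eq (hφ : φ ∈ jacobiForms k m) {ν : ℕ} (h0 : ∀ μ < ν, ∀ τ, taylor μ φ τ = 0)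
    (τ : ℍ) (γ : SL(2, ℤ)) :
    taylor ν φ (γ • τ) = ((γ 1 0 : ℂ) * τ + γ 1 1) ^ (k + ν) * taylor ν φ τ := by
  set d : ℂ := (γ 1 0 : ℂ) * τ + γ 1 1 with hd
  have hd0 : d ≠ 0 := by
    have := UpperHalfPlane.denom_ne_zero (γ : GL (Fin 2) ℝ) τ
    simpa [UpperHalfPlane.denom, hd] using this
  have h1 := tendsto_div_pow (hasSum_taylor_mul_pow hφ (γ • τ)) (fun l hl => h0 l hl (γ • τ))
  have h2 := tendsto_div_pow (hasSum_taylor_mul_pow hφ τ) (fun l hl => h0 l hl τ)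
  have hscale : Tendsto (fun z : ℂ => z / d) (𝓝[≠] 0) (𝓝[≠] 0) := by
    refine tendsto_nhdsWithin_iff.2 ⟨?_, ?_⟩
    · have : Tendsto (fun z : ℂ => z / d) (𝓝 0) (𝓝 (0 / d)) :=
        (continuous_id.div_const d).tendsto 0
      rw [zero_div] at this
      exact this.mono_left nhdsWithin_le_nhds
    · filter_upwards [self_mem_nhdsWithin] with z hz
      exact div_ne_zero hz hd0
  have h3 := h1.comp hscale
  have hE : Tendsto (fun z : ℂ => e (m * (γ 1 0 * z ^ 2 / d))) (𝓝[≠] 0) (𝓝 1) := by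
    have : Tendsto (fun z : ℂ => e (m * (γ 1 0 * z ^ 2 / d))) (𝓝 0)
        (𝓝 (e (m * (γ 1 0 * 0 ^ 2 / d)))) :=
      (continuous_e.comp
        (by fun_prop : Continuous fun z : ℂ => (m : ℂ) * (γ 1 0 * z ^ 2 / d))).tendsto 0
    simp only [ne_eq, OfNat.ofNat_ne_zero, not_false_eq_true, zero_pow, mul_zero, zero_div,
      e_zero] at this
    exact this.mono_left nhdsWithin_le_nhds
  have h4 := ((hE.const_mul (d ^ (k + ν))).mul h2)
  rw [mul_one] at h4
  refine tendsto_nhds_unique (h3.congr fun z => ?_) h4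
  simp only [Function.comp_apply]
  rw [hd, jacobi_smul hφ, ← hd, zpow_add₀ hd0, zpow_natCast, div_pow]
  field_simp

end Taylor

/-! ### From Jacobi forms to elliptic modular forms -/

section Modular

variable {k : ℤ} {m : ℕ} {φ ψ : ℍ × ℂ → ℂ}

theorem mdifferentiable_taylor (hφ : φ ∈ jacobiForms k m) (ν : ℕ) : MDiff (taylor ν φ) := by
  rw [UpperHalfPlane.mdifferentiable_iff]
  intro w hw
  have hw0 : 0 < w.im := hw
  set U : Set ℂ := {v | w.im / 2 < v.im} with hU
  have hUo : IsOpen U := isOpen_lt continuous_const Complex.continuous_im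
  have hwU : w ∈ U := half_lt_self hw0
  have hd : DifferentiableOn ℂ (fun v : ℂ => ∑' p : ℤ × ℤ, coeff p.1 p.2 φ *
      ((2 * Real.pi * Complex.I * p.2) ^ ν / ν.factorial) * e (p.1 * v)) U := by
    refine Complex.differentiableOn_tsum_of_summable_norm
      (summable_norm_coeff hφ (half_pos hw0) 1) (fun p => ?_) hUo fun p v hv => ?_
    · exact ((differentiable_e.comp (differentiable_id.const_mul (p.1 : ℂ))).const_mul
        _).differentiableOn
    · refine (norm_taylor_term_le p ν v).trans ?_
      by_cases hp : 0 ≤ p.1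
      · have hv' : w.im / 2 < v.im := hv
        have hp' : (0 : ℝ) ≤ p.1 := by exact_mod_cast hp
        gcongr
      · rw [hφ.2.2.1 p.1 p.2 fun h => hp h.1]
        simp
  refine ((hd.differentiableAt (hUo.mem_nhds hwU)).congr_of_eventuallyEq ?_).differentiableWithinAt
  filter_upwards [hUo.mem_nhds hwU] with v hv
  have hv' : 0 < v.im := (half_pos hw0).trans hv
  simp only [Function.comp_apply, taylor, ofComplex_apply_of_im_pos hv', UpperHalfPlane.coe_mk]

/-- Every exponent `n` which occurs in a Jacobi form of order at least `j` satisfies `n ≥ j`. -/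
theorem isBigO_taylor (hφ : φ ∈ jacobiForms k m) {j : ℕ} (hj : (j : ℕ∞) ≤ ord φ) (ν : ℕ) :
    taylor ν φ =O[atImInfty] fun τ => ModularForm.discriminant τ ^ j := by
  refine Asymptotics.IsBigO.trans ?_ (ModularForm.exp_isBigO_discriminant.pow j)
  set S : ℝ := ∑' p : ℤ × ℤ, ‖coeff p.1 p.2 φ‖ *
      (Real.exp (-(2 * Real.pi * (p.1 * 1))) * Real.exp (2 * Real.pi * (|(p.2 : ℝ)| * 1))) with hS
  have hsum := summable_norm_coeff hφ one_pos 1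
  refine Asymptotics.IsBigO.of_bound (Real.exp (2 * Real.pi * j) * S) ?_
  filter_upwards [(UpperHalfPlane.atImInfty_mem {τ : ℍ | 1 ≤ τ.im}).2 ⟨1, fun _ h => h⟩] with τ hτ
  have hτ1 : 1 ≤ τ.im := hτ
  rw [norm_pow, Real.norm_of_nonneg (Real.exp_pos _).le, ← Real.exp_nat_mul, mul_right_comm,
    ← Real.exp_add, hS, ← tsum_mul_left]
  refine tsum_of_norm_bounded (hsum.mul_left _).hasSum fun p => (norm_taylor_term_le p ν τ).trans ?_
  have hp : coeff p.1 p.2 φ = 0 ∨ (j : ℤ) ≤ p.1 := by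
    by_cases h0 : 0 ≤ p.1
    · obtain ⟨n, hn⟩ := Int.eq_ofNat_of_zero_le h0
      rw [hn]
      rcases lt_or_ge n j with h | h
      · exact Or.inl (le_ord_iff.1 hj n h p.2)
      · exact Or.inr (by exact_mod_cast h)
    · exact Or.inl (hφ.2.2.1 p.1 p.2 fun h => h0 h.1)
  rcases hp with hp | hp
  · simp [hp]
  · have hp' : (j : ℝ) ≤ p.1 := by exact_mod_cast hp
    rw [mul_left_comm _ ‖_‖, ← mul_assoc (Real.exp (2 * Real.pi * j + _)),
      ← Real.exp_add (2 * Real.pi * j + _)]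
    gcongr
    have : (0 : ℝ) ≤ 2 * Real.pi * ((p.1 - j) * (τ.im - 1)) := by
      have h1 : 0 ≤ (p.1 : ℝ) - j := by linarith
      have h2 : 0 ≤ τ.im - 1 := by linarith
      positivity
    simp only [UpperHalfPlane.coe_im]
    nlinarith

/-- The Jacobi forms `φ` of order at least `j` for which `φ(τ, z)` vanishes at `z = 0` to order at
least `ν`. -/
noncomputable def vanishing (k : ℤ) (m j ν : ℕ) : Submodule ℂ (ℍ × ℂ → ℂ) where
  carrier := {φ | φ ∈ jacobiFormsOrd k m j ∧ ∀ μ < ν, ∀ τ, taylor μ φ τ = 0}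
  add_mem' := by
    rintro φ ψ ⟨h1, h2⟩ ⟨h1', h2'⟩
    refine ⟨add_mem h1 h1', fun μ hμ τ => ?_⟩
    rw [taylor_add h1.1 h1'.1, h2 μ hμ, h2' μ hμ, add_zero]
  zero_mem' := ⟨zero_mem _, fun μ _ τ => taylor_zero μ τ⟩
  smul_mem' := by
    rintro c φ ⟨h1, h2⟩
    refine ⟨Submodule.smul_mem _ c h1, fun μ hμ τ => ?_⟩
    rw [taylor_smul h1.1, h2 μ hμ, mul_zero]

theorem taylor_div_slash {j ν : ℕ} (hφ : φ ∈ vanishing k m j ν) (γ : SL(2, ℤ)) :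
    (fun τ => taylor ν φ τ / ModularForm.discriminant τ ^ j) ∣[k + ν - 12 * j] γ =
      fun τ => taylor ν φ τ / ModularForm.discriminant τ ^ j := by
  ext τ
  have hΔ : ModularForm.discriminant (γ • τ) =
      ((γ 1 0 : ℂ) * τ + γ 1 1) ^ (12 : ℤ) * ModularForm.discriminant τ := by
    have := congrFun (SlashInvariantForm.slash_action_eqn CuspForm.discriminant
      (γ : GL (Fin 2) ℝ) ⟨γ, rfl⟩) τ
    exact (ModularForm.slash_action_eq'_iff 12 _ γ τ).1 this
  have hd0 : (γ 1 0 : ℂ) * τ + γ 1 1 ≠ 0 := by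
    have := UpperHalfPlane.denom_ne_zero (γ : GL (Fin 2) ℝ) τ
    simpa [UpperHalfPlane.denom] using this
  rw [ModularForm.slash_action_eq'_iff, taylor_smul_eq hφ.1.1 hφ.2, hΔ, mul_pow, ← zpow_natCast
    (_ ^ (12 : ℤ)), ← _root_.zpow_mul, zpow_sub₀ hd0]
  ring

/-- The first non-vanishing Taylor coefficient of a Jacobi form of order at least `j`, divided by
`Δ^j`, as an elliptic modular form. -/
noncomputable def taylorForm (k : ℤ) (m j ν : ℕ) :
    vanishing k m j ν →ₗ[ℂ] ModularForm 𝒮ℒ (k + ν - 12 * j) where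
  toFun φ :=
    { toFun := fun τ => taylor ν φ τ / ModularForm.discriminant τ ^ j
      slash_action_eq' := fun _ ⟨γ, hγ⟩ => hγ ▸ taylor_div_slash φ.2 γ
      holo' := (mdifferentiable_taylor φ.2.1.1 ν).div (CuspForm.discriminant.holo'.pow j)
        fun τ => pow_ne_zero _ (ModularForm.discriminant_ne_zero τ)
      bdd_at_cusps' := fun {c} hc => by
        rw [Subgroup.IsArithmetic.isCusp_iff_isCusp_SL2Z] at hc
        rw [OnePoint.isBoundedAt_iff_forall_SL2Z hc]
        intro γ _
        rw [taylor_div_slash φ.2 γ, IsBoundedAtImInfty, BoundedAtFilter]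
        exact (Asymptotics.div_isBoundedUnder_of_isBigO
          (isBigO_taylor φ.2.1.1 φ.2.1.2 ν)).isBigO_one ℝ }
  map_add' φ ψ := by
    ext τ
    change taylor ν (φ.1 + ψ.1) τ / _ = taylor ν φ τ / _ + taylor ν ψ τ / _
    rw [taylor_add φ.2.1.1 ψ.2.1.1, add_div]
  map_smul' c φ := by
    ext τ
    change taylor ν (c • φ.1) τ / _ = c * (taylor ν φ τ / _)
    rw [taylor_smul φ.2.1.1, mul_div_assoc]

/-- The kernel of `taylorForm` consists of the forms which vanish to one order more. -/
theorem dim_vanishing_le (k : ℤ) (m j ν : ℕ) : dim (vanishing k m j ν) ≤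
    dimM (k + ν - 12 * j) + dim (vanishing k m j (ν + 1)) := by
  refine (dim_le_ker_add (taylorForm k m j ν)).trans (add_le_add le_rfl ?_)
  refine dim_le_of_injective (LinearMap.codRestrict _
    ((vanishing k m j ν).subtype.comp (taylorForm k m j ν).ker.subtype) fun φ => ?_) ?_
  · refine ⟨φ.1.2.1, fun μ hμ τ => ?_⟩
    rcases (Nat.lt_succ_iff.1 hμ).lt_or_eq with h | rfl
    · exact φ.1.2.2 μ h τ
    · have h0 : taylorForm k m j μ φ.1 = 0 := φ.2
      have h1 : taylor μ φ.1.1 τ / ModularForm.discriminant τ ^ j = 0 := DFunLike.congr_fun h0 τ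
      exact (div_eq_zero_iff.1 h1).resolve_right
        (pow_ne_zero _ (ModularForm.discriminant_ne_zero τ))
  · intro φ ψ h
    have h1 : (φ.1.1 : ℍ × ℂ → ℂ) = ψ.1.1 := congrArg (fun χ : vanishing k m j (ν + 1) => χ.1) h
    exact Subtype.ext (Subtype.ext h1)

theorem vanishing_zero (k : ℤ) (m j : ℕ) : vanishing k m j 0 = jacobiFormsOrd k m j :=
  le_antisymm (fun _ h => h.1) fun _ h => ⟨h, fun μ hμ => absurd hμ μ.not_lt_zero⟩

theorem vanishing_succ {k : ℤ} {ν : ℕ} (h : Odd (k + ν)) (m j : ℕ) :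
    vanishing k m j (ν + 1) = vanishing k m j ν := by
  refine le_antisymm (fun φ hφ => ⟨hφ.1, fun μ hμ => hφ.2 μ (hμ.trans ν.lt_succ_self)⟩)
    fun φ hφ => ⟨hφ.1, fun μ hμ τ => ?_⟩
  rcases (Nat.lt_succ_iff.1 hμ).lt_or_eq with h1 | rfl
  · exact hφ.2 μ h1 τ
  · exact taylor_eq_zero_of_odd hφ.1.1 h τ

end Modular

/-! ### A Jacobi form is determined by finitely many Taylor coefficients -/

section Determined

variable {k : ℤ} {m : ℕ} {φ : ℍ × ℂ → ℂ}

/-- Comparison of the coefficients of `e(nτ)` in the identity `taylor ν φ = 0`. -/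
theorem tsum_coeff_mul_pow (hφ : φ ∈ jacobiForms k m) {ν : ℕ} (h : ∀ τ, taylor ν φ τ = 0) (n : ℤ) :
    ∑' r : ℤ, coeff n r φ * (r : ℂ) ^ ν = 0 := by
  set b : ℤ → ℂ := fun n => ∑' r : ℤ, coeff n r φ *
    ((2 * Real.pi * Complex.I * r) ^ ν / ν.factorial) * e (n * Complex.I) with hb
  have hb0 : b = 0 := by
    refine HasSum.unique_int (f := fun _ => 0) (fun x => ?_) fun x => by simp
    have h1 := hasSum_taylor hφ ν (x +ᵥ UpperHalfPlane.I)
    rw [h] at h1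
    refine h1.prod_fiberwise fun n => ?_
    have h2 : Summable fun r : ℤ => coeff n r φ *
        ((2 * Real.pi * Complex.I * r) ^ ν / ν.factorial) * e (n * Complex.I) := by
      have h3 := (hasSum_taylor hφ ν UpperHalfPlane.I).summable.comp_injective
        (i := fun r : ℤ => (n, r)) (fun r s hrs => congrArg Prod.snd hrs)
      exact h3
    refine (h2.hasSum.mul_right (e (n * x))).congr_fun fun r => ?_
    simp only
    rw [mul_assoc _ (e _), ← e_add]
    congr 2
    simp
    ring
  have hbn : b n = (∑' r : ℤ, coeff n r φ * (r : ℂ) ^ ν) *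
      ((2 * Real.pi * Complex.I) ^ ν / ν.factorial * e (n * Complex.I)) := by
    rw [hb, ← tsum_mul_right]
    refine tsum_congr fun r => ?_
    rw [mul_pow _ (r : ℂ)]
    ring
  rw [hb0, Pi.zero_apply] at hbn
  refine (mul_eq_zero.1 hbn.symm).resolve_right (mul_ne_zero (div_ne_zero (pow_ne_zero _ ?_) ?_)
    (e_ne_zero _))
  · exact Complex.two_pi_I_ne_zero
  · exact_mod_cast ν.factorial_ne_zero

/-- A family on a finite set of integers whose first moments vanish is zero (Vandermonde). -/
theorem eq_zero_of_moments {s : Finset ℤ} {c : ℤ → ℂ}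
    (h : ∀ i < s.card, ∑ r ∈ s, c r * (r : ℂ) ^ i = 0) {r : ℤ} (hr : r ∈ s) : c r = 0 := by
  have key := Matrix.eq_zero_of_forall_pow_sum_mul_pow_eq_zero
    (f := fun i : Fin s.card => ((s.equivFin.symm i : ℤ) : ℂ))
    (v := fun i => c (s.equivFin.symm i))
    (fun i j hij => s.equivFin.symm.injective (Subtype.ext (Int.cast_injective hij))) fun i => by
      rw [← h i i.2, ← Finset.sum_coe_sort s]
      exact s.equivFin.symm.sum_comp fun r : s => c r * ((r : ℤ) : ℂ) ^ (i : ℕ)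
  simpa using congrFun key (s.equivFin ⟨r, hr⟩)

/-- If the coefficients `c(n', r)` with `n' < n` vanish, then `c(n, r) = 0` for `|r| > m`:
the elliptic transformation moves such a pair `(n, r)` to one with a smaller first entry. -/
theorem coeff_eq_zero_of_lt_abs (hφ : φ ∈ jacobiForms k m) {n : ℤ}
    (h : ∀ n' < n, ∀ r, coeff n' r φ = 0) {r : ℤ} (hr : (m : ℤ) < |r|) : coeff n r φ = 0 := by
  rcases abs_choice r with h1 | h1
  · rw [← coeff_add_mul hφ n r (-1)]
    exact h _ (by linarith) _
  · rw [← coeff_add_mul hφ n r 1]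
    exact h _ (by linarith) _

theorem eq_zero_of_coeff (hφ : φ ∈ jacobiForms k m) (h : ∀ n r, coeff n r φ = 0) : φ = 0 := by
  ext p
  have h1 := hφ.2.2.2 p.1 p.2
  simp only [h, zero_mul] at h1
  exact h1.unique hasSum_zero

/-- If in each row the support of the Fourier coefficients is contained in a set with `D`
elements as soon as all earlier rows vanish, then the first `D` Taylor coefficients determine
the Jacobi form. -/
theorem eq_zero_of_taylor (hφ : φ ∈ jacobiForms k m) (s : Finset ℤ)
    (hs : ∀ n, (∀ n' < n, ∀ r, coeff n' r φ = 0) → ∀ r ∉ s, coeff n r φ = 0)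
    (h : ∀ μ < s.card, ∀ τ, taylor μ φ τ = 0) : φ = 0 := by
  refine eq_zero_of_coeff hφ ?_
  have hneg : ∀ n < 0, ∀ r, coeff n r φ = 0 := fun n hn r =>
    hφ.2.2.1 n r fun h => absurd h.1 (by omega)
  have key : ∀ N : ℕ, ∀ n < (N : ℤ), ∀ r, coeff n r φ = 0 := by
    intro N
    induction N with
    | zero => simpa using hneg
    | succ N ih =>
      intro n hn r
      rcases (Int.lt_add_one_iff.1 (by exact_mod_cast hn : n < (N : ℤ) + 1)).lt_or_eq with h1 | rfl
      · exact ih n h1 r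
      · by_cases hr : r ∈ s
        · refine eq_zero_of_moments (c := fun r => coeff N r φ) (fun i hi => ?_) hr
          rw [← tsum_coeff_mul_pow hφ (h i hi) N]
          refine (tsum_eq_sum fun r hr => ?_).symm
          rw [hs _ ih r hr, zero_mul]
        · exact hs _ ih r hr
  intro n r
  exact key (n.toNat + 1) n (by push_cast; have := Int.self_le_toNat n; omega) r

theorem vanishing_eq_bot (k : ℤ) (m j : ℕ) : vanishing k m j (2 * m + 1) = ⊥ := by
  refine (Submodule.eq_bot_iff _).2 fun φ hφ => ?_
  refine eq_zero_of_taylor hφ.1.1 (Finset.Icc (-(m : ℤ)) m) (fun n hn r hr => ?_) fun μ hμ => ?_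
  · refine coeff_eq_zero_of_lt_abs hφ.1.1 hn ?_
    rw [Finset.mem_Icc, ← abs_le] at hr
    exact not_le.1 hr
  · refine hφ.2 μ ?_
    rw [Int.card_Icc] at hμ
    omega

/-- In odd weight the Fourier coefficients are odd in `r`, so that also those with `r = ±m`
vanish in the first non-zero row, where they agree by the elliptic transformation. -/
theorem vanishing_eq_bot_of_odd {k : ℤ} (hk : Odd k) (m j : ℕ) :
    vanishing k m j (2 * m - 1) = ⊥ := by
  refine (Submodule.eq_bot_iff _).2 fun φ hφ => ?_
  have hodd : ∀ n r, coeff n (-r) φ = -coeff n r φ := fun n r => by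
    rw [coeff_neg hφ.1.1, hk.neg_one_zpow, neg_one_mul]
  refine eq_zero_of_taylor hφ.1.1 (Finset.Ioo (-(m : ℤ)) m) (fun n hn r hr => ?_) fun μ hμ => ?_
  · rw [Finset.mem_Ioo, ← abs_lt, not_lt] at hr
    rcases hr.lt_or_eq with hr | hr
    · exact coeff_eq_zero_of_lt_abs hφ.1.1 hn hr
    · have h1 := coeff_add_mul hφ.1.1 n m (-1)
      have h2 : n + -1 * (m : ℤ) + (-1) ^ 2 * m = n := by ring
      have h3 : (m : ℤ) + 2 * -1 * m = -m := by ring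
      rw [h2, h3, hodd] at h1
      have h4 : coeff n m φ = 0 := self_eq_neg.1 h1.symm
      rcases abs_choice r with h5 | h5
      · rw [← h5, ← hr, h4]
      · rw [← neg_neg r, ← h5, ← hr, hodd, h4, neg_zero]
  · refine hφ.2 μ ?_
    rw [Int.card_Ioo] at hμ
    omega

theorem dim_jacobiFormsOrd_le_of_even {k : ℤ} (hk : Even k) (m j : ℕ) :
    dim (jacobiFormsOrd k m j) ≤ ∑ i ∈ Finset.Icc 0 m, dimM (k + 2 * i - 12 * j) := by
  have key : ∀ n : ℕ, dim (vanishing k m j 0) ≤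
      ∑ i ∈ Finset.range n, dimM (k + 2 * i - 12 * j) + dim (vanishing k m j (2 * n)) := by
    intro n
    induction n with
    | zero => simp
    | succ n ih =>
      refine ih.trans ?_
      have hodd : Odd (k + (2 * n + 1 : ℕ)) :=
        hk.add_odd (by push_cast; exact odd_two_mul_add_one _)
      rw [Finset.sum_range_succ, add_assoc, Nat.mul_succ, vanishing_succ hodd]
      refine add_le_add le_rfl ((dim_vanishing_le k m j (2 * n)).trans (le_of_eq ?_))
      push_cast
      rfl
  have h := key m
  have h1 := dim_vanishing_le k m j (2 * m)
  rw [vanishing_eq_bot, dim_eq_zero (V := (⊥ : Submodule ℂ (ℍ × ℂ → ℂ))), add_zero] at h1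
  rw [vanishing_zero] at h
  refine h.trans ?_
  rw [← Nat.range_succ_eq_Icc_zero, Finset.sum_range_succ]
  refine add_le_add le_rfl (h1.trans (le_of_eq ?_))
  push_cast
  rfl

theorem dim_jacobiFormsOrd_le_of_odd {k : ℤ} (hk : Odd k) (m j : ℕ) :
    dim (jacobiFormsOrd k m j) ≤ ∑ i ∈ Finset.Icc 1 (m - 1), dimM (k - 1 + 2 * i - 12 * j) := by
  have key : ∀ n : ℕ, dim (vanishing k m j 1) ≤
      ∑ i ∈ Finset.Icc 1 n, dimM (k - 1 + 2 * i - 12 * j) + dim (vanishing k m j (2 * n + 1)) := by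
    intro n
    induction n with
    | zero => simp
    | succ n ih =>
      refine ih.trans ?_
      have hodd : Odd (k + (2 * (n + 1) : ℕ)) := hk.add_even (by push_cast; exact even_two_mul _)
      rw [Finset.sum_Icc_succ_top (by omega), add_assoc, vanishing_succ hodd]
      refine add_le_add le_rfl ((dim_vanishing_le k m j (2 * n + 1)).trans (le_of_eq ?_))
      congr 2
      push_cast
      ring
  have h1 := vanishing_succ (k := k) (ν := 0) (by simpa using hk) m j
  rw [← vanishing_zero, ← h1]
  refine (key (m - 1)).trans (le_of_eq ?_)
  have hbot : vanishing k m j (2 * (m - 1) + 1) = ⊥ := by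
    rw [eq_bot_iff, ← vanishing_eq_bot_of_odd hk m j]
    exact fun φ hφ => ⟨hφ.1, fun μ hμ => hφ.2 μ (by omega)⟩
  rw [hbot, dim_eq_zero, add_zero]

theorem dim_jacobiFormsOrd_zero_of_odd {k : ℤ} (hk : Odd k) (j : ℕ) :
    dim (jacobiFormsOrd k 0 j) = 0 := by
  simpa using dim_jacobiFormsOrd_le_of_odd hk 0 j

end Determined

end Paramodular

open Paramodular in
theorem lemma3p2 (N : ℕ) [NeZero N] (ε : ℤˣ) (k : ℤ) :
    dim (paramodularFormsSign N k ε) ≤ dim (formalForms N k ε) ∧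
    dim (formalForms N k ε) ≤
      ∑' j : ℕ, dim (formalFormsFil N k ε j ⧸
        (formalFormsFil N k ε (j + 1)).submoduleOf (formalFormsFil N k ε j)) ∧
    ∑' j : ℕ, dim (formalFormsFil N k ε j ⧸
        (formalFormsFil N k ε (j + 1)).submoduleOf (formalFormsFil N k ε j)) ≤
      ∑' j : ℕ, dim (jacobiFormsOrd k (N * j) (j + delta k ε)) ∧
    (Even k → ∑' j : ℕ, dim (jacobiFormsOrd k (N * j) (j + delta k ε)) ≤
      ∑' j : ℕ, ∑ i ∈ Finset.Icc 0 (N * j), dimM (k + 2 * i - 12 * (j + delta k ε))) ∧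
    (Odd k → ∑' j : ℕ, dim (jacobiFormsOrd k (N * j) (j + delta k ε)) ≤
      ∑' j : ℕ+, ∑ i ∈ Finset.Icc 1 (N * (j : ℕ) - 1),
        dimM (k - 1 + 2 * i - 12 * ((j : ℕ) + delta k ε))) := by
  have hmono : ∀ f g : ℕ → ℕ∞, (∀ j, f j ≤ g j) → ∑' j, f j ≤ ∑' j, g j := fun f g h =>
    (hasSum_enat f).summable.tsum_le_tsum h (hasSum_enat g).summable
  refine ⟨dim_paramodularFormsSign_le, dim_formalForms_le, hmono _ _ dim_graded_le,
    fun hk => hmono _ _ fun j => ?_, fun hk => ?_⟩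
  · exact_mod_cast dim_jacobiFormsOrd_le_of_even hk (N * j) (j + delta k ε)
  · -- the term `j = 0` of the left hand side vanishes
    rw [tsum_pnat_eq_tsum_succ (f := fun j : ℕ => ∑ i ∈ Finset.Icc 1 (N * j - 1),
      dimM (k - 1 + 2 * i - 12 * ((j : ℤ) + delta k ε)))]
    have h0 : dim (jacobiFormsOrd k (N * 0) (0 + delta k ε)) = 0 :=
      dim_jacobiFormsOrd_zero_of_odd hk _
    rw [tsum_eq_zero_add' (hasSum_enat _).summable, h0, zero_add]
    refine hmono _ _ fun j => ?_
    exact_mod_cast dim_jacobiFormsOrd_le_of_odd hk (N * (j + 1)) (j + 1 + delta k ε)
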